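/- Let $G$ be a compact connected Lie group with Lie algebra $\mathfrak g$ and an $\mathrm{Ad}$-invariant inner product $\langle\cdot,\cdot\rangle$ on $\mathfrak g$. Let $\mathcal A=C^1([0,1],\mathfrak g)\otimes\mathbb R^4$, and let $\mathcal A_{NS}\subset\mathcal A$ be the set of solutions $\mathcal T=(T_0,T_1,T_2,T_3)$ of the Nahm--Schmid equations $$\dot T_1+[T_0,T_1]=-[T_2,T_3],\qquad \dot T_2+[T_0,T_2]=[T_3,T_1],\qquad \dot T_3+[T_0,T_3]=[T_1,T_2].$$ The group $\mathcal G_{00}=\{u\in C^2([0,1],G): u(0)=1=u(1)\}$ acts by $u.\mathcal T=(uT_0u^{-1}-\dot uu^{-1},uT_1u^{-1},uT_2u^{-1},uT_3u^{-1})$, and $\mathcal M=\mathcal A_{NS}/\mathcal G_{00}$, with the smooth structure for which $\mathcal A_{NS}\to\mathcal M$ is a submersion. On $\mathcal A$ consider the indefinite metric $$g(X,Y)=\int_0^1\langle X_0,Y_0\rangle+\langle X_1,Y_1\rangle-\langle X_2,Y_2\rangle-\langle X_3,Y_3\rangle\,dt,$$ the endomorphisms $I(X_0,X_1,X_2,X_3)=(X_1,-X_0,-X_3,X_2)$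 and $S(X_0,X_1,X_2,X_3)=(X_2,X_3,X_0,X_1)$, and the form $\omega_I=g(I\cdot,\cdot)$. Let $\mathcal D\subset\mathcal A_{NS}$ be the set of solutions at which $g$ is degenerate on the tangent space of the $\mathcal G_{00}$-orbit, and $\mathcal M^0=(\mathcal A_{NS}\setminus\mathcal D)/\mathcal G_{00}$. The tangent space $\mathrm T_{\mathcal T}\mathcal M^0$ is identified with the space of solutions $X\in C^1([0,1],\mathfrak g)\otimes\mathbb R^4$ of the Nahm--Schmid equations linearised at $\mathcal T$ together with $$\dot X_0+[T_0,X_0]+[T_1,X_1]-[T_2,X_2]-[T_3,X_3]=0;$$ it is invariant under $S$, and $\omega_I$ and $S$ on $\mathcal M^0$ are given by the above formulas on these spaces. Let $\omega_{\mathrm T^*G}=-d\theta=\sum dq_i\wedge dp_i$ be the canonical symplectic form of $\mathrm T^*G$ ($\theta$ the tautological $1$-form), and identify $G\times\mathfrak g$ with $\mathrm T^*G$ by sending $(\gamma,\xi)$ to the covector $v\mapsto\tfrac12\langle\xi,\gamma^{-1}v\rangle$ at $\gamma$. To a pair $(A,B)$ of $C^1$-functions $[0,1]\to\mathfrak g$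 associate the point $(u(1),B(0))\in G\times\mathfrak g\cong \mathrm T^*G$, where $u$ is the unique solution of $A=-\dot uu^{-1}$, $u(0)=1$. **Proposition.** The linear map $P(T_0,T_1,T_2,T_3)=\big((T_0+T_2,T_1+T_3),(T_0-T_2,T_1-T_3)\big)$, followed by the map $(A,B)\mapsto(u(1),B(0))$ on each of the two pairs, descends to a map $\Phi:\mathcal M\to \mathrm T^*G\times \mathrm T^*G$. There are an open set $U$ with $\{T_2=T_3\equiv0\}\subset U\subset\mathcal M^0$ and an open neighbourhood $V$ of the diagonal in $\mathrm T^*G\times \mathrm T^*G$ such that $\Phi$ restricts to a diffeomorphism $U\to V$ with $\Phi^*(\omega_{\mathrm T^*G}\oplus\omega_{\mathrm T^*G})=\omega_I$. Moreover $d\Phi\circ S=(\mathrm{id}\oplus(-\mathrm{id}))\circ d\Phi$ on $U$, i.e. $\Phi$ is compatible with the product structure $S$ on $\mathcal M^0$ and the product structure of $\mathrm T^*G\times \mathrm T^*G$. -/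

import Mathlib

open Set Filter Topology MeasureTheory Bundle
open scoped Manifold ContDiff

namespace NahmSchmid

noncomputable section

/-! ## The Lie algebra of a Lie group

`G` is a Lie group modelled on the normed space `E`. In Mathlib the tangent space
`T₁G = GroupLieAlgebra 𝓘(ℝ, E) G` is, as a vector space, the model space `E` (through the preferred
chart at `1`), so the Lie algebra `𝔤` is written as `E` with the bracket of `GroupLieAlgebra`. -/

section LieAlgebra

variable {E : Type*} [NormedAddCommGroup E] [NormedSpace ℝ E]
  {G : Type*} [TopologicalSpace G] [ChartedSpace E G] [Group G]

variable (G) in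
/-- The Lie bracket of `𝔤 = T₁G` (bracket of left-invariant vector fields). -/
def br (x y : E) : E :=
  let x' : GroupLieAlgebra 𝓘(ℝ, E) G := x
  let y' : GroupLieAlgebra 𝓘(ℝ, E) G := y
  (⁅x', y'⁆ : GroupLieAlgebra 𝓘(ℝ, E) G)

/-- The adjoint action `Ad g = d(x ↦ g x g⁻¹)₁ : 𝔤 → 𝔤`, written `g X g⁻¹` for matrix groups. -/
def Ad (g : G) : E →L[ℝ] E :=
  mfderiv 𝓘(ℝ, E) 𝓘(ℝ, E) (fun x : G => g * x * g⁻¹) (1 : G)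

/-- The right logarithmic derivative `u̇ u⁻¹ ∈ 𝔤` at time `t ∈ [0,1]` of a curve `u` in `G`:
the velocity at `s = t` of the curve `s ↦ u(s) u(t)⁻¹`, which passes through `1`. -/
def logVel (u : ℝ → G) (t : ℝ) : E :=
  mfderivWithin 𝓘(ℝ, ℝ) 𝓘(ℝ, E) (fun s : ℝ => u s * (u t)⁻¹) (Icc 0 1) t (1 : ℝ)

end LieAlgebra

/-- An `Ad`-invariant inner product on the Lie algebra of `G`. -/
structure AdInvariantInner (E : Type*) [NormedAddCommGroup E] [NormedSpace ℝ E]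
    (G : Type*) [TopologicalSpace G] [ChartedSpace E G] [Group G] where
  form : E →L[ℝ] E →L[ℝ] ℝ
  symm : ∀ x y, form x y = form y x
  pos : ∀ x, x ≠ 0 → 0 < form x x
  invariant : ∀ (g : G) (x y : E), form (Ad g x) (Ad g y) = form x y

/-! ## The Banach space `C¹([0,1], 𝔤)` and the space `𝒜` of configurations -/

section Paths

variable (E : Type*) [NormedAddCommGroup E] [NormedSpace ℝ E]

/-- The pairs `(f, ḟ)` of continuous functions on `[0,1]` such that `ḟ` is the derivative of `f`
(one-sided at the end points). -/
def c1Submodule : Submodule ℝ (C(unitInterval, E) × C(unitInterval, E)) where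
  carrier := {p | ∀ t : unitInterval,
    HasDerivWithinAt (IccExtend (zero_le_one' ℝ) p.1) (p.2 t) (Icc (0 : ℝ) 1) t}
  add_mem' := by
    intro p q hp hq t
    exact (hp t).add (hq t)
  zero_mem' := by
    intro t
    exact hasDerivWithinAt_const (t : ℝ) (Icc (0 : ℝ) 1) (0 : E)
  smul_mem' := by
    intro c p hp t
    exact (hp t).const_smul c

/-- `C¹([0,1], E)`, as the space of pairs `(f, ḟ)`. The norm inherited from the product is
`max (sup ‖f‖) (sup ‖ḟ‖)`, which is equivalent to the usual `C¹`-norm `sup ‖f‖ + sup ‖ḟ‖`. -/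
def C1Path : Type _ := c1Submodule E

instance : NormedAddCommGroup (C1Path E) := inferInstanceAs (NormedAddCommGroup (c1Submodule E))

instance : NormedSpace ℝ (C1Path E) := inferInstanceAs (NormedSpace ℝ (c1Submodule E))

/-- The space `𝒜` of quadruples `(T₀, T₁, T₂, T₃)` of `C¹`-functions `[0,1] → 𝔤`. -/
abbrev Config := Fin 4 → C1Path E

variable {E}

/-- The value `f(t)` of a `C¹`-function. -/
def ev (f : C1Path E) (t : unitInterval) : E := f.1.1 t

/-- The derivative `ḟ(t)` of a `C¹`-function. -/
def dv (f : C1Path E) (t : unitInterval) : E := f.1.2 t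

/-- The map `P : (T₀,T₁,T₂,T₃) ↦ ((T₀+T₂, T₁+T₃), (T₀-T₂, T₁-T₃))`. -/
def mapP (T : Config E) : (C1Path E × C1Path E) × (C1Path E × C1Path E) :=
  ((T 0 + T 2, T 1 + T 3), (T 0 - T 2, T 1 - T 3))

/-- The complex structure `I(X₀,X₁,X₂,X₃) = (X₁,-X₀,-X₃,X₂)` on `T𝒜`. -/
def cplxI (X : Config E) : Config E := ![X 1, -X 0, -X 3, X 2]

/-- The product structure `S(X₀,X₁,X₂,X₃) = (X₂,X₃,X₀,X₁)` on `T𝒜`. -/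
def prodS (X : Config E) : Config E := ![X 2, X 3, X 0, X 1]

end Paths

/-! ## Nahm-Schmid equations, gauge group, moduli space, degeneracy locus -/

section Moduli

variable (E : Type*) [NormedAddCommGroup E] [NormedSpace ℝ E]
  (G : Type*) [TopologicalSpace G] [ChartedSpace E G] [Group G]

/-- The set of solutions in `𝒜` of the Nahm-Schmid equations. -/
def Sol : Set (Config E) :=
  {T | ∀ t : unitInterval,
    dv (T 1) t + br G (ev (T 0) t) (ev (T 1) t) = -br G (ev (T 2) t) (ev (T 3) t) ∧
    dv (T 2) t + br G (ev (T 0) t) (ev (T 2) t) = br G (ev (T 3) t) (ev (T 1) t) ∧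
    dv (T 3) t + br G (ev (T 0) t) (ev (T 3) t) = br G (ev (T 1) t) (ev (T 2) t)}

variable {E G} in
/-- `T' = u.T = (u T₀ u⁻¹ - u̇ u⁻¹, u T₁ u⁻¹, u T₂ u⁻¹, u T₃ u⁻¹)` on `[0,1]`. -/
def IsGaugeTransform (u : ℝ → G) (T T' : Config E) : Prop :=
  ∀ t : unitInterval,
    ev (T' 0) t = Ad (u t) (ev (T 0) t) - logVel u t ∧
    ev (T' 1) t = Ad (u t) (ev (T 1) t) ∧
    ev (T' 2) t = Ad (u t) (ev (T 2) t) ∧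
    ev (T' 3) t = Ad (u t) (ev (T 3) t)

/-- Two solutions are related if they differ by an element of the gauge group
`𝒢₀₀ = {u ∈ C²([0,1], G) | u(0) = 1 = u(1)}`. -/
def GaugeRel (T T' : Sol E G) : Prop :=
  ∃ u : ℝ → G, ContMDiffOn 𝓘(ℝ, ℝ) 𝓘(ℝ, E) 2 u (Icc 0 1) ∧ u 0 = 1 ∧ u 1 = 1 ∧
    IsGaugeTransform u T.1 T'.1

/-- The moduli space `ℳ` of solutions modulo `𝒢₀₀`, with the quotient topology of the
`C¹`-topology on solutions. -/
abbrev Moduli : Type _ := Quot (GaugeRel E G)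

/-- The projection from solutions to the moduli space. -/
abbrev proj (T : Sol E G) : Moduli E G := Quot.mk _ T

variable {E}

/-- The tangent space at `T` of the `𝒢₀₀`-orbit of `T`: the vectors
`X^ξ = (-ξ̇ + [ξ,T₀], [ξ,T₁], [ξ,T₂], [ξ,T₃])` with `ξ ∈ C²([0,1], 𝔤)`, `ξ(0) = 0 = ξ(1)`.
(Here `ξ'` is the `C¹`-function `ξ̇`.) -/
def orbitTangent (T : Config E) : Set (Config E) :=
  {X | ∃ ξ ξ' : C1Path E, (∀ t, ev ξ' t = dv ξ t) ∧ ev ξ 0 = 0 ∧ ev ξ 1 = 0 ∧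
    ∀ t, ev (X 0) t = -dv ξ t + br G (ev ξ t) (ev (T 0) t) ∧
      ev (X 1) t = br G (ev ξ t) (ev (T 1) t) ∧
      ev (X 2) t = br G (ev ξ t) (ev (T 2) t) ∧
      ev (X 3) t = br G (ev ξ t) (ev (T 3) t)}

variable {G}

/-- The indefinite metric `g(X,Y) = ∫₀¹ ⟨X₀,Y₀⟩ + ⟨X₁,Y₁⟩ - ⟨X₂,Y₂⟩ - ⟨X₃,Y₃⟩ dt` on `𝒜`. -/
def metric (B : AdInvariantInner E G) (X Y : Config E) : ℝ :=
  ∫ t : unitInterval, (B.form (ev (X 0) t) (ev (Y 0) t) + B.form (ev (X 1) t) (ev (Y 1) t)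
    - B.form (ev (X 2) t) (ev (Y 2) t) - B.form (ev (X 3) t) (ev (Y 3) t))

/-- The symplectic form `ω_I(X,Y) = g(IX,Y)` on `𝒜`; its values on the tangent spaces
`Horizontal B T` below give the form `ω_I` of the hypersymplectic manifold `ℳ⁰`. -/
def omegaI (B : AdInvariantInner E G) (X Y : Config E) : ℝ := metric B (cplxI X) Y

/-- The degeneracy locus `𝒟`: the solutions `T` for which the metric is degenerate on the tangent
space of the `𝒢₀₀`-orbit through `T`. -/
def DegeneracyLocus (B : AdInvariantInner E G) : Set (Config E) :=
  {T | T ∈ Sol E G ∧ ∃ X ∈ orbitTangent G T, X ≠ 0 ∧ ∀ Y ∈ orbitTangent G T, metric B X Y = 0}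

/-- `ℳ⁰ = (solutions ∖ 𝒟) / 𝒢₀₀` as a subset of `ℳ`. -/
def M0 (B : AdInvariantInner E G) : Set (Moduli E G) :=
  proj E G '' {T | T.1 ∉ DegeneracyLocus B}

variable (E G) in
/-- The subset `{T₂ = T₃ ≡ 0}` of `ℳ`. -/
def Z : Set (Moduli E G) := proj E G '' {T | T.1 2 = 0 ∧ T.1 3 = 0}

variable (G) in
/-- The tangent space `T_{[T]} ℳ⁰`: the solutions `X` of the linearised Nahm-Schmid equations
at `T` that are `g`-orthogonal to the `𝒢₀₀`-orbit (the last equation). -/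
def Horizontal (T : Config E) : Set (Config E) :=
  {X | ∀ t : unitInterval,
    dv (X 1) t + br G (ev (T 0) t) (ev (X 1) t) + br G (ev (X 0) t) (ev (T 1) t)
      + br G (ev (T 2) t) (ev (X 3) t) + br G (ev (X 2) t) (ev (T 3) t) = 0 ∧
    dv (X 2) t + br G (ev (T 0) t) (ev (X 2) t) + br G (ev (X 0) t) (ev (T 2) t)
      - br G (ev (T 3) t) (ev (X 1) t) - br G (ev (X 3) t) (ev (T 1) t) = 0 ∧
    dv (X 3) t + br G (ev (T 0) t) (ev (X 3) t) + br G (ev (X 0) t) (ev (T 3) t)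
      - br G (ev (T 1) t) (ev (X 2) t) - br G (ev (X 1) t) (ev (T 2) t) = 0 ∧
    dv (X 0) t + br G (ev (T 0) t) (ev (X 0) t) + br G (ev (T 1) t) (ev (X 1) t)
      - br G (ev (T 2) t) (ev (X 2) t) - br G (ev (T 3) t) (ev (X 3) t) = 0}

/-! ### Smooth maps from and to the moduli space

The solution set is a submanifold of the Banach space `𝒜`, and the smooth structure of `ℳ` is the
one for which the projection from the solution set to `ℳ` is a submersion. So a map `f` from `ℳ` is
smooth near `[T]` iff its pull-back to the solution set extends smoothly to a neighbourhood of `T`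
in `𝒜`, and the differential of `f` at `[T]` is the differential of any such extension, restricted
to the tangent vectors at `T`; and a map to `ℳ` is smooth iff it has local smooth lifts to `𝒜`
with values in the solution set. -/

section Smooth

variable {E' : Type*} [NormedAddCommGroup E'] [NormedSpace ℝ E'] {H' : Type*} [TopologicalSpace H']
  (J : ModelWithCorners ℝ E' H') {N : Type*} [TopologicalSpace N] [ChartedSpace H' N]

/-- `F` is smooth at `T`, and near `T` it extends the pull-back of `f : ℳ → N` to the
solution set. -/
def IsSmoothExtensionAt (f : Moduli E G → N) (T : Sol E G) (F : Config E → N) : Prop :=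
  ContMDiffAt 𝓘(ℝ, Config E) J ∞ F T.1 ∧
    ∀ᶠ T' in 𝓝 T.1, ∀ h : T' ∈ Sol E G, F T' = f (proj E G ⟨T', h⟩)

/-- `f` restricts to a diffeomorphism from the open set `U ⊆ ℳ` onto the open set `V ⊆ N`:
a bijection which is smooth on `U` and whose inverse `V → U` is smooth. -/
def IsDiffeoOn (f : Moduli E G → N) (U : Set (Moduli E G)) (V : Set N) : Prop :=
  IsOpen U ∧ IsOpen V ∧ BijOn f U V ∧
  (∀ T : Sol E G, proj E G T ∈ U → ∃ F : Config E → N, IsSmoothExtensionAt J f T F) ∧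
  (∀ p ∈ V, ∃ σ : N → Config E, ContMDiffAt J 𝓘(ℝ, Config E) ∞ σ p ∧
    ∀ᶠ q in 𝓝 p, ∃ h : σ q ∈ Sol E G,
      proj E G ⟨σ q, h⟩ ∈ U ∧ f (proj E G ⟨σ q, h⟩) = q)

end Smooth

end Moduli

/-! ## The cotangent bundle and its canonical symplectic form -/

section Cotangent

/-- The exterior derivative `dα(v,w) = ∂_v(α(w)) - ∂_w(α(v))` of a 1-form `α` on a manifold without
boundary, computed at `x` in the preferred chart at `x` (through which Mathlib identifies `T_xN`
with the model space `E'`). -/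
def dOneForm {E' : Type*} [NormedAddCommGroup E'] [NormedSpace ℝ E'] {H' : Type*}
    [TopologicalSpace H'] (J : ModelWithCorners ℝ E' H') {N : Type*} [TopologicalSpace N]
    [ChartedSpace H' N] (α : ∀ x : N, TangentSpace J x →L[ℝ] ℝ) (x : N)
    (v w : TangentSpace J x) : ℝ :=
  let a : E' → (E' →L[ℝ] ℝ) := fun y =>
    (α ((extChartAt J x).symm y)).comp (mfderiv 𝓘(ℝ, E') J (extChartAt J x).symm y)
  fderiv ℝ a (extChartAt J x x) v w - fderiv ℝ a (extChartAt J x x) w v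

variable (E : Type*) [NormedAddCommGroup E] [NormedSpace ℝ E]
  (G : Type*) [TopologicalSpace G] [ChartedSpace E G] [IsManifold 𝓘(ℝ, E) 1 G]

/-- The cotangent bundle `T*G`, with the manifold structure of the hom-bundle `Hom(TG, ℝ)`. -/
abbrev Cotangent : Type _ :=
  TotalSpace (E →L[ℝ] ℝ) (fun x : G => TangentSpace 𝓘(ℝ, E) x →L[ℝ] Bundle.Trivial G ℝ x)

/-- The model with corners of `T*G`. -/
abbrev cotangentModel : ModelWithCorners ℝ (E × (E →L[ℝ] ℝ)) (ModelProd E (E →L[ℝ] ℝ)) :=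
  𝓘(ℝ, E).prod 𝓘(ℝ, E →L[ℝ] ℝ)

/-- The tautological 1-form `θ_p(v) = p(dπ(v))` on `T*G`. -/
def tautological (p : Cotangent E G) : TangentSpace (cotangentModel E) p →L[ℝ] ℝ :=
  (p.2 : TangentSpace 𝓘(ℝ, E) p.1 →L[ℝ] ℝ).comp
    (mfderiv (cotangentModel E) 𝓘(ℝ, E) (fun q : Cotangent E G => q.1) p)

/-- The canonical symplectic form `ω_{T*G} = -dθ` (in canonical coordinates `∑ dqᵢ ∧ dpᵢ`). -/
def omegaCot (p : Cotangent E G) (v w : TangentSpace (cotangentModel E) p) : ℝ :=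
  -dOneForm (cotangentModel E) (tautological E G) p v w

/-- The model with corners of `T*G × T*G`. -/
abbrev cotangentModel₂ := (cotangentModel E).prod (cotangentModel E)

/-- The symplectic form `ω_{T*G} ⊕ ω_{T*G}` on `T*G × T*G`. -/
def omegaCot₂ (p : Cotangent E G × Cotangent E G) (v w : TangentSpace (cotangentModel₂ E) p) : ℝ :=
  omegaCot E G p.1 (Prod.fst v) (Prod.fst w) + omegaCot E G p.2 (Prod.snd v) (Prod.snd w)

/-- The product structure `id ⊕ (-id)` on `T*G × T*G`. -/
def prodCot (p : Cotangent E G × Cotangent E G) (v : TangentSpace (cotangentModel₂ E) p) :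
    TangentSpace (cotangentModel₂ E) p :=
  (Prod.fst v, -Prod.snd v)

end Cotangent

/-! ## From solutions of `Ḃ + [A,B] = 0` to `T*G` -/

section Transport

variable {E : Type*} [NormedAddCommGroup E] [NormedSpace ℝ E]
  {G : Type*} [TopologicalSpace G] [ChartedSpace E G] [Group G]

/-- `u : [0,1] → G` is the gauge transformation with `A = -u̇ u⁻¹` and `u(0) = 1`. -/
def IsTransport (A : C1Path E) (u : ℝ → G) : Prop :=
  ContMDiffOn 𝓘(ℝ, ℝ) 𝓘(ℝ, E) 2 u (Icc 0 1) ∧ u 0 = 1 ∧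
    ∀ t : unitInterval, ev A t = -logVel u t

variable [IsManifold 𝓘(ℝ, E) 1 G]

/-- The identification `G × 𝔤 ≅ T*G` given by left translation and the inner product `½⟨·,·⟩`:
`(γ, ξ)` is the covector `v ↦ ½⟨ξ, γ⁻¹ v⟩` at `γ`. -/
def toCotangent (B : AdInvariantInner E G) (γ : G) (ξ : E) : Cotangent E G :=
  ⟨γ, (1 / 2 : ℝ) • (B.form ξ).comp (mfderiv 𝓘(ℝ, E) 𝓘(ℝ, E) (fun x : G => γ⁻¹ * x) γ)⟩

/-- `p ∈ T*G` is the point `(u(1), B(0)) ∈ G × 𝔤 ≅ T*G` associated with the pair `(A, B)`, where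
`u` is the gauge transformation with `A = -u̇ u⁻¹` and `u(0) = 1`. -/
def IsCotangentPoint (B : AdInvariantInner E G) (AB : C1Path E × C1Path E)
    (p : Cotangent E G) : Prop :=
  ∃ u : ℝ → G, IsTransport AB.1 u ∧ p = toCotangent B (u 1) (ev AB.2 0)

end Transport

end

end NahmSchmid

open Set Filter Topology MeasureTheory Bundle
open scoped Manifold ContDiff

namespace NahmSchmid

noncomputable section

set_option linter.unusedSectionVars false

/-! ## Calculus on the Banach spaces `C([0,1], F)` -/

section Paths

variable {F F' F'' : Type*} [NormedAddCommGroup F] [NormedSpace ℝ F]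
  [NormedAddCommGroup F'] [NormedSpace ℝ F'] [NormedAddCommGroup F''] [NormedSpace ℝ F'']

/-! Put A = T₀ + T₂, A' = T₀ - T₂, B = T₁ + T₃, B' = T₁ - T₃ and C = 2T₂ = A - A'. The Nahm-Schmid
equations become Ḃ = -[A,B], Ḃ' = -[A',B'], Ċ = -[A,C] + [B,B'] (`mem_Sol_iff`). Let u̇u⁻¹ = -A,
u(0) = 1. In the gauge where A vanishes, B is a constant ξ, while c = Ad(u)⁻¹C and b = Ad(u)⁻¹B'
satisfy ċ = [ξ,b], ḃ = [c,b] (`isRelSol_relPath`). A solution modulo 𝒢₀₀ is therefore the same as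
u(1) together with initial data (ξ, ξ', c₀) for which this system is solvable on [0,1]
(`gaugeRel_of_eq`, `ofRel_mem_Sol`). The holonomy of -A' is u(1)h, with h the holonomy of c
(`hol_sub_eq`), so inverting Φ means solving a boundary value problem: find c₀ from ξ, ξ' and h.

Where T₂ = T₃ = 0 one has c = 0 and b = ξ = ξ'. The linearised problem there is γ̇ = [ξ,β], β̇ =
[γ,ξ], β(0) = 0, ∫γ = 0. If η is the primitive of γ, then β = [η,ξ], and ⟨η,γ⟩ vanishes at both ends
and has derivative |γ|² + |β|²; hence γ(0) = 0 (`eq_zero_of_linearised`). So the data-to-boundary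
map `relEnd` is a local diffeomorphism at every diagonal datum (ξ, ξ, 0), and it is injective on a
neighbourhood W of all of them (`exists_relDom`). U is the set of classes with initial data in W,
and V = Φ(U). Shrinking W makes c and ξ - b small, hence T₂ and T₃ small in the invariant norm, and
a Poincaré-type estimate keeps U away from 𝒟 (`eq_zero_of_metric_eq_zero`).

For the symplectic form, the tautological form pulls back under (γ,ξ) to ½⟨ξ, γ⁻¹dγ⟩. If γ is the
holonomy of a path a, invariance turns this into ½∫⟨b, da⟩, where b is the transport of ξ along a
(`pairing_comp_eq_form_comp`). Since a depends linearly on the configuration, the exterior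
derivative involves only the variations of b, which for a tangent vector are read off from the
linearised equations (`omegaCot_mfderiv_hol`). Adding the contributions of T₀ ± T₂, T₁ ± T₃ gives
ω_I. The structure S multiplies the pair with sign s by s, which gives the statement on product
structures.

The analysis rests on one device: differential equations are fixed-point equations in C([0,1], F),
superposition operators there are smooth, and Volterra operators are quasi-nilpotent, so the
implicit function theorem yields smooth dependence on all of [0,1] (`exists_smooth_solution`). -/

instance : NormedAddCommGroup C(unitInterval, F) := inferInstance

instance : NormedSpace ℝ C(unitInterval, F) := inferInstance

/-- The extension of a path to the real line by constants. -/
abbrev ext01 (f : C(unitInterval, F)) : ℝ → F := IccExtend (zero_le_one' ℝ) f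

lemma ext01_coe (f : C(unitInterval, F)) (t : unitInterval) : ext01 f t = f t :=
  IccExtend_val _ _ _

lemma ext01_of_mem (f : C(unitInterval, F)) {t : ℝ} (ht : t ∈ Icc (0 : ℝ) 1) :
    ext01 f t = f ⟨t, ht⟩ := IccExtend_of_mem _ _ _

lemma continuous_ext01 (f : C(unitInterval, F)) : Continuous (ext01 f) :=
  f.continuous.Icc_extend'

lemma norm_ext01_le (f : C(unitInterval, F)) (t : ℝ) : ‖ext01 f t‖ ≤ ‖f‖ :=
  f.norm_coe_le_norm _

/-- The primitive `t ↦ ∫₀ᵗ f` as a bounded operator on `C([0,1], F)`. -/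
def intOp : C(unitInterval, F) →L[ℝ] C(unitInterval, F) :=
  LinearMap.mkContinuous
    { toFun := fun f => ⟨fun t => ∫ s in (0 : ℝ)..t, ext01 f s, by
        exact (intervalIntegral.continuous_primitive
          (fun a b => (continuous_ext01 f).intervalIntegrable a b) 0).comp continuous_subtype_val⟩
      map_add' := fun f g => by
        ext t
        simpa [ext01, IccExtend] using intervalIntegral.integral_add
          ((continuous_ext01 f).intervalIntegrable 0 t) ((continuous_ext01 g).intervalIntegrable 0 t)
      map_smul' := fun c f => by
        ext t
        simp [ext01, IccExtend] }
    1 (fun f => by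
      rw [one_mul, ContinuousMap.norm_le _ (norm_nonneg f)]
      intro t
      have := intervalIntegral.norm_integral_le_of_norm_le_const
        (a := 0) (b := (t : ℝ)) (f := ext01 f) (C := ‖f‖) (fun s _ => norm_ext01_le f s)
      refine this.trans ?_
      rw [sub_zero, abs_of_nonneg t.2.1]
      exact mul_le_of_le_one_right (norm_nonneg f) t.2.2)

lemma intOp_apply (f : C(unitInterval, F)) (t : unitInterval) :
    intOp f t = ∫ s in (0 : ℝ)..t, ext01 f s := rfl

@[simp] lemma intOp_zero_apply (f : C(unitInterval, F)) : intOp f 0 = 0 := by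
  simp [intOp_apply]

/-- `x'` is the derivative of the path `x` on `[0,1]`. -/
def HasDerivPath (x x' : C(unitInterval, F)) : Prop :=
  ∀ t : unitInterval, HasDerivWithinAt (ext01 x) (x' t) (Icc (0 : ℝ) 1) t

lemma hasDerivPath_intOp [CompleteSpace F] (f : C(unitInterval, F)) : HasDerivPath (intOp f) f := by
  intro t
  have h := intervalIntegral.integral_hasDerivAt_right
    ((continuous_ext01 f).intervalIntegrable 0 t)
    ((continuous_ext01 f).stronglyMeasurableAtFilter _ _) (continuous_ext01 f).continuousAt
  rw [ext01_coe] at h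
  refine h.hasDerivWithinAt.congr (fun s hs => ?_) ?_
  · rw [ext01_of_mem _ hs]; rfl
  · rw [ext01_coe]; rfl

lemma hasDerivPath_const (c : F) : HasDerivPath (ContinuousMap.const unitInterval c) 0 :=
  fun t => hasDerivWithinAt_const (t : ℝ) (Icc (0 : ℝ) 1) c

lemma HasDerivPath.add {x x' y y' : C(unitInterval, F)} (hx : HasDerivPath x x')
    (hy : HasDerivPath y y') : HasDerivPath (x + y) (x' + y') :=
  fun t => (hx t).add (hy t)

lemma HasDerivPath.neg {x x' : C(unitInterval, F)} (hx : HasDerivPath x x') :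
    HasDerivPath (-x) (-x') :=
  fun t => (hx t).neg

lemma HasDerivPath.sub {x x' y y' : C(unitInterval, F)} (hx : HasDerivPath x x')
    (hy : HasDerivPath y y') : HasDerivPath (x - y) (x' - y') :=
  fun t => (hx t).sub (hy t)

lemma HasDerivPath.eq_add_intOp [CompleteSpace F] {x x' : C(unitInterval, F)}
    (h : HasDerivPath x x') : x = ContinuousMap.const unitInterval (x 0) + intOp x' := by
  ext t
  have h1 : ∫ s in (0 : ℝ)..t, ext01 x' s = ext01 x t - ext01 x 0 := by
    refine intervalIntegral.integral_eq_sub_of_hasDeriv_right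
      (continuous_ext01 x).continuousOn ?_ ((continuous_ext01 x').intervalIntegrable _ _)
    intro s hs
    rw [min_eq_left t.2.1, max_eq_right t.2.1] at hs
    have hs' : s ∈ Icc (0 : ℝ) 1 := ⟨hs.1.le, hs.2.le.trans t.2.2⟩
    have := h ⟨s, hs'⟩
    rw [ext01_of_mem x' hs']
    exact (this.hasDerivAt (Icc_mem_nhds hs.1 (hs.2.trans_le t.2.2))).hasDerivWithinAt
  have h0 : ext01 x 0 = x 0 := ext01_coe x 0
  simp only [ContinuousMap.add_apply, ContinuousMap.const_apply, intOp_apply, h1, h0, ext01_coe]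
  abel

lemma hasDerivPath_of_eq [CompleteSpace F] {x x' : C(unitInterval, F)} {c : F}
    (h : x = ContinuousMap.const unitInterval c + intOp x') : HasDerivPath x x' := by
  rw [h]
  simpa using (hasDerivPath_const c).add (hasDerivPath_intOp x')

variable (F) in
/-- Constant paths, as a bounded operator. -/
def constOp : F →L[ℝ] C(unitInterval, F) :=
  LinearMap.mkContinuous
    { toFun := ContinuousMap.const unitInterval
      map_add' := fun _ _ => rfl
      map_smul' := fun _ _ => rfl } 1 (fun c => by
        rw [one_mul, ContinuousMap.norm_le _ (norm_nonneg c)]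
        intro t
        exact le_rfl)

@[simp] lemma constOp_apply (c : F) (t : unitInterval) : constOp F c t = c := rfl

lemma constOp_eq (c : F) : constOp F c = ContinuousMap.const unitInterval c := rfl

/-- The pointwise application of a bounded bilinear map to two paths. -/
def bilinOp (b : F →L[ℝ] F' →L[ℝ] F'') :
    C(unitInterval, F) →L[ℝ] C(unitInterval, F') →L[ℝ] C(unitInterval, F'') :=
  LinearMap.mkContinuous₂
    (LinearMap.mk₂ ℝ (fun f g => (⟨fun t => b (f t) (g t), by fun_prop⟩ : C(unitInterval, F'')))
      (fun f f' g => by ext t; simp) (fun c f g => by ext t; simp)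
      (fun f g g' => by ext t; simp) (fun c f g => by ext t; simp)) ‖b‖ (fun f g => by
        rw [ContinuousMap.norm_le _ (by positivity)]
        intro t
        refine (b.le_opNorm₂ (f t) (g t)).trans ?_
        gcongr
        · exact f.norm_coe_le_norm t
        · exact g.norm_coe_le_norm t)

@[simp] lemma bilinOp_apply (b : F →L[ℝ] F' →L[ℝ] F'') (f : C(unitInterval, F))
    (g : C(unitInterval, F')) (t : unitInterval) : bilinOp b f g t = b (f t) (g t) := rfl

lemma HasDerivPath.bilinOp {x x' : C(unitInterval, F)} {y y' : C(unitInterval, F')}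
    (b : F →L[ℝ] F' →L[ℝ] F'') (hx : HasDerivPath x x') (hy : HasDerivPath y y') :
    HasDerivPath (bilinOp b x y) (NahmSchmid.bilinOp b x' y + NahmSchmid.bilinOp b x y') := by
  intro t
  have h := (b.hasFDerivWithinAt_of_bilinear (hx t).hasFDerivWithinAt
    (hy t).hasFDerivWithinAt).hasDerivWithinAt
  have e : (b.precompR ℝ (ext01 x t) (ContinuousLinearMap.toSpanSingleton ℝ (y' t)) +
      b.precompL ℝ (ContinuousLinearMap.toSpanSingleton ℝ (x' t)) (ext01 y t)) 1 =
      (NahmSchmid.bilinOp b x' y + NahmSchmid.bilinOp b x y') t := by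
    simp [ContinuousLinearMap.precompR, ContinuousLinearMap.precompL, add_comm]
  rw [e] at h
  exact h

/-- The pointwise action of a path of operators on a path. -/
abbrev applyOp : C(unitInterval, F →L[ℝ] F') →L[ℝ] C(unitInterval, F) →L[ℝ] C(unitInterval, F') :=
  bilinOp (ContinuousLinearMap.id ℝ (F →L[ℝ] F'))

/-- Each further integration turns tⁿ into tⁿ⁺¹/(n+1), so the factorial accumulates; the bound has
to be kept pointwise in `t` for the induction to see this. -/
lemma norm_volterra_pow_apply_le (L : C(unitInterval, F →L[ℝ] F)) (n : ℕ)
    (x : C(unitInterval, F)) (t : unitInterval) :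
    ‖((intOp ∘L applyOp L) ^ n) x t‖ ≤ ‖L‖ ^ n * (t : ℝ) ^ n / n.factorial * ‖x‖ := by
  induction n generalizing t with
  | zero => simpa using x.norm_coe_le_norm t
  | succ n ih =>
    rw [pow_succ', mul_apply_eq_comp, ContinuousLinearMap.comp_apply, intOp_apply]
    set y := ((intOp ∘L applyOp L) ^ n) x with hy
    have key : ∀ s ∈ Ioc (0 : ℝ) t, ‖ext01 (applyOp L y) s‖ ≤
        ‖L‖ ^ (n + 1) / n.factorial * ‖x‖ * s ^ n := by
      intro s hs
      have hs' : s ∈ Icc (0 : ℝ) 1 := ⟨hs.1.le, hs.2.trans t.2.2⟩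
      rw [ext01_of_mem _ hs', bilinOp_apply]
      refine ((L ⟨s, hs'⟩).le_opNorm _).trans ?_
      have h1 := ih ⟨s, hs'⟩
      have h2 := L.norm_coe_le_norm ⟨s, hs'⟩
      calc ‖L ⟨s, hs'⟩‖ * ‖y ⟨s, hs'⟩‖
          ≤ ‖L‖ * (‖L‖ ^ n * s ^ n / n.factorial * ‖x‖) := by gcongr
        _ = _ := by ring
    refine (intervalIntegral.norm_integral_le_of_norm_le t.2.1
      (Eventually.of_forall key) (Continuous.intervalIntegrable (by fun_prop) _ _)).trans ?_
    rw [intervalIntegral.integral_const_mul, integral_pow, Nat.factorial_succ]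
    push_cast
    apply le_of_eq
    have : (n.factorial : ℝ) ≠ 0 := by positivity
    field_simp
    simp

/-- Volterra operators are quasi-nilpotent: `1 - ∫ L` is invertible. -/
lemma isUnit_one_sub_volterra [CompleteSpace F] (L : C(unitInterval, F →L[ℝ] F)) :
    IsUnit (1 - intOp ∘L applyOp L : C(unitInterval, F) →L[ℝ] C(unitInterval, F)) := by
  set K := (intOp ∘L applyOp L : C(unitInterval, F) →L[ℝ] C(unitInterval, F)) with hK
  obtain ⟨n, hn⟩ := ((FloorSemiring.tendsto_pow_div_factorial_atTop ‖L‖).eventually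
    (gt_mem_nhds one_pos)).exists
  have hKn : ‖K ^ n‖ < 1 := by
    refine lt_of_le_of_lt (ContinuousLinearMap.opNorm_le_bound _ (by positivity) fun x => ?_) hn
    rw [ContinuousMap.norm_le _ (by positivity)]
    intro t
    refine (norm_volterra_pow_apply_le L n x t).trans ?_
    gcongr
    exact mul_le_of_le_one_right (by positivity) (pow_le_one₀ t.2.1 t.2.2)
  have hu : IsUnit (1 - K ^ n) := isUnit_one_sub_of_norm_lt_one (x := K ^ n) hKn
  -- Since `1 - K ^ n` is the product of `1 - K` and the geometric sum, and these commute, its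
  -- invertibility passes to `1 - K`.
  have hc : Commute (1 - K) (∑ i ∈ Finset.range n, K ^ i) :=
    Commute.sum_right _ _ _ fun i _ =>
      ((Commute.one_left K).sub_left (Commute.refl K)).pow_right i
  rw [← mul_neg_geom_sum K n, hc.isUnit_mul_iff] at hu
  exact hu.1

lemma eq_zero_of_volterra [CompleteSpace F] (L : C(unitInterval, F →L[ℝ] F))
    (x : C(unitInterval, F)) (h : x = intOp (applyOp L x)) : x = 0 := by
  obtain ⟨u, hu⟩ := isUnit_one_sub_volterra L
  have h1 : (1 - intOp ∘L applyOp L : C(unitInterval, F) →L[ℝ] C(unitInterval, F)) x = 0 := by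
    simp [← h]
  have h2 : (↑u⁻¹ * ↑u : C(unitInterval, F) →L[ℝ] C(unitInterval, F)) x = 0 := by
    rw [mul_apply_eq_comp, hu, h1, map_zero]
  simpa using h2

/-- The difference of the two paths solves a homogeneous linear Volterra equation. This also covers
bilinear systems, since the difference of two solutions satisfies a linear equation whose
coefficients are built from the solutions. -/
lemma HasDerivPath.eq_of_linear [CompleteSpace F] {x y x' y' : C(unitInterval, F)}
    (hx : HasDerivPath x x') (hy : HasDerivPath y y') (h0 : x 0 = y 0)
    (L : C(unitInterval, F →L[ℝ] F)) (h : ∀ t, x' t - y' t = L t (x t - y t)) : x = y := by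
  have e : x' - y' = applyOp L (x - y) := by
    ext t
    simpa using h t
  have h1 := (hx.sub hy).eq_add_intOp
  rw [ContinuousMap.sub_apply, h0, sub_self, e] at h1
  refine sub_eq_zero.1 (eq_zero_of_volterra L _ (h1.trans ?_))
  ext t
  simp

end Paths

/-! ### Smoothness of superposition operators. -/

section Superposition

universe u

/-- The superposition operator `g ↦ f ∘ g` on continuous paths. -/
def superpose {X Y : Type*} [TopologicalSpace X] [TopologicalSpace Y] (f : X → Y)
    (hf : Continuous f) (g : C(unitInterval, X)) : C(unitInterval, Y) :=
  (⟨f, hf⟩ : C(X, Y)).comp g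

@[simp] lemma superpose_apply {X Y : Type*} [TopologicalSpace X] [TopologicalSpace Y] (f : X → Y)
    (hf : Continuous f) (g : C(unitInterval, X)) (t : unitInterval) :
    superpose f hf g t = f (g t) := rfl

variable {X Y : Type u} [NormedAddCommGroup X] [NormedSpace ℝ X]
  [NormedAddCommGroup Y] [NormedSpace ℝ Y]

/-- The mean value inequality is applied on the segment from `g t` to `g t + v t`. The error is
uniform in `t` because `g ↦ f' ∘ g` is continuous in the sup norm. -/
lemma hasFDerivAt_superpose (f : X → Y) (f' : X → X →L[ℝ] Y) (hf : Continuous f)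
    (hf' : Continuous f') (h : ∀ x, HasFDerivAt f (f' x) x) (g : C(unitInterval, X)) :
    HasFDerivAt (superpose f hf) (applyOp (superpose f' hf' g)) g := by
  rw [hasFDerivAt_iff_isLittleO_nhds_zero, Asymptotics.isLittleO_iff]
  intro ε hε
  have hcont : Continuous (superpose f' hf') := ContinuousMap.continuous_postcomp _
  have hnear : ∀ᶠ g' in 𝓝 g, dist (superpose f' hf' g') (superpose f' hf' g) < ε :=
    hcont.continuousAt.eventually (Metric.ball_mem_nhds (superpose f' hf' g) hε)
  obtain ⟨δ, hδ, hball⟩ := Metric.eventually_nhds_iff.1 hnear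
  filter_upwards [Metric.ball_mem_nhds (0 : C(unitInterval, X)) hδ] with v hv
  rw [mem_ball_zero_iff] at hv
  rw [ContinuousMap.norm_le _ (by positivity)]
  intro t
  have key : ∀ y ∈ segment ℝ (g t) (g t + v t), ‖f' y - f' (g t)‖ ≤ ε := by
    intro y hy
    rw [segment_eq_image'] at hy
    obtain ⟨s, hs, rfl⟩ := hy
    have h1 : dist (g + s • v) g < δ := by
      rw [dist_eq_norm, add_sub_cancel_left, norm_smul, Real.norm_of_nonneg hs.1]
      exact lt_of_le_of_lt (mul_le_of_le_one_left (norm_nonneg v) hs.2) hv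
    have h2 := (ContinuousMap.dist_apply_le_dist t).trans (hball h1).le
    rw [dist_eq_norm] at h2
    simpa using h2
  have := (convex_segment (𝕜 := ℝ) (g t) (g t + v t)).norm_image_sub_le_of_norm_hasFDerivWithin_le'
    (fun y _ => (h y).hasFDerivWithinAt) key (left_mem_segment ℝ _ _) (right_mem_segment ℝ _ _)
  simp only [add_sub_cancel_left] at this
  refine (this.trans ?_)
  gcongr
  exact v.norm_coe_le_norm t

/-- The derivative is pointwise application of the superposition operator of `fderiv ℝ f`, whose
values lie in `X →L[ℝ] Y`. The codomain therefore changes in the induction, and `X` and `Y` share a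
universe so that it can. -/
lemma contDiff_superpose_nat (n : ℕ) : ∀ {Y : Type u} [NormedAddCommGroup Y] [NormedSpace ℝ Y]
    (f : X → Y) (hf : ContDiff ℝ n f), ContDiff ℝ n (superpose f hf.continuous) := by
  induction n with
  | zero =>
    intro Y _ _ f hf
    exact contDiff_zero.2 (ContinuousMap.continuous_postcomp _)
  | succ n ih =>
    intro Y _ _ f hf
    have hf1 : ContDiff ℝ (n + 1) f := by exact_mod_cast hf
    have hf' : ContDiff ℝ n (fderiv ℝ f) := hf1.fderiv_right le_rfl
    have hd : ∀ x, HasFDerivAt f (fderiv ℝ f x) x := fun x =>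
      (hf1.differentiable (by simp) x).hasFDerivAt
    have : ContDiff ℝ ((n : WithTop ℕ∞) + 1) (superpose f hf.continuous) := by
      rw [contDiff_succ_iff_hasFDerivAt]
      have h1 : ContDiff ℝ n (superpose (fderiv ℝ f) hf'.continuous) :=
        ih (Y := X →L[ℝ] Y) (fderiv ℝ f) hf'
      have h2 : ContDiff ℝ n (applyOp (F := X) (F' := Y)) := ContinuousLinearMap.contDiff _
      exact ⟨fun g => applyOp (superpose (fderiv ℝ f) hf'.continuous g), h2.comp h1,
        hasFDerivAt_superpose f _ hf.continuous hf'.continuous hd⟩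
    exact_mod_cast this

lemma contDiff_superpose (f : X → Y) (hf : ContDiff ℝ ∞ f) :
    ContDiff ℝ ∞ (superpose f hf.continuous) :=
  contDiff_infty.2 fun n => contDiff_superpose_nat n f (hf.of_le (mod_cast le_top))

end Superposition

/-! ### Smooth dependence of solutions on data, by the implicit function theorem. -/

section ODE

universe u

variable {P F : Type u} [NormedAddCommGroup P] [NormedSpace ℝ P]
  [NormedAddCommGroup F] [NormedSpace ℝ F]

/-- The path of pairs of two paths, as a bounded operator. -/
def pairOp : C(unitInterval, P) × C(unitInterval, F) →L[ℝ] C(unitInterval, P × F) :=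
  ((ContinuousLinearMap.inl ℝ P F).compLeftContinuous ℝ unitInterval).coprod
    ((ContinuousLinearMap.inr ℝ P F).compLeftContinuous ℝ unitInterval)

@[simp] lemma pairOp_apply (a : C(unitInterval, P)) (x : C(unitInterval, F)) (t : unitInterval) :
    pairOp (a, x) t = (a t, x t) := by
  simp [pairOp]

/-- Smooth dependence of the solutions of `ẋ = f(a(t), x)` on the path `a` and the initial
value. -/
theorem exists_smooth_solution [CompleteSpace P] [CompleteSpace F] (f : P × F → F) (hf : ContDiff ℝ ∞ f)
    (a₀ : C(unitInterval, P)) (x₀ : F) (y : C(unitInterval, F))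
    (hy : y = constOp F x₀ + intOp (superpose f hf.continuous (pairOp (a₀, y)))) :
    ∃ σ : C(unitInterval, P) × F → C(unitInterval, F), ContDiffAt ℝ ∞ σ (a₀, x₀) ∧
      σ (a₀, x₀) = y ∧ ∀ᶠ q in 𝓝 (a₀, x₀),
        σ q = constOp F q.2 + intOp (superpose f hf.continuous (pairOp (q.1, σ q))) := by
  set Ψ : (C(unitInterval, P) × F) × C(unitInterval, F) → C(unitInterval, F) := fun q =>
    q.2 - (constOp F q.1.2 + intOp (superpose f hf.continuous (pairOp (q.1.1, q.2)))) with hΨ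
  have hsm : ContDiff ℝ ∞ Ψ := by
    refine contDiff_snd.sub (((constOp F).contDiff.comp (contDiff_snd.comp contDiff_fst)).add
      (intOp.contDiff.comp ((contDiff_superpose f hf).comp (pairOp.contDiff.comp ?_))))
    exact (contDiff_fst.comp contDiff_fst).prodMk contDiff_snd
  have hΨ0 : Ψ ((a₀, x₀), y) = 0 := by
    simp only [hΨ]
    rw [← hy, sub_self]
  have hdf : ∀ z, HasFDerivAt f (fderiv ℝ f z) z := fun z =>
    (hf.differentiable (by simp) z).hasFDerivAt
  have hcf' : Continuous (fderiv ℝ f) := hf.continuous_fderiv (by simp)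
  set D : C(unitInterval, P × F →L[ℝ] F) := superpose _ hcf' (pairOp (a₀, y)) with hD
  set L : C(unitInterval, F →L[ℝ] F) := ((ContinuousLinearMap.compL ℝ F (P × F) F).flip
    (ContinuousLinearMap.inr ℝ P F)).compLeftContinuous ℝ unitInterval D with hL
  -- The derivative in the path alone is `1` minus a Volterra operator, hence invertible without any
  -- smallness assumption. A solution on all of [0,1] thus persists when the data are perturbed.
  have hpart : fderiv ℝ Ψ ((a₀, x₀), y) ∘L .inr ℝ (C(unitInterval, P) × F) C(unitInterval, F) =
      1 - intOp ∘L applyOp L := by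
    have h1 : HasFDerivAt (fun x => Ψ ((a₀, x₀), x))
        (fderiv ℝ Ψ ((a₀, x₀), y) ∘L .inr ℝ (C(unitInterval, P) × F) C(unitInterval, F)) y :=
      ((hsm.differentiable (by simp) _).hasFDerivAt).comp y (hasFDerivAt_prodMk_right _ y)
    refine h1.unique ?_
    have h2 : HasFDerivAt (fun x => superpose f hf.continuous (pairOp (a₀, x)))
        (applyOp D ∘L (pairOp ∘L .inr ℝ C(unitInterval, P) C(unitInterval, F))) y := by
      have h3 : HasFDerivAt (fun x => pairOp (a₀, x))
          (pairOp ∘L .inr ℝ C(unitInterval, P) C(unitInterval, F)) y :=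
        HasFDerivAt.comp (g := pairOp (P := P) (F := F)) y
          (pairOp (P := P) (F := F)).hasFDerivAt (hasFDerivAt_prodMk_right a₀ y)
      exact HasFDerivAt.comp (g := superpose f hf.continuous) y
        (hasFDerivAt_superpose f _ hf.continuous hcf' hdf (pairOp (a₀, y))) h3
    have h4 : HasFDerivAt (fun x => intOp (superpose f hf.continuous (pairOp (a₀, x))))
        (intOp ∘L (applyOp D ∘L (pairOp ∘L .inr ℝ C(unitInterval, P) C(unitInterval, F)))) y :=
      HasFDerivAt.comp (g := intOp (F := F)) y (intOp (F := F)).hasFDerivAt h2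
    refine ((hasFDerivAt_id y).fun_sub (h4.const_add (constOp F x₀))).congr_fderiv ?_
    ext x t
    simp only [sub_apply, ContinuousLinearMap.comp_apply,
      ContinuousMap.sub_apply]
    congr 3
    ext s
    simp only [bilinOp_apply, ContinuousLinearMap.inr_apply, pairOp_apply]
    rfl
  have hinv : (fderiv ℝ Ψ ((a₀, x₀), y) ∘L
      .inr ℝ (C(unitInterval, P) × F) C(unitInterval, F)).IsInvertible := by
    rw [hpart]
    obtain ⟨v, hv⟩ := isUnit_one_sub_volterra L
    rw [← hv]
    exact ⟨ContinuousLinearEquiv.ofUnit v, rfl⟩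
  have hc : ContDiffAt ℝ ∞ Ψ ((a₀, x₀), y) := hsm.contDiffAt
  refine ⟨hc.implicitFunction (by simp) hinv, hc.contDiffAt_implicitFunction (by simp) hinv,
    hc.implicitFunction_apply_self (by simp) hinv, ?_⟩
  filter_upwards [hc.eventually_apply_implicitFunction (by simp) hinv] with q hq
  rw [hΨ0] at hq
  exact sub_eq_zero.1 hq

end ODE


/-! ## Lie groups in the preferred chart at the identity -/

section LieChart

variable {E : Type*} [NormedAddCommGroup E] [NormedSpace ℝ E]
  {G : Type*} [TopologicalSpace G] [ChartedSpace E G] [Group G]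

variable (E) in
/-- The preferred chart at `1`. -/
def lc (g : G) : E := extChartAt 𝓘(ℝ, E) (1 : G) g

variable (G) in
/-- The inverse of the preferred chart at `1`. -/
def li (z : E) : G := (extChartAt 𝓘(ℝ, E) (1 : G)).symm z

variable (E G) in
/-- The domain of the preferred chart at `1`. -/
def lsrc : Set G := (extChartAt 𝓘(ℝ, E) (1 : G)).source

variable (E G) in
/-- The range of the preferred chart at `1`. -/
def ltgt : Set E := (extChartAt 𝓘(ℝ, E) (1 : G)).target

variable (E G) in
/-- The origin of the preferred chart at `1`. -/
def lo : E := lc E (1 : G)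

lemma isOpen_lsrc : IsOpen (lsrc E G) := isOpen_extChartAt_source _

lemma isOpen_ltgt : IsOpen (ltgt E G) := isOpen_extChartAt_target _

lemma one_mem_lsrc : (1 : G) ∈ lsrc E G := mem_extChartAt_source _

lemma lo_mem_ltgt : lo E G ∈ ltgt E G := mem_extChartAt_target _

lemma li_lc {g : G} (hg : g ∈ lsrc E G) : li G (lc E g) = g :=
  (extChartAt 𝓘(ℝ, E) (1 : G)).left_inv hg

lemma lc_li {z : E} (hz : z ∈ ltgt E G) : lc E (li G z) = z :=
  (extChartAt 𝓘(ℝ, E) (1 : G)).right_inv hz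

lemma lc_mem {g : G} (hg : g ∈ lsrc E G) : lc E g ∈ ltgt E G :=
  (extChartAt 𝓘(ℝ, E) (1 : G)).map_source hg

lemma li_mem {z : E} (hz : z ∈ ltgt E G) : li G z ∈ lsrc E G :=
  (extChartAt 𝓘(ℝ, E) (1 : G)).map_target hz

@[simp] lemma lc_one : lc E (1 : G) = lo E G := rfl

@[simp] lemma li_lo : li G (lo E G) = 1 := li_lc one_mem_lsrc

section Smooth

variable [LieGroup 𝓘(ℝ, E) ∞ G]

lemma contMDiffAt_lc {g : G} (hg : g ∈ lsrc E G) :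
    ContMDiffAt 𝓘(ℝ, E) 𝓘(ℝ, E) ∞ (lc E : G → E) g :=
  contMDiffAt_extChartAt' (by rwa [lsrc, extChartAt_source] at hg)

lemma contMDiffAt_li {z : E} (hz : z ∈ ltgt E G) :
    ContMDiffAt 𝓘(ℝ, E) 𝓘(ℝ, E) ∞ (li G) z :=
  (contMDiffOn_extChartAt_symm (1 : G)).contMDiffAt (isOpen_ltgt.mem_nhds hz)

lemma contMDiffAt_li_lo : ContMDiffAt 𝓘(ℝ, E) 𝓘(ℝ, E) ∞ (li G) (lo E G) :=
  contMDiffAt_li lo_mem_ltgt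

lemma contDiffAt_lc_comp {X : Type*} [NormedAddCommGroup X] [NormedSpace ℝ X] {w : X → G} {x : X}
    (hw : ContMDiffAt 𝓘(ℝ, X) 𝓘(ℝ, E) ∞ w x) (hx : w x ∈ lsrc E G) :
    ContDiffAt ℝ ∞ (fun x => lc E (w x)) x :=
  contMDiffAt_iff_contDiffAt.1 ((contMDiffAt_lc hx).comp x hw)

variable (E G) in
/-- Multiplication in the preferred chart at `1`. -/
def lmul (p : E × E) : E := lc E (li G p.1 * li G p.2)

lemma contDiffAt_lmul {p : E × E} (h1 : p.1 ∈ ltgt E G) (h2 : p.2 ∈ ltgt E G)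
    (h : li G p.1 * li G p.2 ∈ lsrc E G) : ContDiffAt ℝ ∞ (lmul E G) p := by
  refine contDiffAt_lc_comp ?_ h
  have e1 : ContMDiffAt 𝓘(ℝ, E × E) 𝓘(ℝ, E) ∞ (fun q : E × E => li G q.1) p :=
    (contMDiffAt_li h1).comp p contDiffAt_fst.contMDiffAt
  have e2 : ContMDiffAt 𝓘(ℝ, E × E) 𝓘(ℝ, E) ∞ (fun q : E × E => li G q.2) p :=
    (contMDiffAt_li h2).comp p contDiffAt_snd.contMDiffAt
  exact e1.mul e2

lemma contDiffAt_lmul_lo : ContDiffAt ℝ ∞ (lmul E G) (lo E G, lo E G) :=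
  contDiffAt_lmul lo_mem_ltgt lo_mem_ltgt (by simpa using one_mem_lsrc)

lemma eventually_mem_ltgt : ∀ᶠ z in 𝓝 (lo E G), z ∈ ltgt E G :=
  isOpen_ltgt.mem_nhds lo_mem_ltgt

/-- As `1` is a two-sided unit, multiplication restricts to the identity on each of the two axes. -/
lemma hasFDerivAt_lmul :
    HasFDerivAt (lmul E G) (ContinuousLinearMap.fst ℝ E E + ContinuousLinearMap.snd ℝ E E)
      (lo E G, lo E G) := by
  have hd := (contDiffAt_lmul_lo (E := E) (G := G)).differentiableAt (by simp)
  have h1 : HasFDerivAt (fun z => lmul E G (z, lo E G))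
      (fderiv ℝ (lmul E G) (lo E G, lo E G) ∘L .inl ℝ E E) (lo E G) :=
    HasFDerivAt.comp (g := lmul E G) (lo E G) hd.hasFDerivAt (hasFDerivAt_prodMk_left _ _)
  have h2 : HasFDerivAt (fun z => lmul E G (lo E G, z))
      (fderiv ℝ (lmul E G) (lo E G, lo E G) ∘L .inr ℝ E E) (lo E G) :=
    HasFDerivAt.comp (g := lmul E G) (lo E G) hd.hasFDerivAt (hasFDerivAt_prodMk_right _ _)
  have e1 : (fun z => lmul E G (z, lo E G)) =ᶠ[𝓝 (lo E G)] id := by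
    filter_upwards [eventually_mem_ltgt (E := E) (G := G)] with z hz
    simp [lmul, lc_li hz]
  have e2 : (fun z => lmul E G (lo E G, z)) =ᶠ[𝓝 (lo E G)] id := by
    filter_upwards [eventually_mem_ltgt (E := E) (G := G)] with z hz
    simp [lmul, lc_li hz]
  have h1' := (h1.congr_of_eventuallyEq e1.symm).unique (hasFDerivAt_id _)
  have h2' := (h2.congr_of_eventuallyEq e2.symm).unique (hasFDerivAt_id _)
  refine hd.hasFDerivAt.congr_fderiv ?_
  ext x <;> simp
  · simpa using DFunLike.congr_fun h1' x
  · simpa using DFunLike.congr_fun h2' x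

lemma hasFDerivAt_linv :
    HasFDerivAt (fun z => lc E (li G z)⁻¹) (-ContinuousLinearMap.id ℝ E) (lo E G) := by
  have hs : ContDiffAt ℝ ∞ (fun z => lc E (li G z)⁻¹) (lo E G) :=
    contDiffAt_lc_comp contMDiffAt_li_lo.inv (by simpa using one_mem_lsrc)
  have hd := (hs.differentiableAt (by simp)).hasFDerivAt
  have h0 : lc E (li G (lo E G))⁻¹ = lo E G := by simp
  have hm : HasFDerivAt (lmul E G)
      (ContinuousLinearMap.fst ℝ E E + ContinuousLinearMap.snd ℝ E E)
      (lo E G, lc E (li G (lo E G))⁻¹) := by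
    rw [h0]; exact hasFDerivAt_lmul
  have h1 := hm.comp (lo E G) ((hasFDerivAt_id (lo E G)).prodMk hd)
  have e1 : (lmul E G ∘ fun z => (id z, lc E (li G z)⁻¹)) =ᶠ[𝓝 (lo E G)] fun _ => lo E G := by
    have hc : ∀ᶠ z in 𝓝 (lo E G), (li G z)⁻¹ ∈ lsrc E G := by
      have : ContinuousAt (fun z => (li G z)⁻¹) (lo E G) :=
        (contMDiffAt_li_lo (E := E) (G := G)).inv.continuousAt
      exact this.eventually (isOpen_lsrc.mem_nhds (by simpa using one_mem_lsrc))
    filter_upwards [hc] with z hz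
    simp [lmul, li_lc hz]
  have h2 := (h1.congr_of_eventuallyEq e1.symm).unique (hasFDerivAt_const _ _)
  refine hd.congr_fderiv ?_
  ext x
  have := DFunLike.congr_fun h2 x
  simp at this
  simpa using eq_neg_of_add_eq_zero_right this

/-! ### The adjoint representation -/

lemma hasFDerivAt_conj (g : G) :
    HasFDerivAt (fun y => lc E (g * li G y * g⁻¹)) (Ad g) (lo E G) := by
  have hc : ContMDiffAt 𝓘(ℝ, E) 𝓘(ℝ, E) ∞ (fun x : G => g * x * g⁻¹) (1 : G) :=
    (contMDiffAt_const.mul contMDiffAt_id).mul contMDiffAt_const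
  have hs : ContDiffAt ℝ ∞ (fun y => lc E (g * li G y * g⁻¹)) (lo E G) :=
    contDiffAt_lc_comp ((contMDiffAt_const.mul contMDiffAt_li_lo).mul contMDiffAt_const)
      (by simpa using one_mem_lsrc)
  refine (hs.differentiableAt (by simp)).hasFDerivAt.congr_fderiv ?_
  refine Eq.trans ?_ (hc.mdifferentiableAt (by simp)).mfderiv.symm
  have h1 : g * 1 * g⁻¹ = 1 := by simp
  -- `mfderiv` uses the chart at the image point `g * 1 * g⁻¹`; once this is rewritten to `1`, both
  -- sides are derivatives in the same chart.
  change _ = fderivWithin ℝ (extChartAt 𝓘(ℝ, E) (g * 1 * g⁻¹) ∘ (fun x : G => g * x * g⁻¹) ∘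
    (extChartAt 𝓘(ℝ, E) (1 : G)).symm) (range 𝓘(ℝ, E)) (extChartAt 𝓘(ℝ, E) (1 : G) 1)
  rw [h1, modelWithCornersSelf_coe, range_id, fderivWithin_univ]
  rfl

lemma hasFDerivAt_conj_comp {F : Type*} [NormedAddCommGroup F] [NormedSpace ℝ F] (g : G)
    {f : G → F} {L : E →L[ℝ] F} (h : HasFDerivAt (fun z => f (li G z)) L (lo E G)) :
    HasFDerivAt (fun z => f (g * li G z * g⁻¹)) (L ∘L Ad g) (lo E G) := by
  have hb : lc E (g * li G (lo E G) * g⁻¹) = lo E G := by simp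
  have h' : HasFDerivAt (fun z => f (li G z)) L (lc E (g * li G (lo E G) * g⁻¹)) := by rwa [hb]
  refine (h'.comp (lo E G) (hasFDerivAt_conj g)).congr_of_eventuallyEq ?_
  have hc : ContinuousAt (fun z => g * li G z * g⁻¹) (lo E G) :=
    ((contMDiffAt_const.mul (contMDiffAt_li_lo (E := E) (G := G))).mul
      (contMDiffAt_const (c := g⁻¹))).continuousAt
  filter_upwards [hc.eventually ((isOpen_lsrc (E := E) (G := G)).mem_nhds
    (by simpa using one_mem_lsrc))] with z hz
  simp only [Function.comp_apply]
  rw [li_lc hz]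

lemma Ad_mul (g h : G) : (Ad (g * h) : E →L[ℝ] E) = Ad g ∘L Ad h := by
  have h1 := hasFDerivAt_conj_comp (f := fun x => lc E (g * x * g⁻¹)) h
    (hasFDerivAt_conj (E := E) g)
  refine (hasFDerivAt_conj (E := E) (g * h)).unique (h1.congr_of_eventuallyEq ?_)
  exact Eventually.of_forall fun z => by simp [mul_assoc]

lemma Ad_one : (Ad (1 : G) : E →L[ℝ] E) = ContinuousLinearMap.id ℝ E := by
  refine (hasFDerivAt_conj (E := E) (1 : G)).unique
    ((hasFDerivAt_id _).congr_of_eventuallyEq ?_)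
  filter_upwards [eventually_mem_ltgt (E := E) (G := G)] with z hz
  simp [lc_li hz]

@[simp] lemma Ad_one_apply (x : E) : Ad (1 : G) x = x := by rw [Ad_one]; rfl

lemma Ad_mul_apply (g h : G) (x : E) : Ad (g * h) x = Ad g (Ad h x) := by rw [Ad_mul]; rfl

@[simp] lemma Ad_inv_Ad (g : G) (x : E) : Ad g⁻¹ (Ad g x) = x := by
  rw [← Ad_mul_apply]; simp

@[simp] lemma Ad_Ad_inv (g : G) (x : E) : Ad g (Ad g⁻¹ x) = x := by
  rw [← Ad_mul_apply]; simp

/-- `Ad (li G z)` is a partial derivative of the jointly smooth map (z, y) ↦ z y z⁻¹, hence smooth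
in `z`. -/
lemma contDiffAt_Ad_li : ContDiffAt ℝ ∞ (fun z => (Ad (li G z) : E →L[ℝ] E)) (lo E G) := by
  have h : ContDiffAt ℝ ∞ (Function.uncurry fun z y => lc E (li G z * li G y * (li G z)⁻¹))
      (lo E G, lo E G) := by
    have e1 : ContMDiffAt 𝓘(ℝ, E × E) 𝓘(ℝ, E) ∞ (fun q : E × E => li G q.1) (lo E G, lo E G) :=
      ContMDiffAt.comp (g := li G) (lo E G, lo E G) contMDiffAt_li_lo contDiffAt_fst.contMDiffAt
    have e2 : ContMDiffAt 𝓘(ℝ, E × E) 𝓘(ℝ, E) ∞ (fun q : E × E => li G q.2) (lo E G, lo E G) :=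
      ContMDiffAt.comp (g := li G) (lo E G, lo E G) contMDiffAt_li_lo contDiffAt_snd.contMDiffAt
    exact contDiffAt_lc_comp ((e1.mul e2).mul e1.inv) (by simpa using one_mem_lsrc)
  have h2 : ContDiffAt ℝ ∞ (fun z => fderiv ℝ (fun y => lc E (li G z * li G y * (li G z)⁻¹))
      (lo E G)) (lo E G) := h.fderiv contDiffAt_const le_rfl
  exact h2.congr_of_eventuallyEq (Eventually.of_forall fun z => (hasFDerivAt_conj (li G z)).fderiv.symm)

variable (E G) in
/-- The Lie bracket as a bounded bilinear map: the derivative of the adjoint representation. -/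
def ad : E →L[ℝ] E →L[ℝ] E := fderiv ℝ (fun z => (Ad (li G z) : E →L[ℝ] E)) (lo E G)

lemma hasFDerivAt_Ad_li : HasFDerivAt (fun z => (Ad (li G z) : E →L[ℝ] E)) (ad E G) (lo E G) :=
  (contDiffAt_Ad_li.differentiableAt (by simp)).hasFDerivAt

/-- Differentiate Ad(g z g⁻¹) = Ad(g) Ad(z) Ad(g)⁻¹ in `z` at the identity. -/
lemma ad_Ad (g : G) (x y : E) : ad E G (Ad g x) (Ad g y) = Ad g (ad E G x y) := by
  have h1 := hasFDerivAt_conj_comp (f := fun x => (Ad x : E →L[ℝ] E)) g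
    (hasFDerivAt_Ad_li (E := E) (G := G))
  have h2 : HasFDerivAt (fun z => (Ad (g * li G z * g⁻¹) : E →L[ℝ] E))
      (((ContinuousLinearMap.compL ℝ E E E (Ad g)) ∘L
        ((ContinuousLinearMap.compL ℝ E E E).flip (Ad g⁻¹))) ∘L ad E G) (lo E G) := by
    refine (((ContinuousLinearMap.compL ℝ E E E (Ad g)) ∘L
        ((ContinuousLinearMap.compL ℝ E E E).flip (Ad g⁻¹))).hasFDerivAt.comp _
        hasFDerivAt_Ad_li).congr_of_eventuallyEq (Eventually.of_forall fun z => ?_)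
    ext v
    simp [Ad_mul_apply]
  have := DFunLike.congr_fun (DFunLike.congr_fun (h1.unique h2) x) (Ad g y)
  simpa using this

/-- Infinitesimal form of `B.invariant`: the function z ↦ ⟨Ad(z)x, Ad(z)y⟩ is constant. -/
lemma AdInvariantInner.form_ad (B : AdInvariantInner E G) (v x y : E) :
    B.form (ad E G v x) y + B.form x (ad E G v y) = 0 := by
  have h1 : HasFDerivAt (fun z => Ad (li G z) x) ((ad E G).flip x) (lo E G) :=
    hasFDerivAt_Ad_li.clm_apply (hasFDerivAt_const x _) |>.congr_fderiv (by ext; simp)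
  have h2 : HasFDerivAt (fun z => Ad (li G z) y) ((ad E G).flip y) (lo E G) :=
    hasFDerivAt_Ad_li.clm_apply (hasFDerivAt_const y _) |>.congr_fderiv (by ext; simp)
  have h3 := (B.form.hasFDerivAt_of_bilinear h1 h2).unique
    ((hasFDerivAt_const (B.form x y) (lo E G)).congr_of_eventuallyEq
      (Eventually.of_forall fun z => B.invariant _ x y))
  have := DFunLike.congr_fun h3 v
  simp [ContinuousLinearMap.precompR, ContinuousLinearMap.precompL] at this
  rw [add_comm]
  exact this

end Smooth

end LieChart


/-! ### The Lie bracket as the derivative of the adjoint representation. -/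

section Bracket

variable {E : Type*} [NormedAddCommGroup E] [NormedSpace ℝ E]
  {G : Type*} [TopologicalSpace G] [ChartedSpace E G] [Group G] [LieGroup 𝓘(ℝ, E) ∞ G]

/-- The derivative at `y = 0` of left translation `y ↦ z y` in the chart. -/
lemma hasFDerivAt_lmul_left {z : E} (hz : z ∈ ltgt E G) :
    HasFDerivAt (fun y => lmul E G (z, y)) (fderiv ℝ (lmul E G) (z, lo E G) ∘L .inr ℝ E E)
      (lo E G) := by
  have hd : DifferentiableAt ℝ (lmul E G) (z, lo E G) :=
    (contDiffAt_lmul hz lo_mem_ltgt (by simpa using li_mem hz)).differentiableAt (by simp)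
  exact HasFDerivAt.comp (g := lmul E G) (lo E G) hd.hasFDerivAt (hasFDerivAt_prodMk_right _ _)

/-- Differentiate z y = (z y z⁻¹) z in `y` at the identity. -/
lemma lmul_right_Ad {z : E} (hz : z ∈ ltgt E G) (w : E) :
    fderiv ℝ (lmul E G) (lo E G, z) (Ad (li G z) w, 0) =
      fderiv ℝ (lmul E G) (z, lo E G) (0, w) := by
  have hd : DifferentiableAt ℝ (lmul E G) (lo E G, z) :=
    (contDiffAt_lmul lo_mem_ltgt hz (by simpa using li_mem hz)).differentiableAt (by simp)
  have h0 : lc E (li G z * li G (lo E G) * (li G z)⁻¹) = lo E G := by simp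
  have hd' : HasFDerivAt (lmul E G) (fderiv ℝ (lmul E G) (lo E G, z))
      (lc E (li G z * li G (lo E G) * (li G z)⁻¹), z) := by
    rw [h0]; exact hd.hasFDerivAt
  have h1 := HasFDerivAt.comp (g := lmul E G) (lo E G) hd'
    ((hasFDerivAt_conj (li G z)).prodMk (hasFDerivAt_const z (lo E G)))
  have hc : ContinuousAt (fun y => li G z * li G y * (li G z)⁻¹) (lo E G) :=
    ((contMDiffAt_const.mul (contMDiffAt_li_lo (E := E) (G := G))).mul
      (contMDiffAt_const (c := (li G z)⁻¹))).continuousAt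
  have h2 := h1.unique ((hasFDerivAt_lmul_left hz).congr_of_eventuallyEq (by
    filter_upwards [hc.eventually ((isOpen_lsrc (E := E) (G := G)).mem_nhds
      (by simpa using one_mem_lsrc))] with y hy
    simp [lmul, li_lc hy]))
  have := DFunLike.congr_fun h2 w
  simpa using this

lemma contDiffAt_fderiv_lmul : ContDiffAt ℝ ∞ (fderiv ℝ (lmul E G)) (lo E G, lo E G) :=
  contDiffAt_lmul_lo.fderiv_right le_rfl

lemma hasFDerivAt_fderiv_lmul_left (w : E × E) :
    HasFDerivAt (fun z => fderiv ℝ (lmul E G) (z, lo E G) w)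
      ((fderiv ℝ (fderiv ℝ (lmul E G)) (lo E G, lo E G)).flip w ∘L .inl ℝ E E) (lo E G) := by
  have h := (contDiffAt_fderiv_lmul (E := E) (G := G)).differentiableAt (by simp)
  have h1 := HasFDerivAt.comp (g := fderiv ℝ (lmul E G)) (f := fun z => (z, lo E G)) (lo E G)
    h.hasFDerivAt (hasFDerivAt_prodMk_left _ _)
  exact (h1.clm_apply (hasFDerivAt_const w _)).congr_fderiv (by ext; simp)

/-- Differentiating `lmul_right_Ad` in `z` at the identity expresses `ad` through mixed second
derivatives of multiplication, and their symmetry brings the result into antisymmetric form. The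
right-hand side is also what the chart formula for the bracket of left-invariant fields produces. -/
lemma ad_eq_sub (x y : E) :
    ad E G x y = fderiv ℝ (fderiv ℝ (lmul E G)) (lo E G, lo E G) (x, 0) (0, y) -
      fderiv ℝ (fderiv ℝ (lmul E G)) (lo E G, lo E G) (y, 0) (0, x) := by
  set D := fderiv ℝ (fderiv ℝ (lmul E G)) (lo E G, lo E G) with hD
  have h := (contDiffAt_fderiv_lmul (E := E) (G := G)).differentiableAt (by simp)
  have h1 := HasFDerivAt.comp (g := fderiv ℝ (lmul E G)) (lo E G) h.hasFDerivAt
    (hasFDerivAt_prodMk_right _ _)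
  have h2 : HasFDerivAt (fun z => (Ad (li G z) y, (0 : E)))
      (((ad E G).flip y).prod (0 : E →L[ℝ] E)) (lo E G) :=
    (hasFDerivAt_Ad_li.clm_apply (hasFDerivAt_const y _) |>.congr_fderiv
      (by ext; simp)).prodMk (hasFDerivAt_const _ _)
  have h3 := h1.clm_apply h2
  have h4 := h3.unique ((hasFDerivAt_fderiv_lmul_left (E := E) (G := G)
      (0, y)).congr_of_eventuallyEq (by
    filter_upwards [eventually_mem_ltgt (E := E) (G := G)] with z hz
    exact lmul_right_Ad hz y))
  have h5 := DFunLike.congr_fun h4 x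
  simp [hasFDerivAt_lmul.fderiv] at h5
  have hs : D (0, x) (y, 0) = D (y, 0) (0, x) :=
    contDiffAt_lmul_lo.isSymmSndFDerivAt
      (by simpa using (WithTop.coe_le_coe.2 le_top : ((2 : ℕ∞) : WithTop ℕ∞) ≤ ((⊤ : ℕ∞) : WithTop ℕ∞))) _ _
  rw [← hD, hs] at h5
  rw [eq_sub_iff_add_eq]
  exact h5

lemma ad_swap (x y : E) : ad E G x y = -ad E G y x := by
  rw [ad_eq_sub, ad_eq_sub y x]; abel

@[simp] lemma ad_self (x : E) : ad E G x x = 0 := by rw [ad_eq_sub, sub_self]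

/-- A left-invariant field, read in the chart at `1`, is the partial derivative of multiplication in
its second factor. The inverse required by the pullback is the derivative of the chart itself. -/
lemma mpullbackWithin_mulInvariantVectorField {z : E} (hz : z ∈ ltgt E G) (v : E) :
    VectorField.mpullbackWithin 𝓘(ℝ, E) 𝓘(ℝ, E) (extChartAt 𝓘(ℝ, E) (1 : G)).symm
      (mulInvariantVectorField (I := 𝓘(ℝ, E)) (v : GroupLieAlgebra 𝓘(ℝ, E) G))
      (range 𝓘(ℝ, E)) z = fderiv ℝ (lmul E G) (z, lo E G) (0, v) := by
  rw [VectorField.mpullbackWithin_apply]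
  rw [ContinuousLinearMap.inverse_eq
    (mfderivWithin_extChartAt_symm_comp_mfderiv_extChartAt (I := 𝓘(ℝ, E)) hz)
    (mfderiv_extChartAt_comp_mfderivWithin_extChartAt_symm (I := 𝓘(ℝ, E)) hz)]
  have hz' : li G z ∈ lsrc E G := li_mem hz
  have hc : MDifferentiableAt 𝓘(ℝ, E) 𝓘(ℝ, E) (extChartAt 𝓘(ℝ, E) (1 : G)) (li G z * 1) := by
    rw [mul_one]
    exact (contMDiffAt_lc hz').mdifferentiableAt (by simp)
  have hm : MDifferentiableAt 𝓘(ℝ, E) 𝓘(ℝ, E) (fun x : G => li G z * x) 1 :=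
    (contMDiffAt_const.mul contMDiffAt_id : ContMDiffAt 𝓘(ℝ, E) 𝓘(ℝ, E) ∞
      (fun x : G => li G z * x) 1).mdifferentiableAt (by simp)
  have h1 : mfderiv 𝓘(ℝ, E) 𝓘(ℝ, E) (lc E ∘ (fun x : G => li G z * x)) 1 v =
      mfderiv 𝓘(ℝ, E) 𝓘(ℝ, E) (extChartAt 𝓘(ℝ, E) (1 : G)) (li G z * 1)
        (mfderiv 𝓘(ℝ, E) 𝓘(ℝ, E) (fun x : G => li G z * x) 1 v) :=
    DFunLike.congr_fun (mfderiv_comp (I' := 𝓘(ℝ, E)) (1 : G) hc hm) v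
  have h2 : mfderiv 𝓘(ℝ, E) 𝓘(ℝ, E) (lc E ∘ (fun x : G => li G z * x)) 1 =
      fderivWithin ℝ (lc E ∘ (fun x : G => li G z * x) ∘ li G) (range 𝓘(ℝ, E)) (lo E G) :=
    (hc.comp (1 : G) hm).mfderiv
  rw [modelWithCornersSelf_coe, range_id, fderivWithin_univ] at h2
  have h3 : fderiv ℝ (lc E ∘ (fun x : G => li G z * x) ∘ li G) (lo E G) v =
      fderiv ℝ (lmul E G) (z, lo E G) (0, v) := by
    have := (hasFDerivAt_lmul_left hz).fderiv
    exact (DFunLike.congr_fun this v).trans (by simp)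
  have h4 := (DFunLike.congr_fun h2 v).trans h3
  rw [← h4]
  refine Eq.trans ?_ h1.symm
  rw [mul_one]
  rfl

/-- The bracket of fields is computed in the chart at `1`, where its two terms are the two terms of
`ad_eq_sub`. From here on the bracket can be used as a bounded bilinear map. -/
lemma br_eq (x y : E) : br G x y = ad E G x y := by
  change VectorField.mlieBracketWithin 𝓘(ℝ, E)
    (mulInvariantVectorField (I := 𝓘(ℝ, E)) (x : GroupLieAlgebra 𝓘(ℝ, E) G))
    (mulInvariantVectorField (I := 𝓘(ℝ, E)) (y : GroupLieAlgebra 𝓘(ℝ, E) G)) univ (1 : G) = _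
  rw [VectorField.mlieBracketWithin_apply, mfderiv_extChartAt_self]
  refine (DFunLike.congr_fun (ContinuousLinearMap.inverse_id (R := ℝ) (M := E)) _).trans ?_
  set W : E → E → E := fun v => VectorField.mpullbackWithin 𝓘(ℝ, E) 𝓘(ℝ, E)
    (extChartAt 𝓘(ℝ, E) (1 : G)).symm
    (mulInvariantVectorField (I := 𝓘(ℝ, E)) (v : GroupLieAlgebra 𝓘(ℝ, E) G)) (range 𝓘(ℝ, E)) with hW
  have hWz : ∀ v, ∀ z ∈ ltgt E G, W v z = fderiv ℝ (lmul E G) (z, lo E G) (0, v) := fun v z hz =>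
    mpullbackWithin_mulInvariantVectorField hz v
  have hS : (extChartAt 𝓘(ℝ, E) (1 : G)).symm ⁻¹' univ ∩ range 𝓘(ℝ, E) = univ := by simp
  have key : ∀ v w : E, fderivWithin ℝ (W v) univ (lo E G) w =
      fderiv ℝ (fderiv ℝ (lmul E G)) (lo E G, lo E G) (w, 0) (0, v) := by
    intro v w
    have := ((hasFDerivAt_fderiv_lmul_left (E := E) (G := G) (0, v)).congr_of_eventuallyEq (by
      filter_upwards [eventually_mem_ltgt (E := E) (G := G)] with z hz
      exact hWz v z hz)).fderiv
    rw [fderivWithin_univ, this]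
    simp
  have key0 : ∀ v : E, W v (lo E G) = v := by
    intro v
    rw [hWz v _ lo_mem_ltgt, hasFDerivAt_lmul.fderiv]
    simp
  rw [ad_eq_sub]
  change fderivWithin ℝ (W y) ((extChartAt 𝓘(ℝ, E) (1 : G)).symm ⁻¹' univ ∩ range 𝓘(ℝ, E))
      (lo E G) (W x (lo E G)) - fderivWithin ℝ (W x)
      ((extChartAt 𝓘(ℝ, E) (1 : G)).symm ⁻¹' univ ∩ range 𝓘(ℝ, E)) (lo E G) (W y (lo E G)) = _
  rw [hS, key0, key0, key, key]

end Bracket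

/-! ## Logarithmic velocities -/

section LogVel

variable {E : Type*} [NormedAddCommGroup E] [NormedSpace ℝ E]
  {G : Type*} [TopologicalSpace G] [ChartedSpace E G] [Group G]

/-- `u̇ u⁻¹ = a` at time `t ∈ [0,1]`. -/
def HasLogVel (u : ℝ → G) (a : E) (t : ℝ) : Prop :=
  ContinuousWithinAt u (Icc 0 1) t ∧
    HasDerivWithinAt (fun s => lc E (u s * (u t)⁻¹)) a (Icc 0 1) t

variable [LieGroup 𝓘(ℝ, E) ∞ G]

/-- The chain rule applied to u(s) = (u(s) u(t)⁻¹) u(t), whose first factor stays in the chart at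
`1` for `s` near `t`. -/
lemma HasLogVel.comp {F : Type*} [NormedAddCommGroup F] [NormedSpace ℝ F] {u : ℝ → G} {a : E}
    {t : ℝ} (hu : HasLogVel u a t) (ht : t ∈ Icc (0 : ℝ) 1) {f : G → F} {L : E →L[ℝ] F}
    (hf : HasFDerivAt (fun z => f (li G z * u t)) L (lo E G)) :
    HasDerivWithinAt (fun s => f (u s)) (L a) (Icc 0 1) t := by
  have := topologicalGroup_of_lieGroup 𝓘(ℝ, E) ∞ (G := G)
  have h0 : lc E (u t * (u t)⁻¹) = lo E G := by simp
  have hf' : HasFDerivAt (fun z => f (li G z * u t)) L (lc E (u t * (u t)⁻¹)) := by rwa [h0]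
  refine (hf'.comp_hasDerivWithinAt t hu.2).congr_of_eventuallyEq_of_mem ?_ ht
  have hc : ContinuousWithinAt (fun s => u s * (u t)⁻¹) (Icc 0 1) t :=
    hu.1.mul continuousWithinAt_const
  filter_upwards [hc.eventually ((isOpen_lsrc (E := E) (G := G)).mem_nhds
    (by simpa using one_mem_lsrc))] with s hs
  simp only [Function.comp_apply]
  rw [li_lc hs, inv_mul_cancel_right]

/-- With w = u v one has w(s) w(t)⁻¹ = (u(s) u(t)⁻¹) · u(t) (v(s) v(t)⁻¹) u(t)⁻¹, and multiplication
has derivative (x, y) ↦ x + y at the identity. -/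
lemma HasLogVel.mul {u v : ℝ → G} {a b : E} {t : ℝ} (hu : HasLogVel u a t) (hv : HasLogVel v b t)
    (ht : t ∈ Icc (0 : ℝ) 1) : HasLogVel (fun s => u s * v s) (a + Ad (u t) b) t := by
  have := topologicalGroup_of_lieGroup 𝓘(ℝ, E) ∞ (G := G)
  refine ⟨hu.1.mul hv.1, ?_⟩
  have h1 : HasDerivWithinAt (fun s => lc E (u t * (v s * (v t)⁻¹) * (u t)⁻¹)) (Ad (u t) b)
      (Icc 0 1) t := by
    refine hv.comp ht (f := fun g => lc E (u t * (g * (v t)⁻¹) * (u t)⁻¹)) ?_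
    simpa using hasFDerivAt_conj (E := E) (u t)
  have h0 : (lc E (u t * (u t)⁻¹), lc E (u t * (v t * (v t)⁻¹) * (u t)⁻¹)) =
      (lo E G, lo E G) := by simp
  have hm : HasFDerivAt (lmul E G)
      (ContinuousLinearMap.fst ℝ E E + ContinuousLinearMap.snd ℝ E E)
      (lc E (u t * (u t)⁻¹), lc E (u t * (v t * (v t)⁻¹) * (u t)⁻¹)) := by
    rw [h0]; exact hasFDerivAt_lmul
  have h2 := HasFDerivAt.comp_hasDerivWithinAt (l := lmul E G) t hm (hu.2.prodMk h1)
  refine HasDerivWithinAt.congr_of_eventuallyEq_of_mem (h2.congr_deriv (by simp)) ?_ ht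
  have hc1 : ContinuousWithinAt (fun s => u s * (u t)⁻¹) (Icc 0 1) t :=
    hu.1.mul continuousWithinAt_const
  have hc2 : ContinuousWithinAt (fun s => u t * (v s * (v t)⁻¹) * (u t)⁻¹) (Icc 0 1) t :=
    (continuousWithinAt_const.mul (hv.1.mul continuousWithinAt_const)).mul continuousWithinAt_const
  filter_upwards [hc1.eventually ((isOpen_lsrc (E := E) (G := G)).mem_nhds
    (by simpa using one_mem_lsrc)), hc2.eventually ((isOpen_lsrc (E := E) (G := G)).mem_nhds
    (by simpa using one_mem_lsrc))] with s hs1 hs2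
  simp only [Function.comp_apply, lmul]
  rw [li_lc hs1, li_lc hs2]
  congr 1
  group

lemma HasLogVel.inv {u : ℝ → G} {a : E} {t : ℝ} (hu : HasLogVel u a t)
    (ht : t ∈ Icc (0 : ℝ) 1) : HasLogVel (fun s => (u s)⁻¹) (-Ad (u t)⁻¹ a) t := by
  have := topologicalGroup_of_lieGroup 𝓘(ℝ, E) ∞ (G := G)
  refine ⟨hu.1.inv, ?_⟩
  have h1 := hasFDerivAt_conj_comp (f := fun g : G => lc E g⁻¹) (u t)⁻¹
    (hasFDerivAt_linv (E := E) (G := G))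
  have h2 := hu.comp ht (f := fun g => lc E (g⁻¹ * ((u t)⁻¹)⁻¹))
    (h1.congr_of_eventuallyEq (Eventually.of_forall fun z => by
      simp only [mul_inv_rev, inv_inv, mul_assoc]))
  simpa using h2

lemma HasLogVel.hasDerivWithinAt_Ad {u : ℝ → G} {a : E} {t : ℝ} (hu : HasLogVel u a t)
    (ht : t ∈ Icc (0 : ℝ) 1) :
    HasDerivWithinAt (fun s => (Ad (u s) : E →L[ℝ] E)) (ad E G a ∘L Ad (u t)) (Icc 0 1) t := by
  refine hu.comp ht (L := (ContinuousLinearMap.compL ℝ E E E).flip (Ad (u t)) ∘L ad E G) ?_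
  have := ((ContinuousLinearMap.compL ℝ E E E).flip (Ad (u t))).hasFDerivAt.comp _
    (hasFDerivAt_Ad_li (E := E) (G := G))
  refine this.congr_of_eventuallyEq (Eventually.of_forall fun z => ?_)
  simp [Ad_mul]

lemma hasLogVel_iff_hasMFDerivWithinAt {u : ℝ → G} {a : E} {t : ℝ} :
    HasLogVel u a t ↔ HasMFDerivWithinAt 𝓘(ℝ, ℝ) 𝓘(ℝ, E) (fun s => u s * (u t)⁻¹) (Icc 0 1) t
      (ContinuousLinearMap.toSpanSingleton ℝ a : ℝ →L[ℝ] E) := by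
  have := topologicalGroup_of_lieGroup 𝓘(ℝ, E) ∞ (G := G)
  have hc : ContinuousWithinAt (fun s => u s * (u t)⁻¹) (Icc 0 1) t ↔
      ContinuousWithinAt u (Icc 0 1) t := by
    refine ⟨fun h => ?_, fun h => h.mul continuousWithinAt_const⟩
    have h2 := h.mul (continuousWithinAt_const (b := u t))
    exact h2.congr (fun s _ => by simp) (by simp)
  have h1 : u t * (u t)⁻¹ = 1 := mul_inv_cancel _
  have hs : (extChartAt 𝓘(ℝ, ℝ) t).symm ⁻¹' (Icc (0 : ℝ) 1) ∩ range 𝓘(ℝ, ℝ) = Icc 0 1 := by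
    rw [modelWithCornersSelf_coe, range_id, inter_univ]
    rfl
  change _ ↔ ContinuousWithinAt (fun s => u s * (u t)⁻¹) (Icc 0 1) t ∧
    HasFDerivWithinAt (extChartAt 𝓘(ℝ, E) (u t * (u t)⁻¹) ∘ (fun s => u s * (u t)⁻¹) ∘
      (extChartAt 𝓘(ℝ, ℝ) t).symm) (ContinuousLinearMap.toSpanSingleton ℝ a)
      ((extChartAt 𝓘(ℝ, ℝ) t).symm ⁻¹' (Icc (0 : ℝ) 1) ∩ range 𝓘(ℝ, ℝ))
      (extChartAt 𝓘(ℝ, ℝ) t t)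
  rw [hc, hs, h1]
  exact Iff.rfl

lemma HasLogVel.logVel_eq {u : ℝ → G} {a : E} {t : ℝ} (h : HasLogVel u a t)
    (ht : t ∈ Icc (0 : ℝ) 1) : logVel u t = a := by
  have hu : UniqueMDiffWithinAt 𝓘(ℝ, ℝ) (Icc (0 : ℝ) 1) t :=
    uniqueMDiffWithinAt_iff_uniqueDiffWithinAt.2 (uniqueDiffOn_Icc one_pos t ht)
  have h1 := (hasLogVel_iff_hasMFDerivWithinAt.1 h).mfderivWithin hu
  refine (DFunLike.congr_fun h1 (1 : ℝ)).trans ?_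
  exact (ContinuousLinearMap.toSpanSingleton_apply ℝ a 1).trans (one_smul ℝ a)

lemma hasLogVel_of_contMDiffOn {u : ℝ → G} {n : WithTop ℕ∞} (hn : n ≠ 0)
    (hu : ContMDiffOn 𝓘(ℝ, ℝ) 𝓘(ℝ, E) n u (Icc 0 1)) {t : ℝ} (ht : t ∈ Icc (0 : ℝ) 1) :
    HasLogVel u (logVel u t : E) t := by
  have hr : MDifferentiable 𝓘(ℝ, E) 𝓘(ℝ, E) (fun g : G => g * (u t)⁻¹) :=
    (contMDiff_mul_right (I := 𝓘(ℝ, E)) (n := ∞) (a := (u t)⁻¹)).mdifferentiable (by simp)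
  have h1 : MDifferentiableWithinAt 𝓘(ℝ, ℝ) 𝓘(ℝ, E) (fun s => u s * (u t)⁻¹) (Icc 0 1) t :=
    (hr (u t)).comp_mdifferentiableWithinAt t ((hu t ht).mdifferentiableWithinAt hn)
  rw [hasLogVel_iff_hasMFDerivWithinAt]
  refine h1.hasMFDerivWithinAt.congr_mfderiv ?_
  refine ContinuousLinearMap.ext_ring (R₁ := ℝ) (M₁ := E) ?_
  exact ((ContinuousLinearMap.toSpanSingleton_apply ℝ _ 1).trans (one_smul ℝ _)).symm

end LogVel

/-! ## Developments: curves in the group with prescribed logarithmic velocity -/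

section Development

universe u v

variable {E : Type u} [NormedAddCommGroup E] [NormedSpace ℝ E]
  {G : Type v} [TopologicalSpace G] [ChartedSpace E G] [Group G]

/-- `u` is the curve in `G` with `u̇ u⁻¹ = a` and `u(0) = 1`. -/
structure IsDev (a : C(unitInterval, E)) (u : ℝ → G) : Prop where
  zero : u 0 = 1
  vel : ∀ t : unitInterval, HasLogVel u (a t) t

variable [LieGroup 𝓘(ℝ, E) ∞ G]

/-- Near each time the curve, translated into the chart at `1`, has zero derivative on an interval;
hence it is locally constant on the connected set [0,1]. -/
lemma eq_of_hasLogVel_zero {w : ℝ → G} (hw : ∀ t : unitInterval, HasLogVel w (0 : E) t)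
    (t : unitInterval) : w t = w 0 := by
  have := topologicalGroup_of_lieGroup 𝓘(ℝ, E) ∞ (G := G)
  have hl : IsLocallyConstant (fun t : unitInterval => w t) := by
    rw [IsLocallyConstant.iff_eventually_eq]
    intro t₀
    have hc : ContinuousWithinAt (fun s => w s * (w t₀)⁻¹) (Icc 0 1) (t₀ : ℝ) :=
      (hw t₀).1.mul continuousWithinAt_const
    have hev : ∀ᶠ s in 𝓝[Icc 0 1] (t₀ : ℝ), w s * (w t₀)⁻¹ ∈ lsrc E G :=
      hc.eventually ((isOpen_lsrc (E := E) (G := G)).mem_nhds (by simpa using one_mem_lsrc))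
    obtain ⟨δ, hδ, hball⟩ := Metric.mem_nhdsWithin_iff.1 hev
    have hconv : Convex ℝ (Metric.ball (t₀ : ℝ) δ ∩ Icc 0 1) :=
      (convex_ball _ _).inter (convex_Icc _ _)
    have hder : ∀ s ∈ Metric.ball (t₀ : ℝ) δ ∩ Icc 0 1,
        HasDerivWithinAt (fun s => lc E (w s * (w t₀)⁻¹)) 0 (Metric.ball (t₀ : ℝ) δ ∩ Icc 0 1) s := by
      intro s hs
      have hd : DifferentiableAt ℝ (fun z => lc E (li G z * w s * (w t₀)⁻¹)) (lo E G) := by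
        refine (contDiffAt_lc_comp ((contMDiffAt_li_lo.mul contMDiffAt_const).mul
          contMDiffAt_const) ?_).differentiableAt (by simp)
        simpa using hball hs
      have := (hw ⟨s, hs.2⟩).comp hs.2 (f := fun g => lc E (g * (w t₀)⁻¹)) hd.hasFDerivAt
      rw [map_zero] at this
      exact this.mono inter_subset_right
    have hball' : ∀ᶠ s : unitInterval in 𝓝 t₀, (s : ℝ) ∈ Metric.ball (t₀ : ℝ) δ :=
      continuous_subtype_val.continuousAt.eventually (Metric.ball_mem_nhds _ hδ)
    filter_upwards [hball'] with s hs
    have hmem : ((s : ℝ)) ∈ Metric.ball (t₀ : ℝ) δ ∩ Icc 0 1 := ⟨hs, s.2⟩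
    have hmem0 : ((t₀ : ℝ)) ∈ Metric.ball (t₀ : ℝ) δ ∩ Icc 0 1 := ⟨Metric.mem_ball_self hδ, t₀.2⟩
    have h1 := hconv.norm_image_sub_le_of_norm_hasDerivWithin_le (C := 0) hder (by simp) hmem0 hmem
    rw [zero_mul, norm_le_zero_iff, sub_eq_zero] at h1
    have h2 := congrArg (li G) h1
    rw [li_lc (hball hmem), li_lc (hball hmem0)] at h2
    exact mul_inv_eq_one.1 (by simpa using h2)
  exact hl.apply_eq_of_isPreconnected isPreconnected_univ (mem_univ t) (mem_univ 0)

/-- The curve u⁻¹v has logarithmic velocity -Ad(u)⁻¹a + Ad(u)⁻¹a = 0. -/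
lemma IsDev.eq {a : C(unitInterval, E)} {u v : ℝ → G} (hu : IsDev a u) (hv : IsDev a v)
    (t : unitInterval) : u t = v t := by
  have h := eq_of_hasLogVel_zero (E := E) (w := fun s => (u s)⁻¹ * v s) (fun t => by
    have := ((hu.vel t).inv t.2).mul (hv.vel t) t.2
    simpa using this) t
  simp only [hu.zero, hv.zero] at h
  exact (inv_mul_eq_one.1 (by simpa using h))

lemma continuous_Ad : Continuous (fun g : G => (Ad g : E →L[ℝ] E)) := by
  have := topologicalGroup_of_lieGroup 𝓘(ℝ, E) ∞ (G := G)
  have h1 : ContinuousAt (fun g : G => (Ad g : E →L[ℝ] E)) 1 := by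
    have h := ContinuousAt.comp (g := fun z => (Ad (li G z) : E →L[ℝ] E)) (f := lc E) (x := (1 : G))
      contDiffAt_Ad_li.continuousAt (contMDiffAt_lc one_mem_lsrc).continuousAt
    refine h.congr ?_
    filter_upwards [(isOpen_lsrc (E := E) (G := G)).mem_nhds one_mem_lsrc] with g hg
    simp only [Function.comp_apply]
    rw [li_lc hg]
  rw [continuous_iff_continuousAt]
  intro g
  have h2 : ContinuousAt (fun x : G => x * g⁻¹) g := by fun_prop
  have h3 : ContinuousAt (fun x : G => (Ad (x * g⁻¹) : E →L[ℝ] E) ∘L Ad g) g := by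
    refine ContinuousAt.clm_comp ?_ continuousAt_const
    exact ContinuousAt.comp (g := fun g : G => (Ad g : E →L[ℝ] E)) (by simpa using h1) h2
  refine h3.congr (Eventually.of_forall fun x => ?_)
  simp only [← Ad_mul, inv_mul_cancel_right]

/-- Compactness of `G` gives a bound independent of the position on a curve, so developments can be
continued in finitely many steps of equal size. -/
lemma exists_norm_Ad_le [CompactSpace G] : ∃ C : ℝ, 0 < C ∧ ∀ g : G, ‖(Ad g : E →L[ℝ] E)‖ ≤ C := by
  obtain ⟨C, hC⟩ := (isCompact_range (continuous_Ad (E := E) (G := G)).norm).bddAbove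
  exact ⟨max C 1, by positivity, fun g => (hC (mem_range_self g)).trans (le_max_left _ _)⟩

lemma IsDev.continuousOn {a : C(unitInterval, E)} {u : ℝ → G} (hu : IsDev a u) :
    ContinuousOn u (Icc 0 1) := fun t ht => (hu.vel ⟨t, ht⟩).1

variable (E) in
/-- The path `t ↦ Ad (u(t))`. -/
def AdPath (u : ℝ → G) (hu : ContinuousOn u (Icc 0 1)) : C(unitInterval, E →L[ℝ] E) :=
  ⟨fun t => Ad (u t), continuous_Ad.comp hu.domRestrict⟩

lemma IsDev.mul {a b c : C(unitInterval, E)} {u v : ℝ → G} (hu : IsDev a u) (hv : IsDev b v)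
    (h : ∀ t : unitInterval, c t = a t + Ad (u t) (b t)) : IsDev c (fun s => u s * v s) where
  zero := by simp [hu.zero, hv.zero]
  vel t := by rw [h]; exact (hu.vel t).mul (hv.vel t) t.2

lemma IsDev.inv {a c : C(unitInterval, E)} {u : ℝ → G} (hu : IsDev a u)
    (h : ∀ t : unitInterval, c t = -Ad (u t)⁻¹ (a t)) : IsDev c (fun s => (u s)⁻¹) where
  zero := by simp [hu.zero]
  vel t := by rw [h]; exact (hu.vel t).inv t.2

lemma isDev_zero : IsDev (0 : C(unitInterval, E)) (fun _ => (1 : G)) where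
  zero := rfl
  vel _ := ⟨continuousWithinAt_const, hasDerivWithinAt_const _ _ _⟩

lemma IsDev.hasDerivPath_Ad {a : C(unitInterval, E)} {u : ℝ → G} (hu : IsDev a u) :
    HasDerivPath (AdPath E u hu.continuousOn)
      (bilinOp (ContinuousLinearMap.compL ℝ E E E ∘L ad E G) a (AdPath E u hu.continuousOn)) := by
  intro t
  refine ((hu.vel t).hasDerivWithinAt_Ad t.2).congr (fun s hs => ?_) ?_
  · rw [ext01_of_mem _ hs]; rfl
  · rw [ext01_coe]; rfl

/-! ### Local existence in the chart -/

variable (E G) in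
/-- The derivative at the identity of right translation by the point with coordinates `y`. -/
def rmulD (y : E) : E →L[ℝ] E := fderiv ℝ (lmul E G) (lo E G, y) ∘L .inl ℝ E E

lemma hasFDerivAt_lmul_right {y : E} (hy : y ∈ ltgt E G) :
    HasFDerivAt (fun z => lmul E G (z, y)) (rmulD E G y) (lo E G) := by
  have hd : DifferentiableAt ℝ (lmul E G) (lo E G, y) :=
    (contDiffAt_lmul lo_mem_ltgt hy (by simpa using li_mem hy)).differentiableAt (by simp)
  exact HasFDerivAt.comp (g := lmul E G) (f := fun z => (z, y)) (lo E G) hd.hasFDerivAt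
    (hasFDerivAt_prodMk_left _ _)

@[simp] lemma rmulD_lo : rmulD E G (lo E G) = ContinuousLinearMap.id ℝ E := by
  rw [rmulD, hasFDerivAt_lmul.fderiv]; ext; simp

lemma contDiffAt_rmulD {y : E} (hy : y ∈ ltgt E G) : ContDiffAt ℝ ∞ (rmulD E G) y := by
  have h : ContDiffAt ℝ ∞ (fderiv ℝ (lmul E G)) (lo E G, y) :=
    (contDiffAt_lmul lo_mem_ltgt hy (by simpa using li_mem hy)).fderiv_right le_rfl
  have h2 : ContDiffAt ℝ ∞ (fun y => fderiv ℝ (lmul E G) (lo E G, y)) y :=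
    ContDiffAt.comp (g := fderiv ℝ (lmul E G)) y h (contDiffAt_const.prodMk contDiffAt_id)
  exact h2.clm_comp contDiffAt_const

/-- This identifies the differential equation to be solved in the chart. The derivative of right
translation by y⁻¹ at `y` is a left inverse of `rmulD E G y`, by differentiating (z y) y⁻¹ = z. -/
lemma hasLogVel_li {x : ℝ → E} {a : E} {t : ℝ} (ht : x t ∈ ltgt E G)
    (hx : HasDerivWithinAt x (rmulD E G (x t) a) (Icc 0 1) t) :
    HasLogVel (fun s => li G (x s)) a t := by
  have := topologicalGroup_of_lieGroup 𝓘(ℝ, E) ∞ (G := G)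
  refine ⟨(contMDiffAt_li ht).continuousAt.comp_continuousWithinAt hx.continuousWithinAt, ?_⟩
  set y := x t with hy
  have hd : DifferentiableAt ℝ (fun z => lc E (li G z * (li G y)⁻¹)) y := by
    refine (contDiffAt_lc_comp ((contMDiffAt_li ht).mul contMDiffAt_const) ?_).differentiableAt
      (by simp)
    simpa using one_mem_lsrc
  have h0 : lmul E G (lo E G, y) = y := by simp [lmul, lc_li ht]
  have hd' : HasFDerivAt (fun z => lc E (li G z * (li G y)⁻¹))
      (fderiv ℝ (fun z => lc E (li G z * (li G y)⁻¹)) y) (lmul E G (lo E G, y)) := by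
    rw [h0]; exact hd.hasFDerivAt
  have h1 := HasFDerivAt.comp (lo E G) hd' (hasFDerivAt_lmul_right ht)
  have hc : ContinuousAt (fun z => li G z * li G y) (lo E G) :=
    (contMDiffAt_li_lo (E := E) (G := G)).continuousAt.mul continuousAt_const
  have h2 := h1.unique ((hasFDerivAt_id (lo E G)).congr_of_eventuallyEq (by
    filter_upwards [hc.eventually ((isOpen_lsrc (E := E) (G := G)).mem_nhds
      (by simpa using li_mem ht)), eventually_mem_ltgt (E := E) (G := G)] with z hz hz'
    simp [lmul, li_lc hz, lc_li hz']))
  have h3 := hd.hasFDerivAt.comp_hasDerivWithinAt t hx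
  have h4 := DFunLike.congr_fun h2 a
  simp only [ContinuousLinearMap.comp_apply, ContinuousLinearMap.id_apply] at h4
  rw [h4] at h3
  exact h3

/-- The superposition operator needs a coefficient smooth on the whole vector space, so `rmulD` is
cut off by a bump function supported in the chart. -/
lemma exists_contDiff_rmulD [FiniteDimensional ℝ E] :
    ∃ M : E → E →L[ℝ] E, ContDiff ℝ ∞ M ∧ ∀ᶠ y in 𝓝 (lo E G), M y = rmulD E G y := by
  obtain ⟨r, hr, hball⟩ := Metric.nhds_basis_closedBall.mem_iff.1
    ((isOpen_ltgt (E := E) (G := G)).mem_nhds lo_mem_ltgt)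
  let χ : ContDiffBump (lo E G) := ⟨r / 2, r, half_pos hr, half_lt_self hr⟩
  refine ⟨fun y => χ y • rmulD E G y, ?_, ?_⟩
  · rw [contDiff_iff_contDiffAt]
    intro y
    by_cases hy : y ∈ ltgt E G
    · exact χ.contDiff.contDiffAt.smul (contDiffAt_rmulD hy)
    · have hy' : y ∈ (Metric.closedBall (lo E G) r)ᶜ := fun h => hy (hball h)
      refine (contDiffAt_const (c := (0 : E →L[ℝ] E))).congr_of_eventuallyEq ?_
      filter_upwards [Metric.isClosed_closedBall.isOpen_compl.mem_nhds hy'] with z hz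
      have hz' : r ≤ dist z (lo E G) := by
        rw [mem_compl_iff, Metric.mem_closedBall, not_le] at hz
        exact hz.le
      rw [χ.zero_of_le_dist hz', zero_smul]
  · filter_upwards [Metric.closedBall_mem_nhds (lo E G) (half_pos hr)] with y hy
    rw [χ.one_of_mem_closedBall hy, one_smul]

lemma HasDerivPath.superpose {X Y : Type*} [NormedAddCommGroup X] [NormedSpace ℝ X]
    [NormedAddCommGroup Y] [NormedSpace ℝ Y] {x x' : C(unitInterval, X)} (hx : HasDerivPath x x')
    {f : X → Y} (hf : ContDiff ℝ 1 f) :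
    HasDerivPath (superpose f hf.continuous x)
      (applyOp (NahmSchmid.superpose (fderiv ℝ f) (hf.continuous_fderiv one_ne_zero) x) x') := by
  intro t
  have hd : HasFDerivAt f (fderiv ℝ f (ext01 x t)) (ext01 x t) :=
    (hf.differentiable one_ne_zero _).hasFDerivAt
  have h := hd.comp_hasDerivWithinAt (t : ℝ) (hx t)
  rw [ext01_coe] at h
  exact h

lemma HasDerivPath.pair {X Y : Type u} [NormedAddCommGroup X] [NormedSpace ℝ X]
    [NormedAddCommGroup Y] [NormedSpace ℝ Y] {x x' : C(unitInterval, X)} (hx : HasDerivPath x x')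
    {y y' : C(unitInterval, Y)} (hy : HasDerivPath y y') :
    HasDerivPath (F := X × Y) (pairOp (x, y)) (pairOp (x', y')) := by
  intro t
  have h := (hx t).prodMk (hy t)
  rw [pairOp_apply]
  refine h.congr (fun s hs => ?_) ?_
  · rw [ext01_of_mem _ hs, ext01_of_mem _ hs, ext01_of_mem _ hs, pairOp_apply]
  · rw [ext01_coe, ext01_coe, ext01_coe, pairOp_apply]

lemma HasDerivPath.contDiffOn_two {X : Type*} [NormedAddCommGroup X] [NormedSpace ℝ X]
    {x x' x'' : C(unitInterval, X)} (hx : HasDerivPath x x') (hx' : HasDerivPath x' x'') :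
    ContDiffOn ℝ 2 (ext01 x) (Icc 0 1) := by
  have hU : UniqueDiffOn ℝ (Icc (0 : ℝ) 1) := uniqueDiffOn_Icc one_pos
  have key : ∀ {y y' : C(unitInterval, X)}, HasDerivPath y y' →
      ∀ s ∈ Icc (0 : ℝ) 1, derivWithin (ext01 y) (Icc 0 1) s = ext01 y' s := by
    intro y y' hy s hs
    rw [ext01_of_mem y' hs]
    exact (hy ⟨s, hs⟩).derivWithin (hU s hs)
  have key2 : ∀ {y y' : C(unitInterval, X)}, HasDerivPath y y' →
      DifferentiableOn ℝ (ext01 y) (Icc 0 1) := fun hy s hs =>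
    (hy ⟨s, hs⟩).differentiableWithinAt
  rw [show (2 : WithTop ℕ∞) = 1 + 1 by norm_num, contDiffOn_succ_iff_derivWithin hU]
  refine ⟨key2 hx, by simp, ContDiffOn.congr ?_ (key hx)⟩
  rw [show (1 : WithTop ℕ∞) = 0 + 1 by norm_num, contDiffOn_succ_iff_derivWithin hU]
  refine ⟨key2 hx', by simp, ContDiffOn.congr ?_ (key hx')⟩
  exact contDiffOn_zero.2 (continuous_ext01 _).continuousOn

end Development

/-! ### Existence of developments and smoothness of the holonomy map. -/

section Holonomy

universe u v

lemma two_le_smooth : (2 : WithTop ℕ∞) ≤ ∞ :=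
  (WithTop.coe_le_coe.2 le_top : ((2 : ℕ∞) : WithTop ℕ∞) ≤ ((⊤ : ℕ∞) : WithTop ℕ∞))

variable {E : Type u} [NormedAddCommGroup E] [NormedSpace ℝ E]
  {G : Type v} [TopologicalSpace G] [ChartedSpace E G] [Group G] [LieGroup 𝓘(ℝ, E) ∞ G]

variable (E G) in
/-- Short paths in the Lie algebra have developments inside the chart at `1`, depending smoothly on
the path. -/
theorem exists_local_dev [FiniteDimensional ℝ E] :
    ∃ X : C(unitInterval, E) → C(unitInterval, E), ContDiffAt ℝ ∞ X 0 ∧ HasFDerivAt X intOp 0 ∧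
      X 0 = constOp E (lo E G) ∧ ∀ᶠ a in 𝓝 0, IsDev a (fun s => li G (ext01 (X a) s)) ∧
        (∀ t, X a t ∈ ltgt E G) ∧
        ∀ a', HasDerivPath a a' → ContDiffOn ℝ 2 (ext01 (X a)) (Icc 0 1) := by
  have := FiniteDimensional.complete ℝ E
  obtain ⟨M, hM, hMe⟩ := exists_contDiff_rmulD (E := E) (G := G)
  set f : E × E → E := fun p => M p.2 p.1 with hf
  have hfs : ContDiff ℝ ∞ f := (hM.comp contDiff_snd).clm_apply contDiff_fst
  have hM0 : M (lo E G) = ContinuousLinearMap.id ℝ E := by rw [hMe.self_of_nhds, rmulD_lo]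
  have hf0 : fderiv ℝ f (0, lo E G) = ContinuousLinearMap.fst ℝ E E := by
    have h1 : HasFDerivAt (fun p : E × E => M p.2)
        (fderiv ℝ M (lo E G) ∘L ContinuousLinearMap.snd ℝ E E) ((0 : E), lo E G) :=
      HasFDerivAt.comp (g := M) (f := Prod.snd) ((0 : E), lo E G)
        (hM.differentiable (by simp) _).hasFDerivAt hasFDerivAt_snd
    have h2 := (h1.clm_apply hasFDerivAt_fst).fderiv
    refine h2.trans ?_
    ext <;> simp [hM0]
  have hy : constOp E (lo E G) = constOp E (lo E G) +
      intOp (superpose f hfs.continuous (pairOp (0, constOp E (lo E G)))) := by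
    have : superpose f hfs.continuous (pairOp (0, constOp E (lo E G))) = 0 := by
      ext t
      simp [hf]
    rw [this, map_zero, add_zero]
  obtain ⟨σ, hσ, hσ0, hσe⟩ := exists_smooth_solution f hfs 0 (lo E G) (constOp E (lo E G)) hy
  have hin : ContDiff ℝ ∞ (fun a : C(unitInterval, E) => (a, lo E G)) :=
    contDiff_id.prodMk contDiff_const
  set X : C(unitInterval, E) → C(unitInterval, E) := fun a => σ (a, lo E G) with hX
  have hXs : ContDiffAt ℝ ∞ X 0 := ContDiffAt.comp (g := σ) 0 hσ hin.contDiffAt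
  have hXe : ∀ᶠ a in 𝓝 (0 : C(unitInterval, E)),
      X a = constOp E (lo E G) + intOp (superpose f hfs.continuous (pairOp (a, X a))) :=
    hin.continuous.continuousAt.eventually hσe
  have hXd := (hXs.differentiableAt (by simp)).hasFDerivAt
  refine ⟨X, hXs, ?_, hσ0, ?_⟩
  · have h1 : HasFDerivAt (fun a => pairOp (a, X a))
        (pairOp ∘L ((ContinuousLinearMap.id ℝ C(unitInterval, E)).prod (fderiv ℝ X 0))) 0 :=
      HasFDerivAt.comp (g := pairOp (P := E) (F := E)) (0 : C(unitInterval, E))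
        (pairOp (P := E) (F := E)).hasFDerivAt ((hasFDerivAt_id _).prodMk hXd)
    have h2 := HasFDerivAt.comp (g := superpose f hfs.continuous) (0 : C(unitInterval, E))
      (hasFDerivAt_superpose f _ hfs.continuous (hfs.continuous_fderiv (by simp))
        (fun z => (hfs.differentiable (by simp) z).hasFDerivAt) (pairOp (0, X 0))) h1
    have h3 := HasFDerivAt.comp (g := intOp (F := E)) (0 : C(unitInterval, E))
      (intOp (F := E)).hasFDerivAt h2
    have h4 := (h3.const_add (constOp E (lo E G))).congr_of_eventuallyEq hXe
    refine h4.congr_fderiv ?_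
    ext b t
    simp only [ContinuousLinearMap.comp_apply]
    congr 2
    ext s
    have hX0 : X 0 = constOp E (lo E G) := hσ0
    simp [hX0, hf0]
  -- For small `a` the path `X a` stays where the cut-off field agrees with `rmulD`, so it solves
  -- the genuine equation and remains in the chart.
  · obtain ⟨r, hr, hball⟩ := Metric.eventually_nhds_iff.1
      (hMe.and (eventually_mem_ltgt (E := E) (G := G)))
    have hXc : ∀ᶠ a in 𝓝 (0 : C(unitInterval, E)), dist (X a) (constOp E (lo E G)) < r := by
      have := hXs.continuousAt.eventually (Metric.ball_mem_nhds (X 0) hr)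
      rwa [show X 0 = constOp E (lo E G) from hσ0] at this
    filter_upwards [hXe, hXc] with a ha hda
    have hd : HasDerivPath (X a) (superpose f hfs.continuous (pairOp (a, X a))) :=
      hasDerivPath_of_eq ha
    have hb : ∀ t, M (X a t) = rmulD E G (X a t) ∧ X a t ∈ ltgt E G := fun t =>
      hball ((ContinuousMap.dist_apply_le_dist t).trans_lt hda)
    refine ⟨⟨?_, fun t => ?_⟩, fun t => (hb t).2, fun a' ha' => ?_⟩
    · have h0 : ext01 (X a) 0 = X a 0 := ext01_coe (X a) 0
      rw [h0, ha]
      simp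
    · refine hasLogVel_li ?_ ?_
      · rw [ext01_coe]; exact (hb t).2
      · have := hd t
        simp only [superpose_apply, pairOp_apply, hf, (hb t).1] at this
        rwa [ext01_coe]
    · exact hd.contDiffOn_two ((ha'.pair hd).superpose (hfs.of_le (one_le_two.trans two_le_smooth)))

/-- A development of a `C¹` path is of class `C²`. -/
def IsDevC2 (a : C(unitInterval, E)) (u : ℝ → G) : Prop :=
  IsDev a u ∧ ∀ a', HasDerivPath a a' → ContMDiffOn 𝓘(ℝ, ℝ) 𝓘(ℝ, E) 2 u (Icc 0 1)

lemma eventually_exists_isDevC2 [FiniteDimensional ℝ E] :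
    ∀ᶠ a in 𝓝 (0 : C(unitInterval, E)), ∃ u : ℝ → G, IsDevC2 a u := by
  obtain ⟨X, -, -, -, hX⟩ := exists_local_dev E G
  filter_upwards [hX] with a ha
  refine ⟨_, ha.1, fun a' ha' => ?_⟩
  have h2 : ContMDiffOn 𝓘(ℝ, ℝ) 𝓘(ℝ, E) 2 (ext01 (X a)) (Icc 0 1) := (ha.2.2 a' ha').contMDiffOn
  intro t ht
  have h3 : ContMDiffAt 𝓘(ℝ, E) 𝓘(ℝ, E) 2 (li G) (ext01 (X a) t) := by
    rw [ext01_of_mem _ ht]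
    exact (contMDiffAt_li (ha.2.1 _)).of_le two_le_smooth
  exact h3.comp_contMDiffWithinAt t (h2 t ht)

lemma IsDev.hasDerivPath_Ad_inv_apply {a b b' : C(unitInterval, E)} {u : ℝ → G} (hu : IsDev a u)
    (hb : HasDerivPath b b') :
    ∃ c c' : C(unitInterval, E), HasDerivPath c c' ∧ ∀ t : unitInterval, c t = Ad (u t)⁻¹ (b t) := by
  have hc : ContinuousOn (fun s => (u s)⁻¹) (Icc 0 1) := by
    have := topologicalGroup_of_lieGroup 𝓘(ℝ, E) ∞ (G := G)
    exact hu.continuousOn.inv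
  have hi : IsDev (-(applyOp (AdPath E _ hc) a)) (fun s => (u s)⁻¹) := hu.inv fun t => rfl
  exact ⟨_, _, hi.hasDerivPath_Ad.bilinOp (ContinuousLinearMap.id ℝ (E →L[ℝ] E)) hb, fun t => rfl⟩

/-- Every path in the Lie algebra has a development. -/
theorem exists_isDevC2 [FiniteDimensional ℝ E] [CompactSpace G] (a : C(unitInterval, E)) :
    ∃ u : ℝ → G, IsDevC2 a u := by
  have hG := topologicalGroup_of_lieGroup 𝓘(ℝ, E) ∞ (G := G)
  have : LieGroup 𝓘(ℝ, E) 2 G := LieGroup.of_le (n := ∞) two_le_smooth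
  obtain ⟨C, hC, hAd⟩ := exists_norm_Ad_le (E := E) (G := G)
  obtain ⟨ε, hε, hball⟩ := Metric.eventually_nhds_iff.1 (eventually_exists_isDevC2 (E := E) (G := G))
  -- With C‖a‖/N < ε, every path Ad(u)⁻¹(a/N) is short enough to have a local development. If u
  -- develops (k/N)a and v develops that path, then u v develops ((k+1)/N)a.
  obtain ⟨N, hN⟩ := exists_nat_gt (C * ‖a‖ / ε)
  have hN0 : (0 : ℝ) < N := lt_of_le_of_lt (by positivity) hN
  have key : ∀ k : ℕ, ∃ u : ℝ → G, IsDevC2 ((k / N : ℝ) • a) u := by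
    intro k
    induction k with
    | zero =>
      refine ⟨fun _ => 1, ?_, fun _ _ => contMDiffOn_const⟩
      simpa using isDev_zero (E := E) (G := G)
    | succ k ih =>
      obtain ⟨u, hu, hu2⟩ := ih
      set b : C(unitInterval, E) :=
        applyOp (AdPath E (fun s => (u s)⁻¹) hu.continuousOn.inv) ((1 / N : ℝ) • a) with hb
      have hbn : dist b 0 < ε := by
        rw [dist_zero_right]
        refine lt_of_le_of_lt ((ContinuousMap.norm_le _ (by positivity)).2 fun t =>
          (((Ad (u t)⁻¹ : E →L[ℝ] E).le_opNorm _).trans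
            (mul_le_mul (hAd _) (ContinuousMap.norm_coe_le_norm _ t) (norm_nonneg _) hC.le))) ?_
        rw [norm_smul, Real.norm_of_nonneg (by positivity)]
        rw [div_lt_iff₀ hε] at hN
        have : C * (1 / N * ‖a‖) = C * ‖a‖ / N := by ring
        rw [this, div_lt_iff₀ hN0]
        linarith
      obtain ⟨v, hv, hv2⟩ := hball hbn
      refine ⟨fun s => u s * v s, hu.mul hv fun t => ?_, fun a' ha' => ?_⟩
      · have : Ad (u t) (b t) = (1 / N : ℝ) • a t := Ad_Ad_inv (u t) _
        rw [this, ContinuousMap.smul_apply, ContinuousMap.smul_apply, ← add_smul]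
        congr 1
        push_cast
        ring
      · have hk : ((k + 1 : ℕ) / N : ℝ) ≠ 0 := by positivity
        -- The regularity hypothesis concerns ((k+1)/N)a; division by the non-zero scalar transfers
        -- it to `a`, and then to the two paths developed by u and v.
        have h1 : HasDerivPath a (((k + 1 : ℕ) / N : ℝ)⁻¹ • a') := by
          intro t
          have h := (ha' t).const_smul ((k + 1 : ℕ) / N : ℝ)⁻¹
          refine h.congr (fun s hs => ?_) ?_
          · simp only [ext01_of_mem _ hs, Pi.smul_apply, ContinuousMap.smul_apply]
            rw [inv_smul_smul₀ hk]
          · simp only [ext01_coe, Pi.smul_apply, ContinuousMap.smul_apply]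
            rw [inv_smul_smul₀ hk]
        have hs : ∀ c : ℝ, HasDerivPath (c • a) (c • (((k + 1 : ℕ) / N : ℝ)⁻¹ • a')) :=
          fun c t => (h1 t).const_smul c
        obtain ⟨c, c', hcc, hc⟩ := hu.hasDerivPath_Ad_inv_apply (hs (1 / N))
        have hcb : c = b := by
          ext t
          rw [hc t]
          rfl
        exact (hu2 _ (hs _)).mul (hv2 c' (hcb ▸ hcc))
  obtain ⟨u, hu⟩ := key N
  rw [div_self hN0.ne', one_smul] at hu
  exact ⟨u, hu⟩

variable [FiniteDimensional ℝ E] [CompactSpace G]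

variable (G) in
/-- The development of a path in the Lie algebra. -/
def dev (a : C(unitInterval, E)) : ℝ → G := (exists_isDevC2 (G := G) a).choose

lemma isDev_dev (a : C(unitInterval, E)) : IsDev a (dev G a) :=
  (exists_isDevC2 (G := G) a).choose_spec.1

lemma contMDiffOn_dev {a a' : C(unitInterval, E)} (h : HasDerivPath a a') :
    ContMDiffOn 𝓘(ℝ, ℝ) 𝓘(ℝ, E) 2 (dev G a) (Icc 0 1) :=
  (exists_isDevC2 (G := G) a).choose_spec.2 a' h

lemma IsDev.eq_dev {a : C(unitInterval, E)} {u : ℝ → G} (hu : IsDev a u) (t : unitInterval) :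
    u t = dev G a t := hu.eq (isDev_dev a) t

@[simp] lemma dev_apply_zero (a : C(unitInterval, E)) : dev G a 0 = 1 := (isDev_dev a).zero

variable (G) in
/-- The end point of the development of a path. -/
def hol (a : C(unitInterval, E)) : G := dev G a 1

variable (G) in
/-- The path `t ↦ Ad (u(t))`, where `u` is the development of `a`. -/
def AdDev (a : C(unitInterval, E)) : C(unitInterval, E →L[ℝ] E) :=
  AdPath E (dev G a) (isDev_dev a).continuousOn

variable (G) in
/-- The path `t ↦ Ad (u(t))⁻¹`, where `u` is the development of `a`. -/
def AdDevInv (a : C(unitInterval, E)) : C(unitInterval, E →L[ℝ] E) :=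
  AdPath E (fun s => (dev G a s)⁻¹) (by
    have := topologicalGroup_of_lieGroup 𝓘(ℝ, E) ∞ (G := G)
    exact (isDev_dev a).continuousOn.inv)

@[simp] lemma AdDev_apply (a : C(unitInterval, E)) (t : unitInterval) :
    AdDev G a t = Ad (dev G a t) := rfl

@[simp] lemma AdDevInv_apply (a : C(unitInterval, E)) (t : unitInterval) :
    AdDevInv G a t = Ad (dev G a t)⁻¹ := rfl

lemma dev_add (a b : C(unitInterval, E)) (t : unitInterval) :
    dev G (a + applyOp (AdDev G a) b) t = dev G a t * dev G b t :=
  (((isDev_dev a).mul (isDev_dev b) fun _ => rfl).eq_dev t).symm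

lemma hol_add (a b : C(unitInterval, E)) :
    hol G (a + applyOp (AdDev G a) b) = hol G a * hol G b := dev_add a b 1

lemma hasDerivPath_AdDev (a : C(unitInterval, E)) :
    HasDerivPath (AdDev G a) (bilinOp (ContinuousLinearMap.compL ℝ E E E ∘L ad E G) a (AdDev G a)) :=
  (isDev_dev a).hasDerivPath_Ad

variable (E G) in
lemma contDiffAt_lc_hol_zero : ContDiffAt ℝ ∞ (fun a : C(unitInterval, E) => lc E (hol G a)) 0 ∧
    HasFDerivAt (fun a : C(unitInterval, E) => lc E (hol G a))
      (ContinuousMap.evalCLM ℝ (1 : unitInterval) ∘L intOp) 0 ∧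
    ∀ᶠ a in 𝓝 (0 : C(unitInterval, E)), hol G a ∈ lsrc E G := by
  obtain ⟨X, hXs, hXd, -, hXe⟩ := exists_local_dev E G
  let e : C(unitInterval, E) →L[ℝ] E := ContinuousMap.evalCLM ℝ (1 : unitInterval)
  have key : ∀ᶠ a in 𝓝 (0 : C(unitInterval, E)),
      lc E (hol G a) = X a 1 ∧ hol G a ∈ lsrc E G := by
    filter_upwards [hXe] with a ha
    have h1 : li G (ext01 (X a) (1 : unitInterval)) = hol G a := ha.1.eq_dev 1
    rw [ext01_coe] at h1
    rw [← h1]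
    exact ⟨lc_li (ha.2.1 1), li_mem (ha.2.1 1)⟩
  have hE : (fun a : C(unitInterval, E) => lc E (hol G a)) =ᶠ[𝓝 0]
      fun a => e (X a) := key.mono fun a ha => ha.1
  refine ⟨?_, ?_, key.mono fun a ha => ha.2⟩
  · exact (ContDiffAt.comp (g := ⇑e) (f := X) 0 e.contDiff.contDiffAt
      hXs).congr_of_eventuallyEq hE
  · exact (HasFDerivAt.comp (g := ⇑e) (f := X) 0 e.hasFDerivAt hXd).congr_of_eventuallyEq hE

/-- Every path is a₀ + Ad(u₀)b with b = Ad(u₀)⁻¹(a - a₀), where u₀ develops a₀. This carries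
smoothness and the derivative of the holonomy from the zero path to an arbitrary base path. -/
lemma hol_eq_mul (a₀ a : C(unitInterval, E)) :
    hol G a = hol G a₀ * hol G (applyOp (AdDevInv G a₀) (a - a₀)) := by
  rw [← hol_add]
  congr 1
  ext t
  simp

/-- The differential of the end point of the development, trivialised by left translation. -/
lemma hasFDerivAt_lc_hol (a₀ : C(unitInterval, E)) :
    HasFDerivAt (fun a => lc E ((hol G a₀)⁻¹ * hol G a))
      (ContinuousMap.evalCLM ℝ (1 : unitInterval) ∘L intOp ∘L applyOp (AdDevInv G a₀)) a₀ := by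
  have h0 : applyOp (AdDevInv G a₀) (a₀ - a₀) = 0 := by rw [sub_self, map_zero]
  have h1 : HasFDerivAt (fun a => applyOp (AdDevInv G a₀) (a - a₀)) (applyOp (AdDevInv G a₀)) a₀ := by
    exact HasFDerivAt.comp (g := applyOp (AdDevInv G a₀)) a₀
      (applyOp (AdDevInv G a₀)).hasFDerivAt ((hasFDerivAt_id a₀).sub_const a₀)
  have h2 := (contDiffAt_lc_hol_zero E G).2.1
  rw [← h0] at h2
  refine (HasFDerivAt.comp a₀ h2 h1).congr_of_eventuallyEq (Eventually.of_forall fun a => ?_)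
  simp only [Function.comp_apply]
  rw [hol_eq_mul a₀ a, inv_mul_cancel_left]

lemma contMDiffAt_hol_zero :
    ContMDiffAt 𝓘(ℝ, C(unitInterval, E)) 𝓘(ℝ, E) ∞ (hol G) (0 : C(unitInterval, E)) := by
  obtain ⟨h1, -, h3⟩ := contDiffAt_lc_hol_zero E G
  have h4 : lc E (hol G (0 : C(unitInterval, E))) ∈ ltgt E G := lc_mem h3.self_of_nhds
  refine (ContMDiffAt.comp (0 : C(unitInterval, E)) (contMDiffAt_li h4)
    h1.contMDiffAt).congr_of_eventuallyEq ?_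
  filter_upwards [h3] with a ha
  exact (li_lc ha).symm

variable (E G) in
lemma contMDiff_hol : ContMDiff 𝓘(ℝ, C(unitInterval, E)) 𝓘(ℝ, E) ∞ (hol G (E := E)) := by
  intro a₀
  have h1 : ContMDiffAt 𝓘(ℝ, C(unitInterval, E)) 𝓘(ℝ, C(unitInterval, E)) ∞
      (fun a => applyOp (AdDevInv G a₀) (a - a₀)) a₀ :=
    ((applyOp (AdDevInv G a₀)).contDiff.comp (contDiff_id.sub contDiff_const)).contDiffAt.contMDiffAt
  have h0 : applyOp (AdDevInv G a₀) (a₀ - a₀) = 0 := by rw [sub_self, map_zero]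
  have h2 : ContMDiffAt 𝓘(ℝ, C(unitInterval, E)) 𝓘(ℝ, E) ∞ (hol G)
      (applyOp (AdDevInv G a₀) (a₀ - a₀)) := by rw [h0]; exact contMDiffAt_hol_zero
  have h3 : ContMDiffAt 𝓘(ℝ, C(unitInterval, E)) 𝓘(ℝ, E) ∞
      (fun a => hol G a₀ * hol G (applyOp (AdDevInv G a₀) (a - a₀))) a₀ :=
    contMDiffAt_const.mul (h2.comp a₀ h1)
  exact h3.congr_of_eventuallyEq (Eventually.of_forall fun a => hol_eq_mul a₀ a)

variable (E G) in
-- R = Ad(u) solves the linear equation Ṙ = ad(a)R, R(0) = 1, in a fixed vector space. Hence its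
-- smoothness as a whole path follows from smooth dependence and uniqueness, without charts of `G`.
lemma contDiff_AdDev : ContDiff ℝ ∞ (AdDev G (E := E)) := by
  have := FiniteDimensional.complete ℝ E
  rw [contDiff_iff_contDiffAt]
  intro a₀
  set b := ContinuousLinearMap.compL ℝ E E E ∘L ad E G with hb
  set f : E × (E →L[ℝ] E) → (E →L[ℝ] E) := fun p => b p.1 p.2 with hf
  have hfs : ContDiff ℝ ∞ f := (b.contDiff.comp contDiff_fst).clm_apply contDiff_snd
  have hpath : ∀ (a : C(unitInterval, E)) (R : C(unitInterval, E →L[ℝ] E)),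
      superpose f hfs.continuous (pairOp (a, R)) = bilinOp b a R := by
    intro a R
    ext1 t
    simp [hf]
  have h0 : ∀ a, AdDev G a 0 = ContinuousLinearMap.id ℝ E := by
    intro a
    rw [AdDev_apply, Set.Icc.coe_zero, dev_apply_zero, Ad_one]
  have hy : AdDev G a₀ = constOp (E →L[ℝ] E) (ContinuousLinearMap.id ℝ E) +
      intOp (superpose f hfs.continuous (pairOp (a₀, AdDev G a₀))) := by
    rw [hpath, constOp_eq, ← h0 a₀]
    exact (hasDerivPath_AdDev a₀).eq_add_intOp
  obtain ⟨σ, hσ, -, hσe⟩ := exists_smooth_solution f hfs a₀ _ _ hy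
  have hin : ContDiff ℝ ∞ (fun a : C(unitInterval, E) => (a, ContinuousLinearMap.id ℝ E)) :=
    contDiff_id.prodMk contDiff_const
  refine (ContDiffAt.comp (g := σ) a₀ hσ hin.contDiffAt).congr_of_eventuallyEq ?_
  filter_upwards [hin.continuous.continuousAt.eventually hσe] with a ha
  rw [hpath] at ha
  refine (hasDerivPath_AdDev a).eq_of_linear (hasDerivPath_of_eq ha) ?_
    (b.compLeftContinuous ℝ unitInterval a) (fun t => ?_)
  · rw [h0 a, Function.comp_apply, ha]
    simp
  · simp only [bilinOp_apply, map_sub]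
    rfl

variable (E G) in
/-- Near `1`, group elements are holonomies of constant paths. -/
lemma exists_local_log : ∃ ℓ : G → E, ContMDiffAt 𝓘(ℝ, E) 𝓘(ℝ, E) ∞ ℓ 1 ∧
    ∀ᶠ g in 𝓝 (1 : G), hol G (constOp E (ℓ g)) = g := by
  have := FiniteDimensional.complete ℝ E
  obtain ⟨h1, h2, h3⟩ := contDiffAt_lc_hol_zero E G
  have h00 : constOp E 0 = 0 := map_zero _
  set F : E → E := fun x => lc E (hol G (constOp E x)) with hF
  have hFs : ContDiffAt ℝ ∞ F 0 :=
    ContDiffAt.comp (g := fun a => lc E (hol G a)) (f := constOp E) (0 : E)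
      (by rw [h00]; exact h1) (constOp E).contDiff.contDiffAt
  -- A constant path has integral equal to its value, so the derivative at zero is the identity and
  -- the inverse function theorem provides a logarithm.
  have hF' : HasFDerivAt F ((ContinuousLinearEquiv.refl ℝ E : E ≃L[ℝ] E) : E →L[ℝ] E) 0 := by
    have h4 := HasFDerivAt.comp (g := fun a => lc E (hol G a)) (f := constOp E) (0 : E)
      (by rw [h00]; exact h2) (constOp E).hasFDerivAt
    refine h4.congr_fderiv ?_
    ext x
    simp [intOp_apply, ext01, IccExtend]
  have hF0 : F 0 = lo E G := by
    have h5 : hol G (0 : C(unitInterval, E)) = 1 :=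
      ((isDev_zero (E := E) (G := G)).eq_dev 1).symm
    simp [hF, h5]
  have hn : (∞ : WithTop ℕ∞) ≠ 0 := by simp
  set ψ := hFs.localInverse hF' hn with hψ
  have hψs : ContDiffAt ℝ ∞ ψ (lo E G) := by
    rw [← hF0]; exact hFs.to_localInverse hF' hn
  have hψ0 : ψ (lo E G) = 0 := by
    rw [← hF0]; exact hFs.localInverse_apply_image hF' hn
  have hψr : ∀ᶠ y in 𝓝 (lo E G), F (ψ y) = y := by
    rw [← hF0]; exact (hFs.hasStrictFDerivAt' hF' hn).eventually_right_inverse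
  have hlc : ContinuousAt (lc E : G → E) 1 := (contMDiffAt_lc one_mem_lsrc).continuousAt
  refine ⟨fun g => ψ (lc E g), ContMDiffAt.comp (g := ψ) (1 : G) hψs.contMDiffAt
    (contMDiffAt_lc one_mem_lsrc), ?_⟩
  have hmem : ∀ᶠ y in 𝓝 (lo E G), hol G (constOp E (ψ y)) ∈ lsrc E G := by
    have hc : ContinuousAt (fun y => constOp E (ψ y)) (lo E G) :=
      (constOp E).continuous.continuousAt.comp hψs.continuousAt
    have h3' : ∀ᶠ a in 𝓝 (constOp E (ψ (lo E G))), hol G a ∈ lsrc E G := by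
      rwa [hψ0, h00]
    exact hc.eventually h3'
  have hlc' : ∀ {p : E → Prop}, (∀ᶠ y in 𝓝 (lo E G), p y) → ∀ᶠ g in 𝓝 (1 : G), p (lc E g) :=
    fun h => hlc.eventually h
  filter_upwards [hlc' hψr, hlc' hmem, (isOpen_lsrc (E := E) (G := G)).mem_nhds one_mem_lsrc]
    with g hg1 hg2 hg3
  have := congrArg (li G) hg1
  rwa [li_lc hg2, li_lc hg3] at this

variable (E) in
/-- Every element of a connected group is the holonomy of a `C¹` path. -/
lemma exists_hol_eq [ConnectedSpace G] (g : G) :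
    ∃ a a' : C(unitInterval, E), HasDerivPath a a' ∧ hol G a = g := by
  have hG := topologicalGroup_of_lieGroup 𝓘(ℝ, E) ∞ (G := G)
  set S : Set G := {g | ∃ a a' : C(unitInterval, E), HasDerivPath a a' ∧ hol G a = g} with hS
  obtain ⟨ℓ, -, hℓ⟩ := exists_local_log E G
  have hmul : ∀ s ∈ S, ∀ x : E, s * hol G (constOp E x) ∈ S := by
    rintro s ⟨a, a', ha, rfl⟩ x
    exact ⟨_, _, ha.add ((hasDerivPath_AdDev a).bilinOp (ContinuousLinearMap.id ℝ (E →L[ℝ] E))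
      (hasDerivPath_const x)), hol_add a (constOp E x)⟩
  have hnear : ∀ g : G, ∀ᶠ y in 𝓝 g, ∃ x : E, y = g * hol G (constOp E x) := by
    intro g
    have hc : ContinuousAt (fun y : G => g⁻¹ * y) g := by fun_prop
    have : ∀ᶠ y in 𝓝 g, hol G (constOp E (ℓ (g⁻¹ * y))) = g⁻¹ * y :=
      hc.eventually (by simpa using hℓ)
    filter_upwards [this] with y hy
    exact ⟨_, by rw [hy, mul_inv_cancel_left]⟩
  have hnear' : ∀ g : G, ∀ᶠ y in 𝓝 g, ∃ x : E, g = y * hol G (constOp E x) := by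
    intro g
    have hc : ContinuousAt (fun y : G => y⁻¹ * g) g := by fun_prop
    have : ∀ᶠ y in 𝓝 g, hol G (constOp E (ℓ (y⁻¹ * g))) = y⁻¹ * g :=
      hc.eventually (by simpa using hℓ)
    filter_upwards [this] with y hy
    exact ⟨_, by rw [hy, mul_inv_cancel_left]⟩
  -- `S` is stable under right multiplication by holonomies of constant paths, and these fill a
  -- neighbourhood of `1`. So `S` is open, and its complement is open by the same argument.
  have hopen : IsOpen S := isOpen_iff_mem_nhds.2 fun s hs => by
    filter_upwards [hnear s] with y ⟨x, hx⟩
    exact hx ▸ hmul s hs x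
  have hclosed : IsClosed S := ⟨isOpen_iff_mem_nhds.2 fun s hs => by
    filter_upwards [hnear' s] with y ⟨x, hx⟩ hy
    exact hs (hx ▸ hmul y hy x)⟩
  have hne : S.Nonempty := ⟨_, 0, 0, hasDerivPath_const (0 : E), rfl⟩
  have huniv := IsClopen.eq_univ ⟨hclosed, hopen⟩ hne
  have : g ∈ S := by rw [huniv]; exact mem_univ g
  exact this

end Holonomy

/-! ## The boundary value problem comparing two solutions of `Ḃ + [A, B] = 0` -/

section BoundaryValue

universe u v

variable {E : Type u} [NormedAddCommGroup E] [NormedSpace ℝ E]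
  {G : Type v} [TopologicalSpace G] [ChartedSpace E G] [Group G] [LieGroup 𝓘(ℝ, E) ∞ G]

lemma pairOp_apply' (y : C(unitInterval, E) × C(unitInterval, E)) (t : unitInterval) :
    pairOp y t = (y.1 t, y.2 t) := pairOp_apply _ _ _

variable (G) in
/-- `y = (c, b)` solves `ċ = [ξ, b]`, `ḃ = [c, b]`, `c(0) = c₀`, `b(0) = ξ'`, where
`p = (ξ, ξ', c₀)`. -/
structure IsRelSol (p : E × E × E) (y : C(unitInterval, E) × C(unitInterval, E)) : Prop where
  left : HasDerivPath y.1 (bilinOp (ad E G) (constOp E p.1) y.2)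
  right : HasDerivPath y.2 (bilinOp (ad E G) y.1 y.2)
  left_zero : y.1 0 = p.2.2
  right_zero : y.2 0 = p.2.1

/-- The quadratic term splits as [c,b] - [c',b'] = [c - c',b] + [c',b - b'], so the difference of
two solutions solves a linear equation. -/
lemma IsRelSol.eq [CompleteSpace E] {p : E × E × E} {y z : C(unitInterval, E) × C(unitInterval, E)}
    (hy : IsRelSol G p y) (hz : IsRelSol G p z) : y = z := by
  have h := (hy.left.pair hy.right).eq_of_linear (hz.left.pair hz.right)
    (by simp only [pairOp_apply, hy.left_zero, hz.left_zero, hy.right_zero, hz.right_zero])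
    ⟨fun t => ((ad E G p.1) ∘L ContinuousLinearMap.snd ℝ E E).prod
      ((ad E G).flip (y.2 t) ∘L ContinuousLinearMap.fst ℝ E E +
        ad E G (z.1 t) ∘L ContinuousLinearMap.snd ℝ E E), by
      refine (ContinuousLinearMap.prodₗᵢ (𝕜 := ℝ) (E := E × E) (F := E) (G := E)
        ℝ).continuous.comp (Continuous.prodMk ?_ ?_) <;> fun_prop⟩
    (fun t => by
      rw [pairOp_apply', pairOp_apply', pairOp_apply, pairOp_apply]
      refine Prod.ext ?_ ?_
      · change _ = ad E G p.1 (y.2 t - z.2 t)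
        simp
      · change _ = ad E G (y.1 t - z.1 t) (y.2 t) + ad E G (z.1 t) (y.2 t - z.2 t)
        simp)
  have h1 : ∀ t, (y.1 t, y.2 t) = (z.1 t, z.2 t) := fun t => by
    rw [← pairOp_apply', ← pairOp_apply']
    exact DFunLike.congr_fun h t
  refine Prod.ext ?_ ?_ <;> ext t
  · exact congrArg Prod.fst (h1 t)
  · exact congrArg Prod.snd (h1 t)

/-- As the system is quadratic, solvability on all of [0,1] is not assumed; only a given solution is
perturbed. This is why `relSet` is introduced, and it shows that `relSet` is open. -/
lemma IsRelSol.exists_contDiffAt [CompleteSpace E] {p₀ : E × E × E}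
    {y₀ : C(unitInterval, E) × C(unitInterval, E)} (h : IsRelSol G p₀ y₀) :
    ∃ Y : E × E × E → C(unitInterval, E) × C(unitInterval, E), ContDiffAt ℝ ∞ Y p₀ ∧
      ∀ᶠ p in 𝓝 p₀, IsRelSol G p (Y p) := by
  set f : E × (E × E) → E × E := fun q => (ad E G q.1 q.2.2, ad E G q.2.1 q.2.2) with hf
  have hfs : ContDiff ℝ ∞ f := by
    refine ContDiff.prodMk ?_ ?_
    · exact ((ad E G).contDiff.comp contDiff_fst).clm_apply (contDiff_snd.comp contDiff_snd)
    · exact ((ad E G).contDiff.comp (contDiff_fst.comp contDiff_snd)).clm_apply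
        (contDiff_snd.comp contDiff_snd)
  have hpath : ∀ (x : E) (y : C(unitInterval, E) × C(unitInterval, E)),
      superpose f hfs.continuous (pairOp (constOp E x, pairOp y)) =
        pairOp (bilinOp (ad E G) (constOp E x) y.2, bilinOp (ad E G) y.1 y.2) := by
    rintro x ⟨c, b⟩
    ext1 t
    simp [hf]
  have hy : pairOp y₀ = constOp (E × E) (p₀.2.2, p₀.2.1) +
      intOp (superpose f hfs.continuous (pairOp (constOp E p₀.1, pairOp y₀))) := by
    rw [hpath, constOp_eq, ← h.left_zero, ← h.right_zero]
    have := (h.left.pair h.right).eq_add_intOp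
    rw [pairOp_apply] at this
    exact this
  obtain ⟨σ, hσ, -, hσe⟩ := exists_smooth_solution f hfs (constOp E p₀.1) (p₀.2.2, p₀.2.1) _ hy
  let i : E × E × E → C(unitInterval, E) × (E × E) := fun p => (constOp E p.1, (p.2.2, p.2.1))
  have hi : ContDiff ℝ ∞ i := ((constOp E).contDiff.comp contDiff_fst).prodMk
    ((contDiff_snd.comp contDiff_snd).prodMk (contDiff_fst.comp contDiff_snd))
  let π₁ := (ContinuousLinearMap.fst ℝ E E).compLeftContinuous ℝ unitInterval
  let π₂ := (ContinuousLinearMap.snd ℝ E E).compLeftContinuous ℝ unitInterval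
  refine ⟨fun p => (π₁ (σ (i p)), π₂ (σ (i p))), ?_, ?_⟩
  · have h1 : ContDiffAt ℝ ∞ (fun p => σ (i p)) p₀ := ContDiffAt.comp (g := σ) p₀ hσ hi.contDiffAt
    exact (ContDiffAt.comp (g := π₁) p₀ π₁.contDiff.contDiffAt h1).prodMk
      (ContDiffAt.comp (g := π₂) p₀ π₂.contDiff.contDiffAt h1)
  · have h1 : ∀ᶠ p in 𝓝 p₀, σ (i p) = constOp (E × E) (i p).2 +
        intOp (superpose f hfs.continuous (pairOp ((i p).1, σ (i p)))) :=
      hi.continuous.continuousAt.eventually hσe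
    filter_upwards [h1] with p hp
    set y : C(unitInterval, E) × C(unitInterval, E) := (π₁ (σ (i p)), π₂ (σ (i p))) with hyd
    have hs : σ (i p) = pairOp y := by
      ext1 t
      rw [hyd, pairOp_apply]
      rfl
    have h2 := hasDerivPath_of_eq hp
    rw [hs, hpath] at h2
    have h0 : σ (i p) 0 = (p.2.2, p.2.1) := by
      rw [hp]
      simp [i]
    refine ⟨fun t => ?_, fun t => ?_, congrArg Prod.fst h0, congrArg Prod.snd h0⟩
    · have h3 := ((ContinuousLinearMap.fst ℝ E E).hasFDerivAt.comp_hasDerivWithinAt (t : ℝ) (h2 t))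
      rw [← hs, pairOp_apply] at h3
      exact h3
    · have h3 := ((ContinuousLinearMap.snd ℝ E E).hasFDerivAt.comp_hasDerivWithinAt (t : ℝ) (h2 t))
      rw [← hs, pairOp_apply] at h3
      exact h3

variable (E G) in
/-- The initial data for which the system has a solution on `[0,1]`. -/
def relSet : Set (E × E × E) := {p | ∃ y, IsRelSol G p y}

open scoped Classical in
variable (G) in
/-- The solution of the system with initial data `p`. -/
def relSol (p : E × E × E) : C(unitInterval, E) × C(unitInterval, E) :=
  if h : ∃ y, IsRelSol G p y then h.choose else 0

lemma isRelSol_relSol {p : E × E × E} (hp : p ∈ relSet E G) : IsRelSol G p (relSol G p) := by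
  have h : ∃ y, IsRelSol G p y := hp
  rw [relSol, dif_pos h]
  exact h.choose_spec

lemma IsRelSol.relSol_eq [CompleteSpace E] {p : E × E × E}
    {y : C(unitInterval, E) × C(unitInterval, E)} (h : IsRelSol G p y) : relSol G p = y :=
  (isRelSol_relSol ⟨y, h⟩).eq h

lemma isOpen_relSet [CompleteSpace E] : IsOpen (relSet E G) :=
  isOpen_iff_mem_nhds.2 fun _ ⟨_, hy⟩ => by
    obtain ⟨Y, -, hY⟩ := hy.exists_contDiffAt
    exact hY.mono fun q hq => ⟨_, hq⟩

lemma contDiffAt_relSol [CompleteSpace E] {p : E × E × E} (hp : p ∈ relSet E G) :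
    ContDiffAt ℝ ∞ (relSol G) p := by
  obtain ⟨Y, hY, hYe⟩ := (isRelSol_relSol hp).exists_contDiffAt
  exact hY.congr_of_eventuallyEq (hYe.mono fun q hq => hq.relSol_eq)

lemma isRelSol_diag (x : E) : IsRelSol G (x, x, 0) (0, constOp E x) where
  left := by
    have : bilinOp (ad E G) (constOp E x) (constOp E x) = 0 := by ext t; simp
    rw [this]
    exact hasDerivPath_const 0
  right := by
    rw [map_zero, zero_apply]
    exact hasDerivPath_const x
  left_zero := rfl
  right_zero := rfl

lemma diag_mem_relSet (x : E) : (x, x, (0 : E)) ∈ relSet E G := ⟨_, isRelSol_diag x⟩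

/-- The linearised system along a constant solution. -/
lemma fderiv_relSol_diag [CompleteSpace E] (x : E) (v : E × E × E) :
    HasDerivPath (fderiv ℝ (relSol G) (x, x, 0) v).1
        (bilinOp (ad E G) (constOp E v.1) (constOp E x) +
          bilinOp (ad E G) (constOp E x) (fderiv ℝ (relSol G) (x, x, 0) v).2) ∧
      HasDerivPath (fderiv ℝ (relSol G) (x, x, 0) v).2
        (bilinOp (ad E G) (fderiv ℝ (relSol G) (x, x, 0) v).1 (constOp E x)) ∧
      (fderiv ℝ (relSol G) (x, x, 0) v).1 0 = v.2.2 ∧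
      (fderiv ℝ (relSol G) (x, x, 0) v).2 0 = v.2.1 := by
  set p : E × E × E := (x, x, 0) with hp
  have hpm : p ∈ relSet E G := diag_mem_relSet x
  set D := fderiv ℝ (relSol G) p with hD
  have hd : HasFDerivAt (relSol G) D p :=
    ((contDiffAt_relSol hpm).differentiableAt (by simp)).hasFDerivAt
  have hval : relSol G p = (0, constOp E x) := (isRelSol_diag x).relSol_eq
  have hd1 : HasFDerivAt (fun q => (relSol G q).1) (ContinuousLinearMap.fst ℝ _ _ ∘L D) p := hd.fst
  have hd2 : HasFDerivAt (fun q => (relSol G q).2) (ContinuousLinearMap.snd ℝ _ _ ∘L D) p := hd.snd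
  have hx : HasFDerivAt (fun q : E × E × E => constOp E q.1)
      (constOp E ∘L ContinuousLinearMap.fst ℝ E (E × E)) p :=
    (constOp E ∘L ContinuousLinearMap.fst ℝ E (E × E)).hasFDerivAt
  have hev := (isOpen_relSet (E := E) (G := G)).mem_nhds hpm
  set c₁ := constOp E ∘L (ContinuousLinearMap.snd ℝ E E ∘L ContinuousLinearMap.snd ℝ E (E × E))
  set c₂ := constOp E ∘L (ContinuousLinearMap.fst ℝ E E ∘L ContinuousLinearMap.snd ℝ E (E × E))
  -- The integral form holds for all nearby data, hence may be differentiated in the data;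
  -- uniqueness of derivatives then gives the linearised integral equations.
  have e1 : (fun q => (relSol G q).1) =ᶠ[𝓝 p] fun q => c₁ q +
      intOp (bilinOp (ad E G) (constOp E q.1) (relSol G q).2) := by
    filter_upwards [hev] with q hq
    have h := isRelSol_relSol hq
    have h1 := h.left.eq_add_intOp
    rw [h.left_zero] at h1
    exact h1
  have e2 : (fun q => (relSol G q).2) =ᶠ[𝓝 p] fun q => c₂ q +
      intOp (bilinOp (ad E G) (relSol G q).1 (relSol G q).2) := by
    filter_upwards [hev] with q hq
    have h := isRelSol_relSol hq
    have h1 := h.right.eq_add_intOp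
    rw [h.right_zero] at h1
    exact h1
  have f1 := (c₁.hasFDerivAt (x := p)).add (HasFDerivAt.comp (g := intOp (F := E)) p
    (intOp (F := E)).hasFDerivAt ((bilinOp (ad E G)).hasFDerivAt_of_bilinear hx hd2))
  have f2 := (c₂.hasFDerivAt (x := p)).add (HasFDerivAt.comp (g := intOp (F := E)) p
    (intOp (F := E)).hasFDerivAt ((bilinOp (ad E G)).hasFDerivAt_of_bilinear hd1 hd2))
  have g1 := DFunLike.congr_fun (hd1.unique (f1.congr_of_eventuallyEq e1)) v
  have g2 := DFunLike.congr_fun (hd2.unique (f2.congr_of_eventuallyEq e2)) v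
  simp only [ContinuousLinearMap.comp_apply, ContinuousLinearMap.coe_fst', add_apply,
    ContinuousLinearMap.coe_snd', ContinuousLinearMap.precompR_apply,
    ContinuousLinearMap.precompL_apply, hval] at g1 g2
  have g1' : (D v).1 = ContinuousMap.const unitInterval v.2.2 +
      intOp (bilinOp (ad E G) (constOp E v.1) (constOp E x) +
        bilinOp (ad E G) (constOp E x) (D v).2) := by
    rw [add_comm (bilinOp (ad E G) (constOp E v.1) (constOp E x))]
    exact g1
  have g2' : (D v).2 = ContinuousMap.const unitInterval v.2.1 +
      intOp (bilinOp (ad E G) (D v).1 (constOp E x)) := by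
    have z : bilinOp (ad E G) 0 (D v).2 = 0 := by rw [map_zero, zero_apply]
    rw [← zero_add (bilinOp (ad E G) (D v).1 (constOp E x)), ← z]
    exact g2
  refine ⟨hasDerivPath_of_eq g1', hasDerivPath_of_eq g2', ?_, ?_⟩
  · rw [g1']; simp
  · rw [g2']; simp

/-- The linearised boundary value problem along a constant solution has no non-zero solution. -/
lemma eq_zero_of_linearised [CompleteSpace E] (B : AdInvariantInner E G) (x : E)
    {γ β : C(unitInterval, E)} (hγ : HasDerivPath γ (bilinOp (ad E G) (constOp E x) β))
    (hβ : HasDerivPath β (bilinOp (ad E G) γ (constOp E x))) (hβ0 : β 0 = 0)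
    (h1 : intOp γ 1 = 0) : γ 0 = 0 := by
  have hη := hasDerivPath_intOp γ
  -- Both sides start at zero and have derivative [γ,x].
  have hβη : β = bilinOp (ad E G) (intOp γ) (constOp E x) := by
    have h2 := hη.bilinOp (ad E G) (hasDerivPath_const x)
    refine hβ.eq_of_linear h2 ?_ 0 (fun t => ?_)
    · simp [hβ0]
    · simp
  have hψ := hη.bilinOp B.form hγ
  set ψ := bilinOp B.form (intOp γ) γ with hψd
  set ψ' := bilinOp B.form γ γ + bilinOp B.form (intOp γ) (bilinOp (ad E G) (constOp E x) β)
    with hψ'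
  -- By invariance ⟨η,[x,[η,x]]⟩ = |[η,x]|² = |β|², where η is the primitive of γ.
  have hψt : ∀ t, ψ' t = B.form (γ t) (γ t) + B.form (β t) (β t) := by
    intro t
    have e := B.form_ad x (intOp γ t) (ad E G (intOp γ t) x)
    rw [ad_swap x (intOp γ t), map_neg, neg_apply, neg_add_eq_zero] at e
    simp only [hψ', hβη, ContinuousMap.add_apply, bilinOp_apply, constOp_apply]
    rw [← e]
  have hnn : ∀ y, 0 ≤ B.form y y := fun y => by
    by_cases hy : y = 0
    · simp [hy]
    · exact (B.pos y hy).le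
  have hmono : MonotoneOn (ext01 ψ) (Icc 0 1) := by
    refine monotoneOn_of_hasDerivWithinAt_nonneg (f' := ext01 ψ') (convex_Icc 0 1)
      (continuous_ext01 ψ).continuousOn (fun s hs => ?_) (fun s hs => ?_)
    · have := hψ ⟨s, interior_subset hs⟩
      rw [ext01_of_mem _ (interior_subset hs)]
      exact this.mono interior_subset
    · rw [ext01_of_mem _ (interior_subset hs), hψt]
      exact add_nonneg (hnn _) (hnn _)
  have e0 : ext01 ψ 0 = 0 := by
    have : ext01 ψ 0 = ψ 0 := ext01_coe ψ 0
    rw [this]; simp [hψd]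
  have e1 : ext01 ψ 1 = 0 := by
    have : ext01 ψ 1 = ψ 1 := ext01_coe ψ 1
    rw [this]; simp [hψd, h1]
  -- ψ is non-decreasing and vanishes at both ends, so it is zero. Its derivative at time 0 is
  -- |γ(0)|², because β(0) = 0.
  have hz : ∀ s ∈ Icc (0 : ℝ) 1, ext01 ψ s = 0 := fun s hs =>
    le_antisymm (e1 ▸ hmono hs (right_mem_Icc.2 zero_le_one) hs.2)
      (e0 ▸ hmono (left_mem_Icc.2 zero_le_one) hs hs.1)
  have hd0 : HasDerivWithinAt (ext01 ψ) 0 (Icc 0 1) ((0 : unitInterval) : ℝ) :=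
    (hasDerivWithinAt_const _ _ (0 : ℝ)).congr hz (hz _ (0 : unitInterval).2)
  have h3 := (uniqueDiffOn_Icc_zero_one _ (0 : unitInterval).2).eq_deriv _ (hψ 0) hd0
  have h4 : B.form (β 0) (β 0) = 0 := by rw [hβ0]; simp
  rw [hψt, h4, add_zero] at h3
  by_contra hne
  exact (B.pos _ hne).ne' h3

end BoundaryValue

/-! ### Local and uniform solvability of the boundary value problem near constant solutions. -/

section EndPoint

universe u v

variable {E : Type u} [NormedAddCommGroup E] [NormedSpace ℝ E] [FiniteDimensional ℝ E]
  {G : Type v} [TopologicalSpace G] [ChartedSpace E G] [Group G] [LieGroup 𝓘(ℝ, E) ∞ G]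
  [CompactSpace G]

variable (E G) in
/-- The data `(ξ, ξ', h(1))` attached to `p = (ξ, ξ', c₀)`, where `h` is the development of the
solution `c`. -/
def relEnd (p : E × E × E) : E × E × E := (p.1, p.2.1, lc E (hol G (relSol G p).1))

lemma contMDiffAt_hol_relSol {p : E × E × E} (hp : p ∈ relSet E G) :
    ContMDiffAt 𝓘(ℝ, E × E × E) 𝓘(ℝ, E) ∞ (fun p => hol G (relSol G p).1) p := by
  have := FiniteDimensional.complete ℝ E
  exact ContMDiffAt.comp (g := hol G (E := E)) p (contMDiff_hol E G _)
    (contDiffAt_relSol hp).fst.contMDiffAt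

lemma contDiffAt_relEnd {p : E × E × E} (hp : p ∈ relSet E G)
    (hl : hol G (relSol G p).1 ∈ lsrc E G) : ContDiffAt ℝ ∞ (relEnd E G) p :=
  contDiffAt_fst.prodMk ((contDiffAt_fst.comp p contDiffAt_snd).prodMk
    (contDiffAt_lc_comp (contMDiffAt_hol_relSol hp) hl))

lemma hol_zero : hol G (0 : C(unitInterval, E)) = 1 :=
  ((isDev_zero (E := E) (G := G)).eq_dev 1).symm

lemma relSol_diag (x : E) : relSol G (x, x, 0) = (0, constOp E x) := by
  have := FiniteDimensional.complete ℝ E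
  exact (isRelSol_diag x).relSol_eq

/-- The first two components of `relEnd` are coordinates, so a kernel vector only varies c₀; its
third component says that the integral of the variation γ vanishes, and `eq_zero_of_linearised`
applies. Injectivity suffices in finite dimension. -/
lemma isInvertible_fderiv_relEnd_diag (B : AdInvariantInner E G) (x : E) :
    (fderiv ℝ (relEnd E G) (x, x, 0)).IsInvertible := by
  have := FiniteDimensional.complete ℝ E
  have hp := diag_mem_relSet (G := G) x
  have hl : hol G (relSol G (x, x, (0 : E))).1 ∈ lsrc E G := by
    rw [relSol_diag, hol_zero]
    exact one_mem_lsrc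
  have hd := ((contDiffAt_relSol hp).differentiableAt (by simp)).hasFDerivAt
  have hd1 : HasFDerivAt (fun q => (relSol G q).1)
      (ContinuousLinearMap.fst ℝ _ _ ∘L fderiv ℝ (relSol G) (x, x, (0 : E))) (x, x, (0 : E)) :=
    hd.fst
  have h1 : HasFDerivAt (fun a : C(unitInterval, E) => lc E (hol G a))
      (ContinuousMap.evalCLM ℝ (1 : unitInterval) ∘L intOp) (relSol G (x, x, (0 : E))).1 := by
    rw [relSol_diag]
    exact (contDiffAt_lc_hol_zero E G).2.1
  have h2 := HasFDerivAt.comp (g := fun a : C(unitInterval, E) => lc E (hol G a))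
    (x, x, (0 : E)) h1 hd1
  have h3 : HasFDerivAt (relEnd E G) _ (x, x, (0 : E)) := (hasFDerivAt_fst (𝕜 := ℝ)).prodMk
    (((ContinuousLinearMap.fst ℝ E E ∘L ContinuousLinearMap.snd ℝ E (E × E)).hasFDerivAt).prodMk h2)
  rw [h3.fderiv]
  set A := (ContinuousLinearMap.fst ℝ E (E × E)).prod
    ((ContinuousLinearMap.fst ℝ E E ∘L ContinuousLinearMap.snd ℝ E (E × E)).prod
      ((ContinuousMap.evalCLM ℝ (1 : unitInterval) ∘L intOp) ∘L
        (ContinuousLinearMap.fst ℝ _ _ ∘L fderiv ℝ (relSol G) (x, x, (0 : E))))) with hA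
  have hinj : Function.Injective (A : E × E × E →ₗ[ℝ] E × E × E) := by
    rw [← LinearMap.ker_eq_bot, LinearMap.ker_eq_bot']
    rintro ⟨v₁, v₂, v₃⟩ hv
    have e1 : v₁ = 0 := congrArg Prod.fst hv
    have e2 : v₂ = 0 := congrArg (fun z => z.2.1) hv
    have e3 : intOp (fderiv ℝ (relSol G) (x, x, 0) (v₁, v₂, v₃)).1 1 = 0 :=
      congrArg (fun z => z.2.2) hv
    obtain ⟨g1, g2, g3, g4⟩ := fderiv_relSol_diag (G := G) x (v₁, v₂, v₃)
    have e4 : v₃ = 0 := by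
      rw [← show _ = v₃ from g3]
      refine eq_zero_of_linearised B x ?_ g2 (g4.trans e2) e3
      have z : bilinOp (ad E G) (constOp E v₁) (constOp E x) = 0 := by
        rw [e1, map_zero, map_zero, zero_apply]
      rwa [z, zero_add] at g1
    rw [e1, e2, e4]
    rfl
  exact ⟨(LinearEquiv.ofInjectiveEndo _ hinj).toContinuousLinearEquiv, by ext <;> rfl⟩

variable (E G) in
/-- The initial data near which the boundary value problem is well posed and whose solution is
close to a constant one. -/
def relGood (r : ℝ) : Set (E × E × E) :=
  {p | p ∈ relSet E G ∧ hol G (relSol G p).1 ∈ lsrc E G ∧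
    (fderiv ℝ (relEnd E G) p).IsInvertible ∧
    ‖(relSol G p).1‖ < r ∧ ‖constOp E p.1 - (relSol G p).2‖ < r}

lemma isOpen_relGood (r : ℝ) : IsOpen (relGood E G r) := by
  have := FiniteDimensional.complete ℝ E
  refine isOpen_iff_mem_nhds.2 fun p ⟨h1, h2, h3, h4, h5⟩ => ?_
  have hc := (contDiffAt_relSol h1).continuousAt
  have hd : ContinuousAt (fderiv ℝ (relEnd E G)) p :=
    ((contDiffAt_relEnd h1 h2).fderiv_right (m := 0) (by simp)).continuousAt
  have e2 : ∀ᶠ q in 𝓝 p, hol G (relSol G q).1 ∈ lsrc E G :=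
    (contMDiffAt_hol_relSol h1).continuousAt.eventually (isOpen_lsrc.mem_nhds h2)
  have e3 : ∀ᶠ q in 𝓝 p, (fderiv ℝ (relEnd E G) q).IsInvertible :=
    hd.eventually (ContinuousLinearEquiv.isOpen.mem_nhds h3)
  have e4 : ∀ᶠ q in 𝓝 p, ‖(relSol G q).1‖ < r := hc.fst.norm.eventually (gt_mem_nhds h4)
  have e5 : ∀ᶠ q in 𝓝 p, ‖constOp E q.1 - (relSol G q).2‖ < r :=
    (((constOp E).continuous.continuousAt.comp continuousAt_fst).sub hc.snd).norm.eventually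
      (gt_mem_nhds h5)
  filter_upwards [isOpen_relSet.mem_nhds h1, e2, e3, e4, e5] with q q1 q2 q3 q4 q5
  exact ⟨q1, q2, q3, q4, q5⟩

lemma diag_mem_relGood (B : AdInvariantInner E G) {r : ℝ} (hr : 0 < r) (x : E) :
    (x, x, (0 : E)) ∈ relGood E G r := by
  refine ⟨diag_mem_relSet x, ?_, isInvertible_fderiv_relEnd_diag B x, ?_, ?_⟩ <;> rw [relSol_diag]
  · rw [hol_zero]
    exact one_mem_lsrc
  · simpa using hr
  · simpa using hr

lemma exists_localInverse_relEnd {r : ℝ} {p : E × E × E} (hp : p ∈ relGood E G r) :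
    ∃ g : E × E × E → E × E × E, ContDiffAt ℝ ∞ g (relEnd E G p) ∧ g (relEnd E G p) = p ∧
      ∀ᶠ q in 𝓝 (relEnd E G p), relEnd E G (g q) = q := by
  have := FiniteDimensional.complete ℝ E
  obtain ⟨h1, h2, ⟨e, he⟩, -, -⟩ := hp
  have hs := contDiffAt_relEnd h1 h2
  have hd : HasFDerivAt (relEnd E G) (e : E × E × E →L[ℝ] E × E × E) p := by
    rw [he]
    exact (hs.differentiableAt (by simp)).hasFDerivAt
  have hn : (∞ : WithTop ℕ∞) ≠ 0 := by simp
  exact ⟨hs.localInverse hd hn, hs.to_localInverse hd hn, hs.localInverse_apply_image hd hn,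
    (hs.hasStrictFDerivAt' hd hn).eventually_right_inverse⟩

/-- Solutions of the boundary value problem are unique near the constant ones. -/
theorem exists_relDom (B : AdInvariantInner E G) {r : ℝ} (hr : 0 < r) :
    ∃ W : Set (E × E × E), IsOpen W ∧ (∀ x : E, (x, x, (0 : E)) ∈ W) ∧ W ⊆ relGood E G r ∧
      InjOn (relEnd E G) W := by
  have := FiniteDimensional.complete ℝ E
  -- W is the union of all balls centred on the diagonal that are contained in the good set and on
  -- which `relEnd` is injective; their radii may depend on the centre.
  refine ⟨{p | ∃ (x : E) (ρ : ℝ), p ∈ Metric.ball (x, x, (0 : E)) ρ ∧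
    Metric.ball (x, x, (0 : E)) ρ ⊆ relGood E G r ∧
    InjOn (relEnd E G) (Metric.ball (x, x, (0 : E)) ρ)}, ?_, ?_, ?_, ?_⟩
  · refine isOpen_iff_mem_nhds.2 fun p ⟨x, ρ, h1, h2, h3⟩ => ?_
    filter_upwards [Metric.isOpen_ball.mem_nhds h1] with q hq
    exact ⟨x, ρ, hq, h2, h3⟩
  · intro x
    have hg := diag_mem_relGood B hr x
    obtain ⟨h1, h2, ⟨e, he⟩, -, -⟩ := id hg
    have hs := contDiffAt_relEnd h1 h2
    have hd : HasFDerivAt (relEnd E G) (e : E × E × E →L[ℝ] E × E × E) (x, x, (0 : E)) := by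
      rw [he]
      exact (hs.differentiableAt (by simp)).hasFDerivAt
    have hsd := hs.hasStrictFDerivAt' hd (by simp)
    set φ := hsd.toOpenPartialHomeomorph (relEnd E G) with hφ
    have hm : (x, x, (0 : E)) ∈ φ.source := hsd.mem_toOpenPartialHomeomorph_source
    obtain ⟨ρ, hρ, hb⟩ := Metric.mem_nhds_iff.1 (Filter.inter_mem (φ.open_source.mem_nhds hm)
      ((isOpen_relGood r).mem_nhds hg))
    exact ⟨x, ρ, Metric.mem_ball_self hρ, hb.trans inter_subset_right,
      φ.injOn.mono (hb.trans inter_subset_left)⟩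
  · rintro p ⟨x, ρ, h1, h2, -⟩
    exact h2 h1
  -- Points with equal `relEnd` agree in their first two coordinates, and the third coordinate of
  -- every centre is zero. In the max metric both points therefore lie in the larger of their two
  -- balls.
  · have key : ∀ {p q : E × E × E} {x y : E} {ρ σ : ℝ}, p ∈ Metric.ball (x, x, (0 : E)) ρ →
        q ∈ Metric.ball (y, y, (0 : E)) σ → relEnd E G p = relEnd E G q → σ ≤ ρ →
        q ∈ Metric.ball (x, x, (0 : E)) ρ := by
      intro p q x y ρ σ hp hq he hle
      obtain ⟨e1, e2⟩ : p.1 = q.1 ∧ p.2.1 = q.2.1 := by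
        simp only [relEnd, Prod.mk.injEq] at he
        exact ⟨he.1, he.2.1⟩
      simp only [Metric.mem_ball, Prod.dist_eq, max_lt_iff] at hp hq ⊢
      exact ⟨e1 ▸ hp.1, e2 ▸ hp.2.1, hq.2.2.trans_le hle⟩
    rintro p ⟨x, ρ, hp, -, hpi⟩ q ⟨y, σ, hq, -, hqi⟩ he
    rcases le_total σ ρ with h | h
    · exact hpi hp (key hp hq he h) he
    · exact hqi (key hq hp he.symm h) hq he

end EndPoint

/-! ## Solutions of the Nahm-Schmid equations and the boundary value problem -/

section C1Paths

universe u

variable {E : Type u} [NormedAddCommGroup E] [NormedSpace ℝ E]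

variable (E) in
/-- The inclusion of `C¹` paths into continuous paths. -/
def C1Path.val : C1Path E →L[ℝ] C(unitInterval, E) :=
  (ContinuousLinearMap.fst ℝ _ _ ∘L (c1Submodule E).subtypeL : c1Submodule E →L[ℝ] _)

variable (E) in
/-- The derivative of `C¹` paths. -/
def C1Path.der : C1Path E →L[ℝ] C(unitInterval, E) :=
  (ContinuousLinearMap.snd ℝ _ _ ∘L (c1Submodule E).subtypeL : c1Submodule E →L[ℝ] _)

lemma ev_eq (f : C1Path E) (t : unitInterval) : ev f t = C1Path.val E f t := rfl

lemma dv_eq (f : C1Path E) (t : unitInterval) : dv f t = C1Path.der E f t := rfl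

lemma C1Path.hasDerivPath (f : C1Path E) : HasDerivPath (C1Path.val E f) (C1Path.der E f) := f.2

lemma C1Path.ext {f g : C1Path E} (h : C1Path.val E f = C1Path.val E g) : f = g := by
  refine Subtype.ext (Prod.ext h ?_)
  ext t
  have h1 := g.hasDerivPath t
  rw [← h] at h1
  exact (uniqueDiffOn_Icc_zero_one _ t.2).eq_deriv _ (f.hasDerivPath t) h1

/-- The `C¹` path with the given values and derivatives. -/
def C1Path.mk {x x' : C(unitInterval, E)} (h : HasDerivPath x x') : C1Path E := ⟨(x, x'), h⟩

@[simp] lemma C1Path.val_mk {x x' : C(unitInterval, E)} (h : HasDerivPath x x') :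
    C1Path.val E (C1Path.mk h) = x := rfl

variable (E) in
/-- The `C¹` path with the given initial value and derivative. -/
def C1Path.ofDeriv [CompleteSpace E] : E × C(unitInterval, E) →L[ℝ] C1Path E :=
  (ContinuousLinearMap.codRestrict
    (((constOp E).coprod intOp).prod (ContinuousLinearMap.snd ℝ E C(unitInterval, E)))
    (c1Submodule E) fun p => by
      have h := (hasDerivPath_const p.1).add (hasDerivPath_intOp p.2)
      rw [zero_add] at h
      exact h : E × C(unitInterval, E) →L[ℝ] c1Submodule E)

lemma C1Path.ofDeriv_eq_mk [CompleteSpace E] {x x' : C(unitInterval, E)} (h : HasDerivPath x x') :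
    C1Path.ofDeriv E (x 0, x') = C1Path.mk h :=
  C1Path.ext h.eq_add_intOp.symm

end C1Paths

/-! ### Nahm-Schmid equations in the gauge A = 0. -/

section Reduction

universe u v

variable {E : Type u} [NormedAddCommGroup E] [NormedSpace ℝ E]
  {G : Type v} [TopologicalSpace G] [ChartedSpace E G] [Group G] [LieGroup 𝓘(ℝ, E) ∞ G]

open C1Path in
/-- The Nahm-Schmid equations in terms of `A = T₀ + T₂`, `B = T₁ + T₃`, `C = 2 T₂`,
`B' = T₁ - T₃`. -/
lemma mem_Sol_iff (T : Config E) : T ∈ Sol E G ↔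
    der E (T 1 + T 3) = -bilinOp (ad E G) (val E (T 0 + T 2)) (val E (T 1 + T 3)) ∧
    der E (T 1 - T 3) = -bilinOp (ad E G) (val E (T 0 - T 2)) (val E (T 1 - T 3)) ∧
    der E ((2 : ℝ) • T 2) = -bilinOp (ad E G) (val E (T 0 + T 2)) (val E ((2 : ℝ) • T 2)) +
      bilinOp (ad E G) (val E (T 1 + T 3)) (val E (T 1 - T 3)) := by
  simp only [Sol, mem_ofPred_eq, br_eq, ev_eq, dv_eq, ContinuousMap.ext_iff, ← forall_and]
  refine forall_congr' fun t => ?_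
  simp only [map_add, map_sub, map_smul, ContinuousMap.add_apply, ContinuousMap.sub_apply,
    ContinuousMap.neg_apply, ContinuousMap.smul_apply, bilinOp_apply, add_apply, sub_apply]
  generalize der E (T 1) t = a1
  generalize der E (T 2) t = a2
  generalize der E (T 3) t = a3
  generalize val E (T 0) t = x0
  generalize val E (T 1) t = x1
  generalize val E (T 2) t = x2
  generalize val E (T 3) t = x3
  rw [ad_swap x3 x1, ad_swap x2 x1, ad_self, ad_self, ad_self]
  constructor
  · rintro ⟨h1, h2, h3⟩
    rw [← eq_sub_iff_add_eq] at h1 h2 h3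
    rw [h1, h2, h3]
    refine ⟨?_, ?_, ?_⟩ <;> module
  · rintro ⟨h1, h2, h3⟩
    have e1 : a1 = (1 / 2 : ℝ) • ((a1 + a3) + (a1 - a3)) := by module
    have e3 : a3 = (1 / 2 : ℝ) • ((a1 + a3) - (a1 - a3)) := by module
    have e2 : a2 = (1 / 2 : ℝ) • ((2 : ℝ) • a2) := by module
    rw [h1, h2] at e1 e3
    rw [h3] at e2
    rw [e1, e2, e3]
    refine ⟨?_, ?_, ?_⟩ <;> module

variable [FiniteDimensional ℝ E] [CompactSpace G]

lemma hasDerivPath_AdDev_apply (a : C(unitInterval, E)) {z z' : C(unitInterval, E)}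
    (hz : HasDerivPath z z') :
    HasDerivPath (applyOp (AdDev G a) z)
      (bilinOp (ad E G) a (applyOp (AdDev G a) z) + applyOp (AdDev G a) z') :=
  (hasDerivPath_AdDev a).bilinOp (ContinuousLinearMap.id ℝ (E →L[ℝ] E)) hz

@[simp] lemma applyOp_AdDev_AdDevInv (a z : C(unitInterval, E)) :
    applyOp (AdDev G a) (applyOp (AdDevInv G a) z) = z := by ext t; simp

/-- Passing to the moving frame replaces ẏ by ẏ - [a,y]; with a = -A this is the covariant
derivative ẏ + [A,y]. -/
lemma hasDerivPath_AdDevInv_apply (a : C(unitInterval, E)) {y y' : C(unitInterval, E)}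
    (hy : HasDerivPath y y') :
    HasDerivPath (applyOp (AdDevInv G a) y) (applyOp (AdDevInv G a) (y' - bilinOp (ad E G) a y)) := by
  have := topologicalGroup_of_lieGroup 𝓘(ℝ, E) ∞ (G := G)
  have hi : IsDev (-(applyOp (AdDevInv G a) a)) (fun s => (dev G a s)⁻¹) :=
    (isDev_dev a).inv fun t => rfl
  have h := hi.hasDerivPath_Ad.bilinOp (ContinuousLinearMap.id ℝ (E →L[ℝ] E)) hy
  have e : applyOp (AdDevInv G a) (y' - bilinOp (ad E G) a y) =
      bilinOp (ContinuousLinearMap.id ℝ (E →L[ℝ] E))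
        (bilinOp (ContinuousLinearMap.compL ℝ E E E ∘L ad E G) (-(applyOp (AdDevInv G a) a))
          (AdPath E (fun s => (dev G a s)⁻¹) hi.continuousOn)) y +
      bilinOp (ContinuousLinearMap.id ℝ (E →L[ℝ] E))
        (AdPath E (fun s => (dev G a s)⁻¹) hi.continuousOn) y' := by
    ext t
    change Ad (dev G a t)⁻¹ (y' t - ad E G (a t) (y t)) =
      ad E G (-(Ad (dev G a t)⁻¹ (a t))) (Ad (dev G a t)⁻¹ (y t)) + Ad (dev G a t)⁻¹ (y' t)
    rw [map_neg, neg_apply, ad_Ad, map_sub]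
    abel
  rw [e]
  exact h

lemma HasDerivPath.eq_constOp {x : C(unitInterval, E)} (h : HasDerivPath x 0) :
    x = constOp E (x 0) := by
  have := FiniteDimensional.complete ℝ E
  have h1 := h.eq_add_intOp
  rwa [(intOp (F := E)).map_zero, add_zero] at h1

/-- The initial values `(B(0), B'(0), C(0))`. -/
def relInit (T : Config E) : E × E × E :=
  (ev (T 1 + T 3) 0, ev (T 1 - T 3) 0, ev ((2 : ℝ) • T 2) 0)

/-- The path `-A = -(T₀ + T₂)`. -/
def negA (T : Config E) : C(unitInterval, E) := -C1Path.val E (T 0 + T 2)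

variable (G) in
/-- The paths `C` and `B'` in the gauge where `A = 0`. -/
def relPath (T : Config E) : C(unitInterval, E) × C(unitInterval, E) :=
  (applyOp (AdDevInv G (negA T)) (C1Path.val E ((2 : ℝ) • T 2)),
    applyOp (AdDevInv G (negA T)) (C1Path.val E (T 1 - T 3)))

/-- Ḃ + [A,B] = 0 says that B is constant in the gauge where A vanishes. -/
lemma val_add_eq {T : Config E} (hT : T ∈ Sol E G) :
    C1Path.val E (T 1 + T 3) = applyOp (AdDev G (negA T)) (constOp E (relInit T).1) := by
  obtain ⟨h1, -, -⟩ := (mem_Sol_iff T).1 hT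
  have h := hasDerivPath_AdDevInv_apply (G := G) (negA T) (T 1 + T 3).hasDerivPath
  have z : -bilinOp (ad E G) (C1Path.val E (T 0 + T 2)) (C1Path.val E (T 1 + T 3)) -
      bilinOp (ad E G) (negA T) (C1Path.val E (T 1 + T 3)) = 0 := by
    ext t
    change -ad E G (C1Path.val E (T 0 + T 2) t) (C1Path.val E (T 1 + T 3) t) -
      ad E G (-(C1Path.val E (T 0 + T 2) t)) (C1Path.val E (T 1 + T 3) t) = 0
    rw [map_neg, neg_apply, sub_self]
  rw [h1, z, map_zero] at h
  have h2 := h.eq_constOp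
  have h3 := congrArg (applyOp (AdDev G (negA T))) h2
  rw [applyOp_AdDev_AdDevInv] at h3
  rw [h3]
  congr 2
  change Ad (dev G (negA T) ((0 : unitInterval) : ℝ))⁻¹ _ = _
  rw [Set.Icc.coe_zero, dev_apply_zero, inv_one, Ad_one_apply]
  rfl

/-- Removing A leaves Ċ + [A,C] = [B,B'] as ċ = [ξ,b]. As A' = A - C, the equation Ḃ' + [A',B'] = 0
reads Ḃ' + [A,B'] = [C,B'] and becomes ḃ = [c,b]. -/
lemma isRelSol_relPath {T : Config E} (hT : T ∈ Sol E G) :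
    IsRelSol G (relInit T) (relPath G T) := by
  have hB := val_add_eq hT
  obtain ⟨-, h2, h3⟩ := (mem_Sol_iff T).1 hT
  have h0 : ∀ y : C(unitInterval, E), applyOp (AdDevInv G (negA T)) y 0 = y 0 := fun y => by
    change Ad (dev G (negA T) ((0 : unitInterval) : ℝ))⁻¹ _ = _
    rw [Set.Icc.coe_zero, dev_apply_zero, inv_one, Ad_one_apply]
  refine ⟨?_, ?_, h0 _, h0 _⟩
  · have h := hasDerivPath_AdDevInv_apply (G := G) (negA T) ((2 : ℝ) • T 2).hasDerivPath
    rw [h3, hB] at h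
    have e : bilinOp (ad E G) (constOp E (relInit T).1) (relPath G T).2 = applyOp (AdDevInv G (negA T))
        (-bilinOp (ad E G) (C1Path.val E (T 0 + T 2)) (C1Path.val E ((2 : ℝ) • T 2)) +
          bilinOp (ad E G) (applyOp (AdDev G (negA T)) (constOp E (relInit T).1))
            (C1Path.val E (T 1 - T 3)) -
          bilinOp (ad E G) (negA T) (C1Path.val E ((2 : ℝ) • T 2))) := by
      ext t
      set g := dev G (negA T) t with hg
      change ad E G (relInit T).1 (Ad g⁻¹ (C1Path.val E (T 1 - T 3) t)) =
        Ad g⁻¹ (-ad E G (C1Path.val E (T 0 + T 2) t) (C1Path.val E ((2 : ℝ) • T 2) t) +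
          ad E G (Ad g (relInit T).1) (C1Path.val E (T 1 - T 3) t) -
          ad E G (-C1Path.val E (T 0 + T 2) t) (C1Path.val E ((2 : ℝ) • T 2) t))
      rw [map_neg (ad E G), neg_apply, neg_add_eq_sub, sub_neg_eq_add, sub_add_cancel, ← ad_Ad,
        Ad_inv_Ad]
    rw [e]
    exact h
  · have h := hasDerivPath_AdDevInv_apply (G := G) (negA T) (T 1 - T 3).hasDerivPath
    rw [h2] at h
    have e : bilinOp (ad E G) (relPath G T).1 (relPath G T).2 = applyOp (AdDevInv G (negA T))
        (-bilinOp (ad E G) (C1Path.val E (T 0 - T 2)) (C1Path.val E (T 1 - T 3)) -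
          bilinOp (ad E G) (negA T) (C1Path.val E (T 1 - T 3))) := by
      ext t
      set g := dev G (negA T) t with hg
      have hA : -C1Path.val E (T 0 + T 2) t =
          -C1Path.val E (T 0 - T 2) t - C1Path.val E ((2 : ℝ) • T 2) t := by
        simp only [two_smul, map_add, map_sub, ContinuousMap.add_apply, ContinuousMap.sub_apply]
        abel
      change ad E G (Ad g⁻¹ (C1Path.val E ((2 : ℝ) • T 2) t)) (Ad g⁻¹ (C1Path.val E (T 1 - T 3) t)) =
        Ad g⁻¹ (-ad E G (C1Path.val E (T 0 - T 2) t) (C1Path.val E (T 1 - T 3) t) -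
          ad E G (-C1Path.val E (T 0 + T 2) t) (C1Path.val E (T 1 - T 3) t))
      rw [hA, map_sub (ad E G), map_neg (ad E G), sub_apply, neg_apply, ad_Ad]
      congr 1
      abel
    rw [e]
    exact h

/-- -A' = -A + C = -A + Ad(u)c, which is the logarithmic velocity of the product of u with the
development of c. -/
lemma hol_sub_eq (T : Config E) :
    hol G (-C1Path.val E (T 0 - T 2)) = hol G (negA T) * hol G (relPath G T).1 := by
  rw [← hol_add]
  congr 1
  rw [relPath, applyOp_AdDev_AdDevInv, negA, two_smul, map_sub, map_add, map_add]
  abel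

end Reduction

/-! ### Gauge invariance, classification by holonomy and initial data, and reconstruction. -/

section Gauge

universe u v

variable {E : Type u} [NormedAddCommGroup E] [NormedSpace ℝ E] [FiniteDimensional ℝ E]
  {G : Type v} [TopologicalSpace G] [ChartedSpace E G] [Group G] [LieGroup 𝓘(ℝ, E) ∞ G]
  [CompactSpace G]

open C1Path

/-- If v develops -x, then u v develops -x', and u is trivial at both ends. -/
lemma hol_neg_gauge {u : ℝ → G} (hu : ContMDiffOn 𝓘(ℝ, ℝ) 𝓘(ℝ, E) 2 u (Icc 0 1)) (h0 : u 0 = 1)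
    (h1 : u 1 = 1) {x x' : C(unitInterval, E)}
    (h : ∀ t : unitInterval, x' t = Ad (u t) (x t) - logVel u t) : hol G (-x') = hol G (-x) := by
  have hd : IsDev (-x') (fun s => u s * dev G (-x) s) := by
    refine ⟨by simp [h0], fun t => ?_⟩
    have := (hasLogVel_of_contMDiffOn two_ne_zero hu t.2).mul ((isDev_dev (G := G) (-x)).vel t) t.2
    rw [ContinuousMap.neg_apply, map_neg] at this
    rw [ContinuousMap.neg_apply, h t, neg_sub, sub_eq_add_neg]
    exact this
  have := hd.eq_dev 1
  rw [Set.Icc.coe_one, h1, one_mul] at this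
  exact this.symm

lemma GaugeRel.hol_eq {T T' : Sol E G} (h : GaugeRel E G T T') :
    hol G (-val E (T.1 0 + T.1 2)) = hol G (-val E (T'.1 0 + T'.1 2)) ∧
      hol G (-val E (T.1 0 - T.1 2)) = hol G (-val E (T'.1 0 - T'.1 2)) := by
  obtain ⟨u, hu, h0, h1, hg⟩ := h
  constructor
  · refine (hol_neg_gauge hu h0 h1 fun t => ?_).symm
    obtain ⟨g0, -, g2, -⟩ := hg t
    rw [ev_eq, ev_eq] at g0 g2
    rw [map_add, map_add, ContinuousMap.add_apply, ContinuousMap.add_apply, g0, g2, map_add]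
    abel
  · refine (hol_neg_gauge hu h0 h1 fun t => ?_).symm
    obtain ⟨g0, -, g2, -⟩ := hg t
    rw [ev_eq, ev_eq] at g0 g2
    rw [map_sub, map_sub, ContinuousMap.sub_apply, ContinuousMap.sub_apply, g0, g2, map_sub]
    abel

lemma GaugeRel.relInit_eq {T T' : Sol E G} (h : GaugeRel E G T T') :
    relInit T.1 = relInit T'.1 := by
  obtain ⟨u, -, h0, -, hg⟩ := h
  obtain ⟨-, g1, g2, g3⟩ := hg 0
  rw [Set.Icc.coe_zero, h0, Ad_one_apply] at g1 g2 g3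
  simp only [ev_eq] at g1 g2 g3
  simp only [relInit, ev_eq, map_add, map_sub, map_smul, ContinuousMap.add_apply,
    ContinuousMap.sub_apply, ContinuousMap.smul_apply, g1, g2, g3]

lemma Ad_relPath_fst (T : Config E) (t : unitInterval) :
    Ad (dev G (negA T) t) ((relPath G T).1 t) = (2 : ℝ) • val E (T 2) t :=
  Ad_Ad_inv _ _

lemma Ad_relPath_snd (T : Config E) (t : unitInterval) :
    Ad (dev G (negA T) t) ((relPath G T).2 t) = val E (T 1) t - val E (T 3) t :=
  Ad_Ad_inv _ _

lemma Ad_relInit_fst {T : Config E} (hT : T ∈ Sol E G) (t : unitInterval) :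
    Ad (dev G (negA T) t) (relInit T).1 = val E (T 1) t + val E (T 3) t :=
  (DFunLike.congr_fun (val_add_eq hT) t).symm

/-- The gauge transformation is u'u⁻¹, the quotient of the two developments; it is trivial at time 1
because the holonomies agree. Equal initial data give equal (c, b) by uniqueness, so it also matches
the remaining components. -/
lemma gaugeRel_of_eq {T T' : Sol E G} (h1 : hol G (negA T.1) = hol G (negA T'.1))
    (h2 : relInit T.1 = relInit T'.1) : GaugeRel E G T T' := by
  have := FiniteDimensional.complete ℝ E
  have : LieGroup 𝓘(ℝ, E) 2 G := LieGroup.of_le (n := ∞) two_le_smooth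
  have hp : relPath G T.1 = relPath G T'.1 := by
    have h := isRelSol_relPath T'.2
    rw [← h2] at h
    exact (isRelSol_relPath T.2).eq h
  set u := dev G (negA T.1) with hu
  set u' := dev G (negA T'.1) with hu'
  have hc : ContMDiffOn 𝓘(ℝ, ℝ) 𝓘(ℝ, E) 2 u (Icc 0 1) :=
    contMDiffOn_dev (T.1 0 + T.1 2).hasDerivPath.neg
  have hc' : ContMDiffOn 𝓘(ℝ, ℝ) 𝓘(ℝ, E) 2 u' (Icc 0 1) :=
    contMDiffOn_dev (T'.1 0 + T'.1 2).hasDerivPath.neg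
  have hAd : ∀ (t : unitInterval) (y : E), Ad (u' t * (u t)⁻¹) (Ad (u t) y) = Ad (u' t) y := by
    intro t y
    rw [Ad_mul_apply, Ad_inv_Ad]
  refine ⟨fun s => u' s * (u s)⁻¹, hc'.mul hc.inv, by simp [hu, hu'], mul_inv_eq_one.2 h1.symm,
    fun t => ?_⟩
  have e1 : val E (T'.1 1) t + val E (T'.1 3) t =
      Ad (u' t * (u t)⁻¹) (val E (T.1 1) t + val E (T.1 3) t) := by
    rw [← Ad_relInit_fst T.2, ← Ad_relInit_fst T'.2, hAd, h2]
  have e2 : (2 : ℝ) • val E (T'.1 2) t = Ad (u' t * (u t)⁻¹) ((2 : ℝ) • val E (T.1 2) t) := by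
    rw [← Ad_relPath_fst (G := G), ← Ad_relPath_fst (G := G) T.1, hAd, hp]
  have e3 : val E (T'.1 1) t - val E (T'.1 3) t =
      Ad (u' t * (u t)⁻¹) (val E (T.1 1) t - val E (T.1 3) t) := by
    rw [← Ad_relPath_snd (G := G), ← Ad_relPath_snd (G := G) T.1, hAd, hp]
  have e4 : logVel (fun s => u' s * (u s)⁻¹) (t : ℝ) =
      negA T'.1 t + Ad (u' t) (-Ad (u t)⁻¹ (negA T.1 t)) :=
    (((isDev_dev (G := G) (negA T'.1)).vel t).mul (((isDev_dev (G := G) (negA T.1)).vel t).inv t.2)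
      t.2).logVel_eq t.2
  have e5 : Ad (u' t) (-Ad (u t)⁻¹ (negA T.1 t)) =
      Ad (u' t * (u t)⁻¹) (val E (T.1 0) t + val E (T.1 2) t) := by
    rw [← map_neg, Ad_mul_apply, negA, map_add]
    simp
  have e2' : val E (T'.1 2) t = Ad (u' t * (u t)⁻¹) (val E (T.1 2) t) := by
    rw [map_smul] at e2
    exact smul_right_injective E (two_ne_zero (α := ℝ)) e2
  simp only [ev_eq]
  refine ⟨?_, ?_, e2', ?_⟩
  · rw [e4, e5, map_add, ← e2', negA, map_add, ContinuousMap.neg_apply, ContinuousMap.add_apply]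
    abel
  · have : val E (T'.1 1) t = (1 / 2 : ℝ) • ((val E (T'.1 1) t + val E (T'.1 3) t) +
        (val E (T'.1 1) t - val E (T'.1 3) t)) := by module
    rw [this, e1, e3, ← map_add, ← map_smul]
    congr 1
    module
  · have : val E (T'.1 3) t = (1 / 2 : ℝ) • ((val E (T'.1 1) t + val E (T'.1 3) t) -
        (val E (T'.1 1) t - val E (T'.1 3) t)) := by module
    rw [this, e1, e3, ← map_sub, ← map_smul]
    congr 1
    module

/-! ### Construction of solutions -/

lemma val_ofDeriv [CompleteSpace E] {x x' : C(unitInterval, E)} {x₀ : E} (h : HasDerivPath x x')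
    (h0 : x 0 = x₀) : val E (ofDeriv E (x₀, x')) = x := by
  rw [← h0, ofDeriv_eq_mk h, val_mk]

lemma ev_ofDeriv_zero [CompleteSpace E] (x₀ : E) (x' : C(unitInterval, E)) :
    ev (ofDeriv E (x₀, x')) 0 = x₀ := by
  change x₀ + intOp x' 0 = x₀
  rw [intOp_zero_apply, add_zero]

variable (G) in
/-- The components `B`, `B'`, `C` of the solution with `A = -a` and initial values `p`. -/
def relComp [CompleteSpace E] (q : C1Path E × (E × E × E)) : C1Path E × C1Path E × C1Path E :=
  let a := val E q.1
  let R := AdDev G a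
  let y := relSol G q.2
  -- Derivatives are prescribed by the equations instead of being taken, which makes the dependence
  -- on `q` smooth with values in C¹ paths.
  (ofDeriv E (q.2.1, bilinOp (ad E G) a (applyOp R (constOp E q.2.1))),
    ofDeriv E (q.2.2.1, bilinOp (ad E G) a (applyOp R y.2) + applyOp R (bilinOp (ad E G) y.1 y.2)),
    ofDeriv E (q.2.2.2, bilinOp (ad E G) a (applyOp R y.1) +
      applyOp R (bilinOp (ad E G) (constOp E q.2.1) y.2)))

variable (G) in
/-- The solution of the Nahm-Schmid equations with `A = -a` and initial values `p`. -/
def ofRel [CompleteSpace E] (q : C1Path E × (E × E × E)) : Config E :=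
  let y := relComp G q
  ![-q.1 - (1 / 2 : ℝ) • y.2.2, (1 / 2 : ℝ) • (y.1 + y.2.1), (1 / 2 : ℝ) • y.2.2,
    (1 / 2 : ℝ) • (y.1 - y.2.1)]

section OfRel

variable [CompleteSpace E]

lemma ofRel_A (q : C1Path E × (E × E × E)) : ofRel G q 0 + ofRel G q 2 = -q.1 := by
  change -q.1 - (1 / 2 : ℝ) • (relComp G q).2.2 + (1 / 2 : ℝ) • (relComp G q).2.2 = _
  abel

lemma ofRel_B (q : C1Path E × (E × E × E)) : ofRel G q 1 + ofRel G q 3 = (relComp G q).1 := by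
  change (1 / 2 : ℝ) • ((relComp G q).1 + (relComp G q).2.1) +
    (1 / 2 : ℝ) • ((relComp G q).1 - (relComp G q).2.1) = _
  module

lemma ofRel_B' (q : C1Path E × (E × E × E)) : ofRel G q 1 - ofRel G q 3 = (relComp G q).2.1 := by
  change (1 / 2 : ℝ) • ((relComp G q).1 + (relComp G q).2.1) -
    (1 / 2 : ℝ) • ((relComp G q).1 - (relComp G q).2.1) = _
  module

lemma ofRel_C (q : C1Path E × (E × E × E)) : (2 : ℝ) • ofRel G q 2 = (relComp G q).2.2 := by
  change (2 : ℝ) • (1 / 2 : ℝ) • (relComp G q).2.2 = _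
  module

lemma relInit_ofRel (q : C1Path E × (E × E × E)) : relInit (ofRel G q) = q.2 := by
  rw [relInit, ofRel_B, ofRel_B', ofRel_C]
  refine Prod.ext (ev_ofDeriv_zero _ _) (Prod.ext (ev_ofDeriv_zero _ _) (ev_ofDeriv_zero _ _))

lemma negA_ofRel (q : C1Path E × (E × E × E)) : negA (ofRel G q) = val E q.1 := by
  rw [negA, ofRel_A, map_neg, neg_neg]

lemma AdDev_apply_zero (a z : C(unitInterval, E)) : applyOp (AdDev G a) z 0 = z 0 := by
  change Ad (dev G a ((0 : unitInterval) : ℝ)) _ = _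
  rw [Set.Icc.coe_zero, dev_apply_zero, Ad_one_apply]

/-- The gauge A = 0 is undone: conjugating ξ, b and c by Ad of the development of `a` adds the terms
[a, ·] to their equations, and these are the terms coming from A = -a. -/
lemma ofRel_mem_Sol {q : C1Path E × (E × E × E)} (hq : q.2 ∈ relSet E G) :
    ofRel G q ∈ Sol E G := by
  have hy := isRelSol_relSol hq
  set y := relSol G q.2 with hyd
  set a := val E q.1 with ha
  have h1 : HasDerivPath (applyOp (AdDev G a) (constOp E q.2.1))
      (bilinOp (ad E G) a (applyOp (AdDev G a) (constOp E q.2.1))) := by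
    have := hasDerivPath_AdDev_apply (G := G) a (hasDerivPath_const q.2.1)
    rwa [map_zero, add_zero] at this
  have v1 : val E (relComp G q).1 = applyOp (AdDev G a) (constOp E q.2.1) :=
    val_ofDeriv h1 (AdDev_apply_zero _ _)
  have v2 : val E (relComp G q).2.1 = applyOp (AdDev G a) y.2 :=
    val_ofDeriv (hasDerivPath_AdDev_apply a hy.right) ((AdDev_apply_zero _ _).trans hy.right_zero)
  have v3 : val E (relComp G q).2.2 = applyOp (AdDev G a) y.1 :=
    val_ofDeriv (hasDerivPath_AdDev_apply a hy.left) ((AdDev_apply_zero _ _).trans hy.left_zero)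
  have hA : ofRel G q 0 - ofRel G q 2 = -q.1 - (relComp G q).2.2 := by
    rw [← ofRel_A (G := G), ← ofRel_C]
    module
  rw [mem_Sol_iff, ofRel_A, ofRel_B, ofRel_B', ofRel_C, hA, map_sub, map_neg, v1, v2, v3, ← ha]
  refine ⟨?_, ?_, ?_⟩ <;> ext t
  · change ad E G (a t) (Ad (dev G a t) q.2.1) = -ad E G (-(a t)) (Ad (dev G a t) q.2.1)
    rw [map_neg, neg_apply, neg_neg]
  · change ad E G (a t) (Ad (dev G a t) (y.2 t)) + Ad (dev G a t) (ad E G (y.1 t) (y.2 t)) =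
      -ad E G (-(a t) - Ad (dev G a t) (y.1 t)) (Ad (dev G a t) (y.2 t))
    rw [← ad_Ad, map_sub, map_neg, sub_apply, neg_apply]
    abel
  · change ad E G (a t) (Ad (dev G a t) (y.1 t)) + Ad (dev G a t) (ad E G q.2.1 (y.2 t)) =
      -ad E G (-(a t)) (Ad (dev G a t) (y.1 t)) +
        ad E G (Ad (dev G a t) q.2.1) (Ad (dev G a t) (y.2 t))
    rw [← ad_Ad, map_neg, neg_apply, neg_neg]

lemma contDiffAt_bilinOp {X F F' F'' : Type*} [NormedAddCommGroup X] [NormedSpace ℝ X]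
    [NormedAddCommGroup F] [NormedSpace ℝ F] [NormedAddCommGroup F'] [NormedSpace ℝ F']
    [NormedAddCommGroup F''] [NormedSpace ℝ F''] (b : F →L[ℝ] F' →L[ℝ] F'')
    {f : X → C(unitInterval, F)} {g : X → C(unitInterval, F')} {x : X}
    (hf : ContDiffAt ℝ ∞ f x) (hg : ContDiffAt ℝ ∞ g x) :
    ContDiffAt ℝ ∞ (fun x => bilinOp b (f x) (g x)) x :=
  ContDiffAt.clm_apply (ContDiffAt.comp (g := bilinOp b) x (bilinOp b).contDiff.contDiffAt hf) hg

lemma contDiffAt_ofRel {q : C1Path E × (E × E × E)} (hq : q.2 ∈ relSet E G) :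
    ContDiffAt ℝ ∞ (ofRel G) q := by
  have ha : ContDiffAt ℝ ∞ (fun q : C1Path E × (E × E × E) => val E q.1) q :=
    ((val E).contDiff.comp contDiff_fst).contDiffAt
  have hR : ContDiffAt ℝ ∞ (fun q : C1Path E × (E × E × E) => AdDev G (val E q.1)) q :=
    ((contDiff_AdDev E G).comp ((val E).contDiff.comp contDiff_fst)).contDiffAt
  have hy : ContDiffAt ℝ ∞ (fun q : C1Path E × (E × E × E) => relSol G q.2) q :=
    ContDiffAt.comp (g := relSol G) q (contDiffAt_relSol hq) contDiffAt_snd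
  have h1 : ContDiffAt ℝ ∞ (fun q : C1Path E × (E × E × E) => q.2.1) q :=
    (contDiff_fst.comp contDiff_snd).contDiffAt
  have h2 : ContDiffAt ℝ ∞ (fun q : C1Path E × (E × E × E) => q.2.2.1) q :=
    (contDiff_fst.comp (contDiff_snd.comp contDiff_snd)).contDiffAt
  have h3 : ContDiffAt ℝ ∞ (fun q : C1Path E × (E × E × E) => q.2.2.2) q :=
    (contDiff_snd.comp (contDiff_snd.comp contDiff_snd)).contDiffAt
  have hx : ContDiffAt ℝ ∞ (fun q : C1Path E × (E × E × E) => constOp E q.2.1) q :=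
    ContDiffAt.comp (g := constOp E) q (constOp E).contDiff.contDiffAt h1
  have hof : ∀ {f : C1Path E × (E × E × E) → E × C(unitInterval, E)}, ContDiffAt ℝ ∞ f q →
      ContDiffAt ℝ ∞ (fun q => ofDeriv E (f q)) q := fun hf =>
    ContDiffAt.comp (g := ofDeriv E) q (ofDeriv E).contDiff.contDiffAt hf
  have c1 : ContDiffAt ℝ ∞ (fun q => (relComp G q).1) q :=
    hof (h1.prodMk (contDiffAt_bilinOp _ ha (contDiffAt_bilinOp _ hR hx)))
  have c2 : ContDiffAt ℝ ∞ (fun q => (relComp G q).2.1) q :=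
    hof (h2.prodMk ((contDiffAt_bilinOp _ ha (contDiffAt_bilinOp _ hR hy.snd)).add
      (contDiffAt_bilinOp _ hR (contDiffAt_bilinOp _ hy.fst hy.snd))))
  have c3 : ContDiffAt ℝ ∞ (fun q => (relComp G q).2.2) q :=
    hof (h3.prodMk ((contDiffAt_bilinOp _ ha (contDiffAt_bilinOp _ hR hy.fst)).add
      (contDiffAt_bilinOp _ hR (contDiffAt_bilinOp _ hx hy.snd))))
  rw [contDiffAt_pi]
  intro i
  fin_cases i
  · exact contDiffAt_fst.neg.sub (c3.const_smul (1 / 2 : ℝ))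
  · exact (c1.add c2).const_smul (1 / 2 : ℝ)
  · exact c3.const_smul (1 / 2 : ℝ)
  · exact (c1.sub c2).const_smul (1 / 2 : ℝ)

end OfRel

variable (E) in
/-- Every group element is the holonomy of a `C¹` path which depends smoothly on it, locally. -/
lemma exists_local_path [ConnectedSpace G] (γ₀ : G) : ∃ α : G → C1Path E,
    ContMDiffAt 𝓘(ℝ, E) 𝓘(ℝ, C1Path E) ∞ α γ₀ ∧ ∀ᶠ γ in 𝓝 γ₀, hol G (val E (α γ)) = γ := by
  have := FiniteDimensional.complete ℝ E
  have hG := topologicalGroup_of_lieGroup 𝓘(ℝ, E) ∞ (G := G)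
  obtain ⟨a, a', ha, rfl⟩ := exists_hol_eq E γ₀
  obtain ⟨ℓ, hℓ, hℓe⟩ := exists_local_log E G
  -- β(x) is the C¹ path a + Ad(u)x, with u the development of `a`; its holonomy is that of `a`
  -- times that of the constant path x.
  let β : E → C1Path E := fun x => ofDeriv E (a 0 + x, a' +
    bilinOp (ad E G) a (applyOp (AdDev G a) (constOp E x)))
  have hβ : ContDiff ℝ ∞ β := by
    refine (ofDeriv E).contDiff.comp ((contDiff_const.add contDiff_id).prodMk (contDiff_const.add ?_))
    exact (bilinOp (ad E G) a).contDiff.comp ((applyOp (AdDev G a)).contDiff.comp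
      (constOp E).contDiff)
  have hβv : ∀ x, val E (β x) = a + applyOp (AdDev G a) (constOp E x) := by
    intro x
    have h1 := hasDerivPath_AdDev_apply (G := G) a (hasDerivPath_const x)
    rw [map_zero, add_zero] at h1
    refine val_ofDeriv (ha.add h1) ?_
    rw [ContinuousMap.add_apply, AdDev_apply_zero]
    rfl
  have hm : ContMDiffAt 𝓘(ℝ, E) 𝓘(ℝ, E) ∞ (fun γ : G => (hol G a)⁻¹ * γ) (hol G a) :=
    contMDiffAt_const.mul contMDiffAt_id
  have hm1 : (hol G a)⁻¹ * hol G a = 1 := inv_mul_cancel _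
  refine ⟨fun γ => β (ℓ ((hol G a)⁻¹ * γ)), ?_, ?_⟩
  · refine ContMDiffAt.comp (g := β) (hol G a) hβ.contDiffAt.contMDiffAt ?_
    exact ContMDiffAt.comp (g := ℓ) (hol G a) (by rwa [hm1]) hm
  · have : ∀ᶠ γ in 𝓝 (hol G a), hol G (constOp E (ℓ ((hol G a)⁻¹ * γ))) = (hol G a)⁻¹ * γ :=
      Tendsto.eventually (f := fun γ : G => (hol G a)⁻¹ * γ) hm.continuousAt
        (p := fun g => hol G (constOp E (ℓ g)) = g) (by simpa using hℓe)
    filter_upwards [this] with γ hγ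
    rw [hβv, hol_add, hγ, mul_inv_cancel_left]

end Gauge

/-! ## Solutions with small `T₂`, `T₃` are not in the degeneracy locus -/

section Nondegeneracy

universe u v

lemma integral_unitInterval {F : Type*} [NormedAddCommGroup F] [NormedSpace ℝ F] [CompleteSpace F]
    (f : C(unitInterval, F)) : ∫ t : unitInterval, f t = intOp f 1 := by
  have h1 : ∫ t : unitInterval, ext01 f t = ∫ s in Icc (0 : ℝ) 1, ext01 f s :=
    integral_subtype_comap measurableSet_Icc (ext01 f)
  simp only [ext01_coe] at h1
  rw [h1, integral_Icc_eq_integral_Ioc, intOp_apply, Set.Icc.coe_one,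
    intervalIntegral.integral_of_le zero_le_one]

lemma intOp_mono {f g : C(unitInterval, ℝ)} (h : ∀ t, f t ≤ g t) (t : unitInterval) :
    intOp f t ≤ intOp g t := by
  rw [intOp_apply, intOp_apply]
  exact intervalIntegral.integral_mono_on t.2.1 ((continuous_ext01 f).intervalIntegrable _ _)
    ((continuous_ext01 g).intervalIntegrable _ _) fun s hs => h _

lemma intOp_le_intOp_one {g : C(unitInterval, ℝ)} (h : ∀ t, 0 ≤ g t) (t : unitInterval) :
    intOp g t ≤ intOp g 1 := by
  rw [intOp_apply, intOp_apply]
  exact intervalIntegral.integral_mono_interval le_rfl t.2.1 t.2.2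
    (Eventually.of_forall fun s => h _) ((continuous_ext01 g).intervalIntegrable _ _)

lemma intOp_const_one (c : ℝ) : intOp (constOp ℝ c) 1 = c := by
  rw [← integral_unitInterval]
  simp

variable {E : Type u} [NormedAddCommGroup E] [NormedSpace ℝ E]
  {G : Type v} [TopologicalSpace G] [ChartedSpace E G] [Group G]

lemma AdInvariantInner.nonneg (B : AdInvariantInner E G) (x : E) : 0 ≤ B.form x x := by
  by_cases hx : x = 0
  · simp [hx]
  · exact (B.pos x hx).le

lemma AdInvariantInner.eq_zero (B : AdInvariantInner E G) {x : E} (h : B.form x x ≤ 0) : x = 0 := by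
  by_contra hx
  exact absurd (B.pos x hx) h.not_gt

lemma metric_eq [CompleteSpace E] (B : AdInvariantInner E G) (X Y : Config E) :
    metric B X Y = intOp (bilinOp B.form (C1Path.val E (X 0)) (C1Path.val E (Y 0)) +
      bilinOp B.form (C1Path.val E (X 1)) (C1Path.val E (Y 1)) -
      bilinOp B.form (C1Path.val E (X 2)) (C1Path.val E (Y 2)) -
      bilinOp B.form (C1Path.val E (X 3)) (C1Path.val E (Y 3))) 1 := by
  rw [← integral_unitInterval]
  rfl

variable [LieGroup 𝓘(ℝ, E) ∞ G]

/-- The operator `x ↦ [x, y]` has norm at most `1 / 4`. -/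
def IsSmall (B : AdInvariantInner E G) (y : E) : Prop :=
  ∀ x, B.form (ad E G x y) (ad E G x y) ≤ 1 / 16 * B.form x x

/-- Compactness of the unit sphere gives m > 0 with ⟨x,x⟩ ≥ m‖x‖², which compares the given norm
with the invariant one. -/
lemma exists_isSmall [FiniteDimensional ℝ E] (B : AdInvariantInner E G) :
    ∃ r : ℝ, 0 < r ∧ ∀ y : E, ‖y‖ < r → IsSmall B y := by
  have := FiniteDimensional.proper_real E
  obtain ⟨m, hm, hmin⟩ := (isCompact_sphere (0 : E) 1).exists_forall_le'
    (f := fun x => B.form x x) (a := 0) (by fun_prop) (fun x hx => B.pos x (by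
      rintro rfl
      simp at hx))
  have hlow : ∀ x : E, m * ‖x‖ ^ 2 ≤ B.form x x := by
    intro x
    by_cases hx : x = 0
    · simp [hx]
    have hn : ‖x‖ ≠ 0 := norm_ne_zero_iff.2 hx
    have h1 := hmin (‖x‖⁻¹ • x) (by simp [norm_smul, hn])
    simp only [map_smul, smul_apply, smul_eq_mul] at h1
    have h2 := mul_le_mul_of_nonneg_right h1 (sq_nonneg ‖x‖)
    have h3 : ‖x‖⁻¹ * (‖x‖⁻¹ * B.form x x) * ‖x‖ ^ 2 = B.form x x := by
      field_simp
    rwa [h3] at h2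
  set K := ‖B.form‖ * ‖ad E G‖ ^ 2 with hK
  have hK0 : 0 ≤ K := by positivity
  -- With |[x,y]|² ≤ K‖x‖²‖y‖², the bound ‖y‖² ≤ m/(16(K+1)) yields m‖x‖²/16; using K + 1 keeps the
  -- denominator non-zero.
  refine ⟨Real.sqrt (m / (16 * (K + 1))), by positivity, fun y hy x => ?_⟩
  have hy2 : ‖y‖ ^ 2 ≤ m / (16 * (K + 1)) := by
    rw [← Real.sq_sqrt (show 0 ≤ m / (16 * (K + 1)) by positivity)]
    gcongr
  have h1 : B.form (ad E G x y) (ad E G x y) ≤ K * (‖x‖ ^ 2 * ‖y‖ ^ 2) := by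
    refine (le_abs_self _).trans ((B.form.le_opNorm₂ _ _).trans ?_)
    have := (ad E G).le_opNorm₂ x y
    calc ‖B.form‖ * ‖ad E G x y‖ * ‖ad E G x y‖
        ≤ ‖B.form‖ * (‖ad E G‖ * ‖x‖ * ‖y‖) * (‖ad E G‖ * ‖x‖ * ‖y‖) := by gcongr
      _ = K * (‖x‖ ^ 2 * ‖y‖ ^ 2) := by rw [hK]; ring
  refine h1.trans ?_
  have h2 : K * (‖x‖ ^ 2 * ‖y‖ ^ 2) ≤ (K + 1) * (‖x‖ ^ 2 * (m / (16 * (K + 1)))) := by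
    gcongr
    linarith
  refine h2.trans ?_
  have h3 : (K + 1) * (‖x‖ ^ 2 * (m / (16 * (K + 1)))) = 1 / 16 * (m * ‖x‖ ^ 2) := by
    field_simp
  rw [h3]
  gcongr
  exact hlow x

/-- Smallness is measured in the invariant form, so it survives the change of gauge, which need not
preserve the norm. -/
lemma IsSmall.Ad {B : AdInvariantInner E G} {y : E} (h : IsSmall B y) (g : G) :
    IsSmall B (Ad g y) := by
  intro x
  have h1 := h (NahmSchmid.Ad g⁻¹ x)
  rw [B.invariant] at h1
  rwa [← B.invariant g (ad E G _ _), ← ad_Ad, Ad_Ad_inv] at h1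

/-- Let M be the maximum of |ξ|². Since ⟨ξ,[ξ,T₀]⟩ = 0, the derivative of |ξ|² is -2⟨ξ,X₀⟩, and ξ(0)
= 0 gives the Poincaré-type bound M ≤ 4∫|X₀|². The negative part of the metric is at most M/8 by
smallness, so a null vector satisfies ∫|X₀|² ≤ M/8 and therefore M ≤ M/2. -/
lemma eq_zero_of_metric_eq_zero [CompleteSpace E] (B : AdInvariantInner E G) {T X : Config E}
    (h2 : ∀ t, IsSmall B (ev (T 2) t)) (h3 : ∀ t, IsSmall B (ev (T 3) t))
    (hX : X ∈ orbitTangent G T) (h0 : metric B X X = 0) : X = 0 := by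
  obtain ⟨ξ, ξ', -, hξ0, -, hXt⟩ := hX
  simp only [br_eq, ev_eq, dv_eq] at *
  set x := C1Path.val E ξ with hx
  set n := bilinOp B.form x x with hn
  set e := bilinOp B.form (C1Path.val E (X 0)) (C1Path.val E (X 0)) with he
  have hder := (ξ.hasDerivPath.bilinOp B.form ξ.hasDerivPath)
  rw [← hx, ← hn] at hder
  have hn' : ∀ t, (bilinOp B.form (C1Path.der E ξ) x + bilinOp B.form x (C1Path.der E ξ)) t =
      -2 * B.form (x t) (C1Path.val E (X 0) t) := by
    intro t
    have e1 : C1Path.der E ξ t = ad E G (x t) (C1Path.val E (T 0) t) - C1Path.val E (X 0) t := by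
      rw [(hXt t).1]
      abel
    have e2 := B.form_ad (x t) (x t) (C1Path.val E (T 0) t)
    rw [ad_self, map_zero, zero_apply, zero_add] at e2
    simp only [ContinuousMap.add_apply, bilinOp_apply]
    rw [B.symm (C1Path.der E ξ t), e1, map_sub, e2]
    ring
  obtain ⟨t₀, -, ht₀⟩ := isCompact_univ.exists_isMaxOn (univ_nonempty (α := unitInterval))
    n.continuous.continuousOn
  have hmax : ∀ t, n t ≤ n t₀ := fun t => ht₀ (mem_univ t)
  set M := n t₀ with hM
  have he0 : ∀ t, 0 ≤ e t := fun t => B.nonneg _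
  have hM0 : 0 ≤ M := B.nonneg _
  -- Expanding |ξ + 2X₀|² ≥ 0 gives -2⟨ξ,X₀⟩ ≤ |ξ|²/2 + 2|X₀|². The coefficient 1/2 lets M be
  -- absorbed after integration.
  have hbound : ∀ t, (bilinOp B.form (C1Path.der E ξ) x + bilinOp B.form x (C1Path.der E ξ)) t ≤
      (constOp ℝ (M / 2) + (2 : ℝ) • e) t := by
    intro t
    rw [hn' t]
    have h := B.nonneg (x t + (2 : ℝ) • C1Path.val E (X 0) t)
    simp only [map_add, map_smul, add_apply, smul_apply, smul_eq_mul,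
      B.symm (C1Path.val E (X 0) t) (x t)] at h
    have h' : n t = B.form (x t) (x t) := rfl
    have h'' : e t = B.form (C1Path.val E (X 0) t) (C1Path.val E (X 0) t) := rfl
    have h''' := hmax t
    simp only [ContinuousMap.add_apply, constOp_apply, ContinuousMap.smul_apply, smul_eq_mul]
    linarith
  have hMe : M ≤ 4 * intOp e 1 := by
    have e1 := DFunLike.congr_fun hder.eq_add_intOp t₀
    have e2 : n 0 = 0 := by
      rw [hn, bilinOp_apply, hξ0, map_zero]
    rw [ContinuousMap.add_apply, ContinuousMap.const_apply, e2, zero_add, ← hM] at e1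
    have e3 := (intOp_mono hbound t₀).trans (intOp_le_intOp_one (fun t => by
      simp only [ContinuousMap.add_apply, constOp_apply, ContinuousMap.smul_apply, smul_eq_mul]
      have := he0 t
      linarith) t₀)
    rw [← e1, map_add, map_smul, ContinuousMap.add_apply, ContinuousMap.smul_apply,
      intOp_const_one, smul_eq_mul] at e3
    linarith
  -- Each of |X₂|² and |X₃|² is at most M/16, which accounts for M/8; the term |X₁|² is dropped.
  have hle : intOp (e - constOp ℝ (M / 8)) 1 ≤ 0 := by
    rw [← h0, metric_eq]
    refine intOp_mono (fun t => ?_) 1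
    obtain ⟨-, -, x2, x3⟩ := hXt t
    simp only [ContinuousMap.sub_apply, ContinuousMap.add_apply, constOp_apply, bilinOp_apply, he]
    rw [x2, x3]
    have h1 := B.nonneg (C1Path.val E (X 1) t)
    have h2' := h2 t (x t)
    have h3' := h3 t (x t)
    have h4 : B.form (x t) (x t) ≤ M := hmax t
    linarith
  rw [map_sub, ContinuousMap.sub_apply, intOp_const_one] at hle
  have hMz : M ≤ 0 := by linarith
  have hxz : ξ = 0 := by
    refine C1Path.ext ?_
    rw [map_zero]
    ext t
    exact B.eq_zero ((hmax t).trans hMz)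
  have hx0 : ∀ t, x t = 0 := fun t => by rw [hx, hxz, map_zero]; rfl
  have hxd : ∀ t, C1Path.der E ξ t = 0 := fun t => by rw [hxz, map_zero]; rfl
  funext i
  refine C1Path.ext ?_
  rw [Pi.zero_apply, map_zero]
  ext t
  obtain ⟨x0, x1, x2, x3⟩ := hXt t
  rw [hx0 t, map_zero] at x0 x1 x2 x3
  rw [hxd t] at x0
  fin_cases i
  · exact x0.trans (by simp)
  · exact x1
  · exact x2
  · exact x3

lemma not_mem_degeneracyLocus [CompleteSpace E] (B : AdInvariantInner E G) {T : Config E}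
    (h2 : ∀ t, IsSmall B (ev (T 2) t)) (h3 : ∀ t, IsSmall B (ev (T 3) t)) :
    T ∉ DegeneracyLocus B := by
  rintro ⟨-, X, hX, hne, h⟩
  exact hne (eq_zero_of_metric_eq_zero B h2 h3 hX (h X hX))

variable [FiniteDimensional ℝ E] [CompactSpace G]

/-- Up to Ad of the development, T₂ is c/2 and T₃ is (ξ - b)/2, and these are the quantities bounded
in `relGood`. -/
lemma not_mem_degeneracyLocus_of_relGood (B : AdInvariantInner E G) {r : ℝ}
    (hr : ∀ y : E, ‖y‖ < r → IsSmall B y) {T : Config E} (hT : T ∈ Sol E G)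
    (h : relInit T ∈ relGood E G r) : T ∉ DegeneracyLocus B := by
  have := FiniteDimensional.complete ℝ E
  obtain ⟨-, -, -, h4, h5⟩ := h
  rw [(isRelSol_relPath hT).relSol_eq] at h4 h5
  have hhalf : ∀ y : E, ‖y‖ < r → IsSmall B ((1 / 2 : ℝ) • y) := fun y hy =>
    hr _ (lt_of_le_of_lt (by rw [norm_smul]; norm_num; linarith [norm_nonneg y]) hy)
  refine not_mem_degeneracyLocus B (fun t => ?_) (fun t => ?_)
  · have h6 := (hhalf _ (((relPath G T).1.norm_coe_le_norm t).trans_lt h4)).Ad (dev G (negA T) t)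
    rw [map_smul, Ad_relPath_fst, smul_smul] at h6
    norm_num at h6
    exact h6
  · have h6 := (hhalf _ (((constOp E (relInit T).1 - (relPath G T).2).norm_coe_le_norm t).trans_lt
      h5)).Ad (dev G (negA T) t)
    rw [map_smul, ContinuousMap.sub_apply, constOp_apply, map_sub, Ad_relPath_snd,
      Ad_relInit_fst hT] at h6
    rw [ev_eq]
    convert h6 using 1
    module

end Nondegeneracy

/-! ## Coordinates on the cotangent bundle -/

section CotangentChart

universe u v

variable {E : Type u} [NormedAddCommGroup E] [NormedSpace ℝ E]
  {G : Type v} [TopologicalSpace G] [ChartedSpace E G] [IsManifold 𝓘(ℝ, E) ∞ G]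

/-- The fibre coordinate of a covector in the preferred chart at `γ₀`. -/
def fibCoord (γ₀ : G) (p : Cotangent E G) : E →L[ℝ] ℝ :=
  ContinuousLinearMap.comp (p.2 : E →L[ℝ] ℝ)
    (mfderiv 𝓘(ℝ, E) 𝓘(ℝ, E) (extChartAt 𝓘(ℝ, E) γ₀).symm (extChartAt 𝓘(ℝ, E) γ₀ p.1) : E →L[ℝ] E)

/-- The fibre coordinate in the hom-bundle is composition with the derivative of the inverse chart,
because the trivialisation of the trivial line bundle is the identity. -/
lemma inCoordinates_eq_fibCoord (γ₀ : G) {p : Cotangent E G}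
    (h : p.1 ∈ (chartAt E γ₀).source) :
    ContinuousLinearMap.inCoordinates E (fun x : G => TangentSpace 𝓘(ℝ, E) x) ℝ (Bundle.Trivial G ℝ)
      γ₀ p.1 γ₀ p.1 p.2 = fibCoord γ₀ p := by
  have h1 := TangentBundle.symmL_trivializationAt (I := 𝓘(ℝ, E)) (𝕜 := ℝ) h
  have h2 : (trivializationAt ℝ (Bundle.Trivial G ℝ) γ₀).continuousLinearMapAt ℝ p.1 =
      ContinuousLinearMap.id ℝ ℝ :=
    Bundle.Trivial.continuousLinearMapAt_trivialization ℝ G ℝ p.1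
  rw [ContinuousLinearMap.inCoordinates, h1, h2, modelWithCornersSelf_coe, range_id,
    mfderivWithin_univ]
  ext v
  rfl

lemma extChartAt_cotangent (p₀ : Cotangent E G) {p : Cotangent E G}
    (h : p.1 ∈ (chartAt E p₀.1).source) :
    extChartAt (cotangentModel E) p₀ p = (extChartAt 𝓘(ℝ, E) p₀.1 p.1, fibCoord p₀.1 p) := by
  rw [← inCoordinates_eq_fibCoord p₀.1 h]
  have := hom_chart (HB := E) (𝕜 := ℝ) p₀ p
  exact Prod.ext (congrArg Prod.fst this) (congrArg Prod.snd this)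

lemma mem_extChartAt_cotangent_source (p₀ p : Cotangent E G) :
    p ∈ (extChartAt (cotangentModel E) p₀).source ↔ p.1 ∈ (chartAt E p₀.1).source := by
  simp only [FiberBundle.chartedSpace_chartAt, mfld_simps]
  exact ⟨fun h => h.1.1, fun h => ⟨⟨h, mem_univ _⟩, h⟩⟩

lemma contMDiffAt_cotangent {X : Type*} [NormedAddCommGroup X] [NormedSpace ℝ X] {H : Type*}
    [TopologicalSpace H] {I : ModelWithCorners ℝ X H} {M : Type*} [TopologicalSpace M]
    [ChartedSpace H M] {K : M → Cotangent E G} {x : M}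
    (h1 : ContMDiffAt I 𝓘(ℝ, E) ∞ (fun y => (K y).1) x)
    (h2 : ContMDiffAt I 𝓘(ℝ, E →L[ℝ] ℝ) ∞ (fun y => fibCoord (K x).1 (K y)) x) :
    ContMDiffAt I (cotangentModel E) ∞ K x := by
  rw [contMDiffAt_hom_bundle]
  refine ⟨h1, h2.congr_of_eventuallyEq ?_⟩
  filter_upwards [h1.continuousAt.eventually
    ((chartAt E (K x).1).open_source.mem_nhds (mem_chart_source E (K x).1))] with y hy
  exact inCoordinates_eq_fibCoord _ hy

lemma contMDiffAt_fibCoord (p₀ : Cotangent E G) {p : Cotangent E G}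
    (h : p.1 ∈ (chartAt E p₀.1).source) :
    ContMDiffAt (cotangentModel E) 𝓘(ℝ, E →L[ℝ] ℝ) ∞ (fibCoord p₀.1) p := by
  have h1 : ContMDiffAt (cotangentModel E) 𝓘(ℝ, E × (E →L[ℝ] ℝ)) ∞
      (extChartAt (cotangentModel E) p₀) p :=
    contMDiffAt_extChartAt' (by
      rw [← extChartAt_source (cotangentModel E), mem_extChartAt_cotangent_source]
      exact h)
  have h2 : ContMDiffAt (cotangentModel E) 𝓘(ℝ, E →L[ℝ] ℝ) ∞
      (fun q => (extChartAt (cotangentModel E) p₀ q).2) p :=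
    ContMDiffAt.comp (g := Prod.snd) p contDiff_snd.contDiffAt.contMDiffAt h1
  refine h2.congr_of_eventuallyEq ?_
  have hs : (extChartAt (cotangentModel E) p₀).source ∈ 𝓝 p :=
    (isOpen_extChartAt_source p₀).mem_nhds ((mem_extChartAt_cotangent_source p₀ p).2 h)
  filter_upwards [hs] with q hq
  rw [extChartAt_cotangent p₀ ((mem_extChartAt_cotangent_source p₀ q).1 hq)]

/-- The tautological form in coordinates is `p dq`. -/
lemma tautological_comp_extChartAt_symm (p : Cotangent E G) :
    ∀ᶠ y in 𝓝 (extChartAt (cotangentModel E) p p),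
      (tautological E G ((extChartAt (cotangentModel E) p).symm y)).comp
        (mfderiv 𝓘(ℝ, E × (E →L[ℝ] ℝ)) (cotangentModel E) (extChartAt (cotangentModel E) p).symm y) =
      (y.2.comp (ContinuousLinearMap.fst ℝ E (E →L[ℝ] ℝ)) : E × (E →L[ℝ] ℝ) →L[ℝ] ℝ) := by
  have ht : (extChartAt (cotangentModel E) p).target ∈ 𝓝 (extChartAt (cotangentModel E) p p) :=
    extChartAt_target_mem_nhds p
  filter_upwards [ht, eventually_mem_nhds_iff.2 ht] with y hy hy'
  set q := (extChartAt (cotangentModel E) p).symm y with hq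
  have hqs : q ∈ (extChartAt (cotangentModel E) p).source :=
    (extChartAt (cotangentModel E) p).map_target hy
  have hq1 := (mem_extChartAt_cotangent_source p q).1 hqs
  have hy2 : (extChartAt 𝓘(ℝ, E) p.1 q.1, fibCoord p.1 q) = y := by
    rw [← extChartAt_cotangent p hq1]
    exact (extChartAt (cotangentModel E) p).right_inv hy
  have hsm : MDifferentiableAt 𝓘(ℝ, E × (E →L[ℝ] ℝ)) (cotangentModel E)
      (extChartAt (cotangentModel E) p).symm y :=
    ((contMDiffOn_extChartAt_symm (n := ∞) p).contMDiffAt hy').mdifferentiableAt (by simp)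
  have hpr : MDifferentiableAt (cotangentModel E) 𝓘(ℝ, E) (fun q : Cotangent E G => q.1) q :=
    (contMDiff_proj (n := ∞) _ q).mdifferentiableAt (by simp)
  have e1 := mfderiv_comp y hpr hsm
  have e2 : (fun q : Cotangent E G => q.1) ∘ (extChartAt (cotangentModel E) p).symm =ᶠ[𝓝 y]
      (extChartAt 𝓘(ℝ, E) p.1).symm ∘ Prod.fst := by
    filter_upwards [hy'] with z hz
    have hz1 := (mem_extChartAt_cotangent_source p _).1
      ((extChartAt (cotangentModel E) p).map_target hz)
    have hz2 : z.1 = extChartAt 𝓘(ℝ, E) p.1 ((extChartAt (cotangentModel E) p).symm z).1 :=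
      congrArg Prod.fst (((extChartAt (cotangentModel E) p).right_inv hz).symm.trans
        (extChartAt_cotangent p hz1))
    simp only [Function.comp_apply]
    rw [hz2]
    exact ((extChartAt 𝓘(ℝ, E) p.1).left_inv (by rwa [extChartAt_source])).symm
  have hy1 : y.1 = extChartAt 𝓘(ℝ, E) p.1 q.1 := congrArg Prod.fst hy2.symm
  have hsm' : MDifferentiableAt 𝓘(ℝ, E) 𝓘(ℝ, E) (extChartAt 𝓘(ℝ, E) p.1).symm y.1 := by
    have : y.1 ∈ (extChartAt 𝓘(ℝ, E) p.1).target := by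
      rw [hy1]
      exact (extChartAt 𝓘(ℝ, E) p.1).map_source (by rwa [extChartAt_source])
    exact ((contMDiffOn_extChartAt_symm (n := ∞) p.1).contMDiffAt
      ((isOpen_extChartAt_target p.1).mem_nhds this)).mdifferentiableAt (by simp)
  have e3 := e2.mfderiv_eq (I := 𝓘(ℝ, E × (E →L[ℝ] ℝ))) (I' := 𝓘(ℝ, E))
  have e4 := mfderiv_comp (I := 𝓘(ℝ, E × (E →L[ℝ] ℝ))) (I' := 𝓘(ℝ, E)) (I'' := 𝓘(ℝ, E)) y
    (f := Prod.fst) hsm' (differentiableAt_fst (𝕜 := ℝ)).mdifferentiableAt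
  ext v
  have e5 := DFunLike.congr_fun (e1.symm.trans (e3.trans e4)) v
  have e6 : (mfderiv 𝓘(ℝ, E × (E →L[ℝ] ℝ)) 𝓘(ℝ, E) (Prod.fst : E × (E →L[ℝ] ℝ) → E) y :
      E × (E →L[ℝ] ℝ) →L[ℝ] E) = ContinuousLinearMap.fst ℝ E (E →L[ℝ] ℝ) := by
    rw [mfderiv_eq_fderiv, fderiv_fst]
  have e7 : y.2 = fibCoord p.1 q := congrArg Prod.snd hy2.symm
  rw [e6] at e5
  rw [e7]
  change (q.2 : E →L[ℝ] ℝ) _ = (q.2 : E →L[ℝ] ℝ) _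
  rw [← hy1]
  exact congrArg (q.2 : E →L[ℝ] ℝ) e5

/-- For the coordinate form p dq: the coefficient is linear in the point, so its derivative is that
same linear map. -/
lemma fderiv_comp_clm {X Y : Type*} [NormedAddCommGroup X] [NormedSpace ℝ X]
    [NormedAddCommGroup Y] [NormedSpace ℝ Y] (s : X →L[ℝ] (Y →L[ℝ] ℝ)) (c : X →L[ℝ] Y)
    {a : X → (X →L[ℝ] ℝ)} {x : X} (h : ∀ᶠ y in 𝓝 x, a y = (s y).comp c) (v w : X) :
    fderiv ℝ a x v w = s v (c w) := by
  let L : X →L[ℝ] (X →L[ℝ] ℝ) := (ContinuousLinearMap.compL ℝ X Y ℝ).flip c ∘L s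
  have h1 : a =ᶠ[𝓝 x] L := h
  rw [h1.fderiv_eq, L.fderiv]
  rfl

lemma omegaCot_apply (p : Cotangent E G) (v w : E × (E →L[ℝ] ℝ)) :
    omegaCot E G p v w = w.2 v.1 - v.2 w.1 := by
  have h := fderiv_comp_clm (ContinuousLinearMap.snd ℝ E (E →L[ℝ] ℝ))
    (ContinuousLinearMap.fst ℝ E (E →L[ℝ] ℝ)) (tautological_comp_extChartAt_symm p)
  refine (congrArg Neg.neg (congrArg₂ (· - ·) (h v w) (h w v))).trans ?_
  simp

end CotangentChart

/-! ### The left trivialisation of the cotangent bundle in charts. -/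

section ToCotangent

universe u v

variable {E : Type u} [NormedAddCommGroup E] [NormedSpace ℝ E]
  {G : Type v} [TopologicalSpace G] [ChartedSpace E G]

lemma mfderiv_eq_fderiv_extChartAt {X : Type*} [NormedAddCommGroup X] [NormedSpace ℝ X]
    {F H : Type*} [NormedAddCommGroup F] [NormedSpace ℝ F] [TopologicalSpace H]
    {J : ModelWithCorners ℝ F H} {M : Type*} [TopologicalSpace M] [ChartedSpace H M]
    {f : X → M} {x : X} (hf : MDifferentiableAt 𝓘(ℝ, X) J f x) :
    mfderiv 𝓘(ℝ, X) J f x = fderiv ℝ (fun y => extChartAt J (f x) (f y)) x := by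
  rw [hf.mfderiv, modelWithCornersSelf_coe, range_id, fderivWithin_univ]
  rfl

lemma contMDiffAt_extChartAt_symm [IsManifold 𝓘(ℝ, E) ∞ G] {γ₀ : G} {z : E}
    (hz : z ∈ (extChartAt 𝓘(ℝ, E) γ₀).target) :
    ContMDiffAt 𝓘(ℝ, E) 𝓘(ℝ, E) ∞ (extChartAt 𝓘(ℝ, E) γ₀).symm z :=
  (contMDiffOn_extChartAt_symm γ₀).contMDiffAt ((isOpen_extChartAt_target γ₀).mem_nhds hz)

variable [Group G]

lemma mfderiv_eq_fderiv_lc {X : Type*} [NormedAddCommGroup X] [NormedSpace ℝ X]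
    {f : X → G} {x : X} (hf : MDifferentiableAt 𝓘(ℝ, X) 𝓘(ℝ, E) f x) (h1 : f x = 1) :
    (mfderiv 𝓘(ℝ, X) 𝓘(ℝ, E) f x : X →L[ℝ] E) = fderiv ℝ (fun y => lc E (f y)) x := by
  have h := mfderiv_eq_fderiv_extChartAt hf
  rw [h1] at h
  exact h

variable (E) in
/-- The left-invariant Maurer-Cartan form in the preferred chart at `γ₀`. -/
def maurerCartan (γ₀ : G) (z : E) : E →L[ℝ] E :=
  fderiv ℝ (fun z' => lc E (((extChartAt 𝓘(ℝ, E) γ₀).symm z)⁻¹ *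
    (extChartAt 𝓘(ℝ, E) γ₀).symm z')) z

variable [LieGroup 𝓘(ℝ, E) ∞ G]

lemma contDiffAt_lc_inv_mul {γ₀ : G} {z : E} (hz : z ∈ (extChartAt 𝓘(ℝ, E) γ₀).target) :
    ContDiffAt ℝ ∞ (fun p : E × E => lc E (((extChartAt 𝓘(ℝ, E) γ₀).symm p.1)⁻¹ *
      (extChartAt 𝓘(ℝ, E) γ₀).symm p.2)) (z, z) := by
  have e1 : ContMDiffAt 𝓘(ℝ, E × E) 𝓘(ℝ, E) ∞
      (fun q : E × E => (extChartAt 𝓘(ℝ, E) γ₀).symm q.1) (z, z) :=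
    ContMDiffAt.comp (g := (extChartAt 𝓘(ℝ, E) γ₀).symm) (z, z) (contMDiffAt_extChartAt_symm hz)
      contDiffAt_fst.contMDiffAt
  have e2 : ContMDiffAt 𝓘(ℝ, E × E) 𝓘(ℝ, E) ∞
      (fun q : E × E => (extChartAt 𝓘(ℝ, E) γ₀).symm q.2) (z, z) :=
    ContMDiffAt.comp (g := (extChartAt 𝓘(ℝ, E) γ₀).symm) (z, z) (contMDiffAt_extChartAt_symm hz)
      contDiffAt_snd.contMDiffAt
  exact contDiffAt_lc_comp (e1.inv.mul e2) (by simpa using one_mem_lsrc)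

lemma contDiffAt_maurerCartan {γ₀ : G} {z : E} (hz : z ∈ (extChartAt 𝓘(ℝ, E) γ₀).target) :
    ContDiffAt ℝ ∞ (maurerCartan E γ₀) z :=
  ContDiffAt.fderiv (f := fun z z' => lc E (((extChartAt 𝓘(ℝ, E) γ₀).symm z)⁻¹ *
    (extChartAt 𝓘(ℝ, E) γ₀).symm z')) (g := id) (contDiffAt_lc_inv_mul hz) contDiffAt_id le_rfl

lemma hasFDerivAt_maurerCartan {γ₀ : G} {z : E} (hz : z ∈ (extChartAt 𝓘(ℝ, E) γ₀).target) :
    HasFDerivAt (fun z' => lc E (((extChartAt 𝓘(ℝ, E) γ₀).symm z)⁻¹ *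
      (extChartAt 𝓘(ℝ, E) γ₀).symm z')) (maurerCartan E γ₀ z) z := by
  have h : ContDiffAt ℝ ∞ (fun z' => lc E (((extChartAt 𝓘(ℝ, E) γ₀).symm z)⁻¹ *
      (extChartAt 𝓘(ℝ, E) γ₀).symm z')) z :=
    ContDiffAt.comp (g := fun p : E × E => lc E (((extChartAt 𝓘(ℝ, E) γ₀).symm p.1)⁻¹ *
      (extChartAt 𝓘(ℝ, E) γ₀).symm p.2)) (f := fun z' => (z, z')) z (contDiffAt_lc_inv_mul hz)
      (contDiffAt_const.prodMk contDiffAt_id)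
  exact (h.differentiableAt (by simp)).hasFDerivAt

/-- Left translation y ↦ γ y, read in the charts at `1` and `γ₀`, is a local inverse of z' ↦ γ⁻¹z'.
This gives a right inverse of the derivative, which suffices in finite dimension. -/
lemma isInvertible_maurerCartan [FiniteDimensional ℝ E] {γ₀ : G} {z : E}
    (hz : z ∈ (extChartAt 𝓘(ℝ, E) γ₀).target) : (maurerCartan E γ₀ z).IsInvertible := by
  set φ := extChartAt 𝓘(ℝ, E) γ₀ with hφ
  have hs : φ.symm z ∈ φ.source := φ.map_target hz
  have hm : ContMDiffAt 𝓘(ℝ, E) 𝓘(ℝ, E) ∞ (fun y => φ.symm z * li G y) (lo E G) :=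
    contMDiffAt_const.mul contMDiffAt_li_lo
  have h0 : φ.symm z * li G (lo E G) = φ.symm z := by simp
  have h1 : ContMDiffAt 𝓘(ℝ, E) 𝓘(ℝ, E) ∞ (fun y => φ (φ.symm z * li G y)) (lo E G) := by
    refine ContMDiffAt.comp (g := φ) (lo E G) ?_ hm
    rw [h0]
    exact contMDiffAt_extChartAt' (by rwa [← extChartAt_source 𝓘(ℝ, E)])
  have h2 := ((contMDiffAt_iff_contDiffAt.1 h1).differentiableAt (by simp)).hasFDerivAt
  have h3 : HasFDerivAt (fun z' => lc E ((φ.symm z)⁻¹ * φ.symm z')) (maurerCartan E γ₀ z)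
      (φ (φ.symm z * li G (lo E G))) := by
    rw [h0, φ.right_inv hz]
    exact hasFDerivAt_maurerCartan hz
  have h4 := h3.comp (lo E G) h2
  have hev : ∀ᶠ y in 𝓝 (lo E G), φ.symm z * li G y ∈ φ.source :=
    hm.continuousAt.eventually ((isOpen_extChartAt_source γ₀).mem_nhds
      (by simpa only [h0] using hs))
  have h5 : (fun z' => lc E ((φ.symm z)⁻¹ * φ.symm z')) ∘ (fun y => φ (φ.symm z * li G y))
      =ᶠ[𝓝 (lo E G)] id := by
    filter_upwards [hev, eventually_mem_ltgt (E := E) (G := G)] with y hy hy'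
    simp only [Function.comp_apply, φ.left_inv hy, inv_mul_cancel_left, lc_li hy', id]
  have h6 := h4.unique ((hasFDerivAt_id _).congr_of_eventuallyEq h5)
  have hsurj : Function.Surjective (maurerCartan E γ₀ z : E →ₗ[ℝ] E) := fun x =>
    ⟨_, DFunLike.congr_fun h6 x⟩
  have hinj := LinearMap.injective_iff_surjective.2 hsurj
  exact ⟨(LinearEquiv.ofInjectiveEndo _ hinj).toContinuousLinearEquiv, by ext; rfl⟩

lemma fibCoord_toCotangent (B : AdInvariantInner E G) {γ₀ γ : G} (h : γ ∈ (chartAt E γ₀).source)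
    (ξ : E) : fibCoord γ₀ (toCotangent B γ ξ) =
      (1 / 2 : ℝ) • (B.form ξ).comp (maurerCartan E γ₀ (extChartAt 𝓘(ℝ, E) γ₀ γ)) := by
  set φ := extChartAt 𝓘(ℝ, E) γ₀ with hφ
  have hs : γ ∈ φ.source := by rwa [hφ, extChartAt_source]
  have hz : φ γ ∈ φ.target := φ.map_source hs
  have hinv : φ.symm (φ γ) = γ := φ.left_inv hs
  have d1 : MDifferentiableAt 𝓘(ℝ, E) 𝓘(ℝ, E) φ.symm (φ γ) :=
    (contMDiffAt_extChartAt_symm hz).mdifferentiableAt (by simp)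
  have d2 : MDifferentiableAt 𝓘(ℝ, E) 𝓘(ℝ, E) (fun x : G => γ⁻¹ * x) (φ.symm (φ γ)) :=
    (contMDiffAt_const.mul contMDiffAt_id : ContMDiffAt 𝓘(ℝ, E) 𝓘(ℝ, E) ∞
      (fun x : G => γ⁻¹ * x) _).mdifferentiableAt (by simp)
  have e1 := mfderiv_comp (φ γ) d2 d1
  have e2 := mfderiv_eq_fderiv_lc (d2.comp (φ γ) d1) (by simp [hinv])
  have e3 : (mfderiv 𝓘(ℝ, E) 𝓘(ℝ, E) (fun x : G => γ⁻¹ * x) γ : E →L[ℝ] E) ∘L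
      (mfderiv 𝓘(ℝ, E) 𝓘(ℝ, E) φ.symm (φ γ) : E →L[ℝ] E) = maurerCartan E γ₀ (φ γ) := by
    rw [maurerCartan, ← hφ, hinv]
    refine Eq.trans ?_ e2
    refine Eq.trans ?_ e1.symm
    rw [hinv]
  rw [← e3]
  rfl

lemma toCotangent_injective [FiniteDimensional ℝ E] (B : AdInvariantInner E G) {γ γ' : G}
    {ξ ξ' : E} (h : toCotangent B γ ξ = toCotangent B γ' ξ') : γ = γ' ∧ ξ = ξ' := by
  have h1 : γ = γ' := congrArg (fun p : Cotangent E G => p.1) h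
  subst h1
  refine ⟨rfl, ?_⟩
  have hm : γ ∈ (chartAt E γ).source := mem_chart_source E γ
  have h2 := congrArg (fibCoord γ) h
  rw [fibCoord_toCotangent B hm, fibCoord_toCotangent B hm] at h2
  have h3 := smul_right_injective _ (show (1 / 2 : ℝ) ≠ 0 by norm_num) h2
  obtain ⟨e, he⟩ := isInvertible_maurerCartan (mem_extChartAt_target (I := 𝓘(ℝ, E)) γ)
  rw [← he] at h3
  have h4 : ∀ y, B.form ξ y = B.form ξ' y := fun y => by
    simpa using DFunLike.congr_fun h3 (e.symm y)
  refine sub_eq_zero.1 (B.eq_zero ?_)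
  rw [(B.form).map_sub, sub_apply, h4, sub_self]

lemma contMDiffAt_extChartAt_comp {X H M : Type*} [NormedAddCommGroup X] [NormedSpace ℝ X]
    [TopologicalSpace H] {I : ModelWithCorners ℝ X H} [TopologicalSpace M] [ChartedSpace H M]
    {γ : M → G} {x : M} {γ₀ : G} (hγ : ContMDiffAt I 𝓘(ℝ, E) ∞ γ x)
    (h : γ x ∈ (chartAt E γ₀).source) :
    ContMDiffAt I 𝓘(ℝ, E) ∞ (fun y => extChartAt 𝓘(ℝ, E) γ₀ (γ y)) x :=
  ContMDiffAt.comp (g := extChartAt 𝓘(ℝ, E) γ₀) x (contMDiffAt_extChartAt' h) hγ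

lemma contMDiffAt_maurerCartan_comp {X H M : Type*} [NormedAddCommGroup X] [NormedSpace ℝ X]
    [TopologicalSpace H] {I : ModelWithCorners ℝ X H} [TopologicalSpace M] [ChartedSpace H M]
    {γ : M → G} {x : M} {γ₀ : G} (hγ : ContMDiffAt I 𝓘(ℝ, E) ∞ γ x)
    (h : γ x ∈ (chartAt E γ₀).source) : ContMDiffAt I 𝓘(ℝ, E →L[ℝ] E) ∞
      (fun y => maurerCartan E γ₀ (extChartAt 𝓘(ℝ, E) γ₀ (γ y))) x :=
  ContMDiffAt.comp (g := maurerCartan E γ₀) x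
    (contDiffAt_maurerCartan ((extChartAt 𝓘(ℝ, E) γ₀).map_source
      (by rwa [extChartAt_source]))).contMDiffAt (contMDiffAt_extChartAt_comp hγ h)

lemma contMDiffAt_toCotangent (B : AdInvariantInner E G) {X H M : Type*} [NormedAddCommGroup X]
    [NormedSpace ℝ X] [TopologicalSpace H] {I : ModelWithCorners ℝ X H} [TopologicalSpace M]
    [ChartedSpace H M] {γ : M → G} {ξ : M → E} {x : M} (hγ : ContMDiffAt I 𝓘(ℝ, E) ∞ γ x)
    (hξ : ContMDiffAt I 𝓘(ℝ, E) ∞ ξ x) :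
    ContMDiffAt I (cotangentModel E) ∞ (fun y => toCotangent B (γ y) (ξ y)) x := by
  refine contMDiffAt_cotangent hγ ?_
  have hm : γ x ∈ (chartAt E (γ x)).source := mem_chart_source E (γ x)
  have h1 : ContMDiffAt I 𝓘(ℝ, E →L[ℝ] ℝ) ∞ (fun y => (1 / 2 : ℝ) • (B.form (ξ y)).comp
      (maurerCartan E (γ x) (extChartAt 𝓘(ℝ, E) (γ x) (γ y)))) x :=
    ContMDiffAt.clm_comp (g := fun y => ((1 / 2 : ℝ) • B.form) (ξ y)) (ContMDiffAt.comp
      (g := ((1 / 2 : ℝ) • B.form)) x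
      ((1 / 2 : ℝ) • B.form).contDiff.contDiffAt.contMDiffAt hξ)
      (contMDiffAt_maurerCartan_comp hγ hm)
  refine h1.congr_of_eventuallyEq ?_
  filter_upwards [hγ.continuousAt.eventually ((chartAt E (γ x)).open_source.mem_nhds hm)] with y hy
  exact fibCoord_toCotangent B hy (ξ y)

lemma exists_form_equiv [FiniteDimensional ℝ E] (B : AdInvariantInner E G) :
    ∃ e : E ≃L[ℝ] (E →L[ℝ] ℝ), ∀ x, e x = B.form x := by
  have hinj : Function.Injective (B.form : E →ₗ[ℝ] (E →L[ℝ] ℝ)) := by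
    rw [← LinearMap.ker_eq_bot, LinearMap.ker_eq_bot']
    intro x hx
    refine B.eq_zero (le_of_eq ?_)
    have : B.form x = 0 := hx
    rw [this, zero_apply]
  have hfr : Module.finrank ℝ E = Module.finrank ℝ (E →L[ℝ] ℝ) :=
    (Subspace.dual_finrank_eq (K := ℝ) (V := E)).symm.trans
      (LinearMap.toContinuousLinearMap (𝕜 := ℝ) (E := E) (F' := ℝ)).finrank_eq
  exact ⟨(LinearMap.linearEquivOfInjective _ hinj hfr).toContinuousLinearEquiv, fun x => rfl⟩

/-- `toCotangent` has smooth local inverses. -/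
lemma exists_toCotangent_eq [FiniteDimensional ℝ E] (B : AdInvariantInner E G)
    (p₀ : Cotangent E G) : ∃ ξ : Cotangent E G → E,
      ContMDiffAt (cotangentModel E) 𝓘(ℝ, E) ∞ ξ p₀ ∧
      ∀ᶠ q in 𝓝 p₀, toCotangent B q.1 (ξ q) = q := by
  have := FiniteDimensional.complete ℝ E
  obtain ⟨e, he⟩ := exists_form_equiv B
  have hm : p₀.1 ∈ (chartAt E p₀.1).source := mem_chart_source E p₀.1
  have hpr : ContMDiffAt (cotangentModel E) 𝓘(ℝ, E) ∞ (fun q : Cotangent E G => q.1) p₀ :=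
    contMDiff_proj _ p₀
  -- `fibCoord_toCotangent` is solved for ξ: compose with the inverse Maurer-Cartan form, apply the
  -- inverse of the inner product and cancel the factor 1/2.
  refine ⟨fun q => (2 : ℝ) • e.symm ((fibCoord p₀.1 q).comp
    (maurerCartan E p₀.1 (extChartAt 𝓘(ℝ, E) p₀.1 q.1)).inverse), ?_, ?_⟩
  · have h1 : ContMDiffAt (cotangentModel E) 𝓘(ℝ, E →L[ℝ] E) ∞ (fun q : Cotangent E G =>
        (maurerCartan E p₀.1 (extChartAt 𝓘(ℝ, E) p₀.1 q.1)).inverse) p₀ := by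
      obtain ⟨m, hmc⟩ := isInvertible_maurerCartan (mem_extChartAt_target (I := 𝓘(ℝ, E)) p₀.1)
      refine ContMDiffAt.comp (g := ContinuousLinearMap.inverse) p₀ ?_
        (contMDiffAt_maurerCartan_comp hpr hm)
      rw [← hmc]
      exact (contDiffAt_map_inverse m).contMDiffAt
    have h2 := (contMDiffAt_fibCoord p₀ hm).clm_comp h1
    exact ContMDiffAt.comp (g := (2 : ℝ) • (e.symm : (E →L[ℝ] ℝ) →L[ℝ] E)) p₀
      ((2 : ℝ) • (e.symm : (E →L[ℝ] ℝ) →L[ℝ] E)).contDiff.contDiffAt.contMDiffAt h2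
  · filter_upwards [hpr.continuousAt.eventually ((chartAt E p₀.1).open_source.mem_nhds hm)]
      with q hq
    have hq1 : (toCotangent B q.1 ((2 : ℝ) • e.symm ((fibCoord p₀.1 q).comp
      (maurerCartan E p₀.1 (extChartAt 𝓘(ℝ, E) p₀.1 q.1)).inverse))).1 ∈ (chartAt E p₀.1).source := hq
    refine (extChartAt (cotangentModel E) p₀).injOn
      ((mem_extChartAt_cotangent_source p₀ _).2 hq1) ((mem_extChartAt_cotangent_source p₀ q).2 hq) ?_
    rw [extChartAt_cotangent p₀ hq1, extChartAt_cotangent p₀ hq]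
    refine Prod.ext rfl ?_
    change fibCoord p₀.1 _ = fibCoord p₀.1 q
    rw [fibCoord_toCotangent B hq, ← he, map_smul, e.apply_symm_apply]
    obtain ⟨m, hmc⟩ := isInvertible_maurerCartan ((extChartAt 𝓘(ℝ, E) p₀.1).map_source
      (show q.1 ∈ _ by rwa [extChartAt_source]))
    rw [← hmc, ContinuousLinearMap.inverse_equiv]
    ext v
    simp

end ToCotangent

/-! ### Pulling back the canonical form through the left trivialisation. -/

section PullbackForm

universe u v

variable {E : Type u} [NormedAddCommGroup E] [NormedSpace ℝ E]
  {G : Type v} [TopologicalSpace G] [ChartedSpace E G] [Group G] [LieGroup 𝓘(ℝ, E) ∞ G]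

lemma fderiv_lc_inv_mul {X : Type*} [NormedAddCommGroup X] [NormedSpace ℝ X] {γ : X → G} {x : X}
    (hγ : ContMDiffAt 𝓘(ℝ, X) 𝓘(ℝ, E) ∞ γ x) {γ₀ : G} (h : γ x ∈ (chartAt E γ₀).source) :
    fderiv ℝ (fun y => lc E ((γ x)⁻¹ * γ y)) x =
      (maurerCartan E γ₀ (extChartAt 𝓘(ℝ, E) γ₀ (γ x))).comp
        (fderiv ℝ (fun y => extChartAt 𝓘(ℝ, E) γ₀ (γ y)) x) := by
  set φ := extChartAt 𝓘(ℝ, E) γ₀ with hφ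
  have hs : γ x ∈ φ.source := by rwa [hφ, extChartAt_source]
  have h1 := hasFDerivAt_maurerCartan (φ.map_source hs)
  have h2 := ((contMDiffAt_iff_contDiffAt.1
    (contMDiffAt_extChartAt_comp hγ h)).differentiableAt (by simp)).hasFDerivAt
  have h3 := HasFDerivAt.comp (f := fun y => φ (γ y)) x h1 h2
  refine (h3.congr_of_eventuallyEq ?_).fderiv
  filter_upwards [hγ.continuousAt.eventually ((isOpen_extChartAt_source γ₀).mem_nhds hs)] with y hy
  simp only [Function.comp_apply]
  rw [φ.left_inv hs, φ.left_inv hy]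

/-- The pull-back of the canonical symplectic form by a map `y ↦ (γ(y), ξ(y)) ∈ G × 𝔤 ≅ T*G` in
terms of the 1-form `β = ⟨ξ, γ⁻¹dγ⟩`. -/
lemma omegaCot_mfderiv_toCotangent (B : AdInvariantInner E G) {X : Type*} [NormedAddCommGroup X]
    [NormedSpace ℝ X] {γ : X → G} {ξ : X → E} {x : X}
    (hγ : ContMDiff 𝓘(ℝ, X) 𝓘(ℝ, E) ∞ γ) (hξ : ContDiffAt ℝ ∞ ξ x)
    {β : X → (X →L[ℝ] ℝ)} {β' : X →L[ℝ] (X →L[ℝ] ℝ)}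
    (hβ : ∀ᶠ y in 𝓝 x, β y = (B.form (ξ y)).comp (fderiv ℝ (fun y' => lc E ((γ y)⁻¹ * γ y')) y))
    (hβ' : HasFDerivAt β β' x) (v w : X) :
    omegaCot E G (toCotangent B (γ x) (ξ x))
      (mfderiv 𝓘(ℝ, X) (cotangentModel E) (fun y => toCotangent B (γ y) (ξ y)) x v)
      (mfderiv 𝓘(ℝ, X) (cotangentModel E) (fun y => toCotangent B (γ y) (ξ y)) x w) =
    -(1 / 2) * (β' v w - β' w v) := by
  have hm : γ x ∈ (chartAt E (γ x)).source := mem_chart_source E (γ x)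
  set z : X → E := fun y => extChartAt 𝓘(ℝ, E) (γ x) (γ y) with hz
  set η : X → (E →L[ℝ] ℝ) := fun y => fibCoord (γ x) (toCotangent B (γ y) (ξ y)) with hη
  have hK := contMDiffAt_toCotangent B (hγ x) hξ.contMDiffAt
  have dz : ContDiffAt ℝ ∞ z x := contMDiffAt_iff_contDiffAt.1 (contMDiffAt_extChartAt_comp (hγ x) hm)
  have dη : ContDiffAt ℝ ∞ η x := contMDiffAt_iff_contDiffAt.1
    (ContMDiffAt.comp (g := fibCoord (γ x)) x (contMDiffAt_fibCoord (toCotangent B (γ x) (ξ x)) hm)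
      hK)
  have hsrc : ∀ᶠ y in 𝓝 x, γ y ∈ (chartAt E (γ x)).source :=
    (hγ x).continuousAt.eventually ((chartAt E (γ x)).open_source.mem_nhds hm)
  have hder : mfderiv 𝓘(ℝ, X) (cotangentModel E) (fun y => toCotangent B (γ y) (ξ y)) x =
      (fderiv ℝ z x).prod (fderiv ℝ η x) := by
    rw [mfderiv_eq_fderiv_extChartAt (hK.mdifferentiableAt (by simp))]
    have h1 : (fun y => extChartAt (cotangentModel E) (toCotangent B (γ x) (ξ x))
        (toCotangent B (γ y) (ξ y))) =ᶠ[𝓝 x] fun y => (z y, η y) := by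
      filter_upwards [hsrc] with y hy
      exact extChartAt_cotangent (toCotangent B (γ x) (ξ x)) (p := toCotangent B (γ y) (ξ y)) hy
    rw [h1.fderiv_eq]
    exact DifferentiableAt.fderiv_prodMk (dz.differentiableAt (by simp))
      (dη.differentiableAt (by simp))
  -- In the coordinates (z, η) of the cotangent bundle β is 2η dz, the factor 2 undoing the 1/2 in
  -- `toCotangent`.
  have hβz : β =ᶠ[𝓝 x] fun y => ((2 : ℝ) • η y).comp (fderiv ℝ z y) := by
    filter_upwards [hβ, hsrc] with y hy hy'
    rw [hy, fderiv_lc_inv_mul (hγ y) hy', hη]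
    simp only
    rw [fibCoord_toCotangent B hy', smul_smul, mul_one_div_cancel two_ne_zero, one_smul]
    rfl
  have dDz : HasFDerivAt (fderiv ℝ z) (fderiv ℝ (fderiv ℝ z) x) x :=
    ((dz.fderiv_right (m := 1) (by simpa [one_add_one_eq_two] using two_le_smooth)).differentiableAt (by simp)).hasFDerivAt
  have h2 := (((dη.differentiableAt (by simp)).hasFDerivAt.const_smul (2 : ℝ)).clm_comp
    dDz).congr_of_eventuallyEq hβz
  rw [hβ'.unique h2]
  refine (omegaCot_apply (E := E) (G := G) _ _ _).trans ?_
  rw [hder]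
  -- The second derivatives of z cancel by symmetry, leaving dη ∧ dz.
  have hsymm := (dz.isSymmSndFDerivAt (by simp [two_le_smooth])).eq v w
  change fderiv ℝ η x w (fderiv ℝ z x v) - fderiv ℝ η x v (fderiv ℝ z x w) =
    -(1 / 2) * ((2 * η x (fderiv ℝ (fderiv ℝ z) x v w) + 2 * fderiv ℝ η x v (fderiv ℝ z x w)) -
      (2 * η x (fderiv ℝ (fderiv ℝ z) x w v) + 2 * fderiv ℝ η x w (fderiv ℝ z x v)))
  rw [hsymm]
  ring

end PullbackForm

/-! ### The pulled-back form when the group element is a holonomy. -/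

section HolonomyForm

universe u v w

variable {E : Type u} [NormedAddCommGroup E] [NormedSpace ℝ E] [FiniteDimensional ℝ E]
  {G : Type v} [TopologicalSpace G] [ChartedSpace E G] [Group G] [LieGroup 𝓘(ℝ, E) ∞ G]
  [CompactSpace G]

lemma apply_intOp [CompleteSpace E] (l : E →L[ℝ] ℝ) (f : C(unitInterval, E)) (t : unitInterval) :
    l (intOp f t) = intOp (bilinOp (ContinuousLinearMap.id ℝ (E →L[ℝ] ℝ)) (constOp _ l) f) t := by
  rw [intOp_apply, intOp_apply, ← l.intervalIntegral_comp_comm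
    ((continuous_ext01 f).intervalIntegrable _ _)]
  rfl

variable (G) in
/-- The solution of `ḃ = [a, b]`, `b(0) = ξ`. -/
def transportPath (a : C(unitInterval, E)) (ξ : E) : C(unitInterval, E) :=
  applyOp (AdDev G a) (constOp E ξ)

lemma hasDerivPath_transportPath (a : C(unitInterval, E)) (ξ : E) :
    HasDerivPath (transportPath G a ξ) (bilinOp (ad E G) a (transportPath G a ξ)) := by
  have h := hasDerivPath_AdDev_apply (G := G) a (hasDerivPath_const ξ)
  rwa [(applyOp (AdDev G a)).map_zero, add_zero] at h

lemma transportPath_zero (a : C(unitInterval, E)) (ξ : E) : transportPath G a ξ 0 = ξ :=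
  AdDev_apply_zero a _

lemma eq_transportPath {a b : C(unitInterval, E)} (h : HasDerivPath b (bilinOp (ad E G) a b)) :
    b = transportPath G a (b 0) := by
  have := FiniteDimensional.complete ℝ E
  refine h.eq_of_linear (hasDerivPath_transportPath a (b 0)) (transportPath_zero a _).symm
    (superpose (ad E G) (ad E G).continuous a) fun t => ?_
  exact ((ad E G (a t)).map_sub _ _).symm

set_option synthInstance.maxHeartbeats 200000 in
lemma contDiff_transportPath :
    ContDiff ℝ ∞ (fun p : C(unitInterval, E) × E => transportPath G p.1 p.2) :=
  (ContDiff.clm_apply (f := fun p : C(unitInterval, E) × E => applyOp (AdDev G p.1))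
    ((applyOp (F := E) (F' := E)).contDiff.comp ((contDiff_AdDev E G).comp contDiff_fst))
    ((constOp E).contDiff.comp contDiff_snd))

lemma hasDerivPath_fderiv_transportPath (p v : C(unitInterval, E) × E) :
    HasDerivPath (fderiv ℝ (fun p : C(unitInterval, E) × E => transportPath G p.1 p.2) p v)
      (bilinOp (ad E G) p.1
        (fderiv ℝ (fun p : C(unitInterval, E) × E => transportPath G p.1 p.2) p v) +
        bilinOp (ad E G) v.1 (transportPath G p.1 p.2)) := by
  have := FiniteDimensional.complete ℝ E
  have hd := ((contDiff_transportPath (E := E) (G := G)).differentiable (by simp) p).hasFDerivAt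
  set D := fderiv ℝ (fun p : C(unitInterval, E) × E => transportPath G p.1 p.2) p with hD
  have h1 := (bilinOp (ad E G)).hasFDerivAt_of_bilinear (hasFDerivAt_fst (𝕜 := ℝ) (p := p)) hd
  have h2 := ((constOp E).hasFDerivAt.comp p hasFDerivAt_snd).add (intOp.hasFDerivAt.comp p h1)
  have h3 : (fun p : C(unitInterval, E) × E => transportPath G p.1 p.2) =
      fun p => constOp E p.2 + intOp (bilinOp (ad E G) p.1 (transportPath G p.1 p.2)) := by
    funext q
    have h := (hasDerivPath_transportPath (G := G) q.1 q.2).eq_add_intOp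
    rwa [transportPath_zero] at h
  have h4 := DFunLike.congr_fun ((h3 ▸ hd).unique h2) v
  exact hasDerivPath_of_eq h4

lemma fderiv_transportPath_eq {p v : C(unitInterval, E) × E} {b : C(unitInterval, E)}
    (hb : HasDerivPath b (bilinOp (ad E G) p.1 b + bilinOp (ad E G) v.1 (transportPath G p.1 p.2)))
    (h0 : b 0 = v.2) :
    fderiv ℝ (fun p : C(unitInterval, E) × E => transportPath G p.1 p.2) p v = b := by
  have := FiniteDimensional.complete ℝ E
  refine (hasDerivPath_fderiv_transportPath p v).eq_of_linear hb ?_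
    (superpose (ad E G) (ad E G).continuous p.1) fun t => ?_
  · have hd := ((contDiff_transportPath (E := E) (G := G)).differentiable (by simp) p).hasFDerivAt
    have h1 := HasFDerivAt.comp
      (g := (ContinuousMap.evalCLM ℝ (0 : unitInterval) : C(unitInterval, E) →L[ℝ] E)) p
      (ContinuousMap.evalCLM ℝ (0 : unitInterval) : C(unitInterval, E) →L[ℝ] E).hasFDerivAt hd
    have h2 : HasFDerivAt (Prod.snd : C(unitInterval, E) × E → E)
      (ContinuousMap.evalCLM ℝ (0 : unitInterval) ∘L
        fderiv ℝ (fun p : C(unitInterval, E) × E => transportPath G p.1 p.2) p) p :=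
      h1.congr_of_eventuallyEq (Eventually.of_forall fun q => (transportPath_zero q.1 q.2).symm)
    exact (DFunLike.congr_fun (h2.unique hasFDerivAt_snd) v).trans h0.symm
  · change ad E G (p.1 t) _ + ad E G (v.1 t) _ - (ad E G (p.1 t) _ + ad E G (v.1 t) _) = _
    rw [add_sub_add_right_eq_sub]
    exact ((ad E G (p.1 t)).map_sub _ _).symm

/-- The pairing `∫₀¹ ⟨b, a⟩`. -/
def AdInvariantInner.pairing (B : AdInvariantInner E G) :
    C(unitInterval, E) →L[ℝ] (C(unitInterval, E) →L[ℝ] ℝ) :=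
  ContinuousLinearMap.compL ℝ _ _ ℝ
    (ContinuousMap.evalCLM ℝ (1 : unitInterval) ∘L (intOp : C(unitInterval, ℝ) →L[ℝ] _)) ∘L
    bilinOp B.form

lemma AdInvariantInner.pairing_apply (B : AdInvariantInner E G) (b a : C(unitInterval, E)) :
    B.pairing b a = intOp (bilinOp B.form b a) 1 := rfl

/-- Invariance moves Ad(u)⁻¹ from the variation onto ξ, where it becomes the transported path
Ad(u)ξ. -/
lemma form_evalCLM_intOp (B : AdInvariantInner E G) (a c : C(unitInterval, E)) (ξ : E) :
    B.form ξ (intOp (applyOp (AdDevInv G a) c) 1) = B.pairing (transportPath G a ξ) c := by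
  have := FiniteDimensional.complete ℝ E
  rw [apply_intOp, AdInvariantInner.pairing_apply]
  congr 2
  ext t
  change B.form ξ (Ad (dev G a t)⁻¹ (c t)) = B.form (Ad (dev G a t) ξ) (c t)
  rw [← B.invariant (dev G a t), Ad_Ad_inv]

/-- As `a` is linear, differentiating the one-form only differentiates the coefficient `f`. -/
lemma exists_hasFDerivAt_comp_clm {X F F' : Type*} [NormedAddCommGroup X] [NormedSpace ℝ X]
    [NormedAddCommGroup F] [NormedSpace ℝ F] [NormedAddCommGroup F'] [NormedSpace ℝ F']
    (Λ : F →L[ℝ] (F' →L[ℝ] ℝ)) (a : X →L[ℝ] F') {f : X → F} {f' : X →L[ℝ] F} {x : X}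
    (h : HasFDerivAt f f' x) : ∃ L : X →L[ℝ] (X →L[ℝ] ℝ),
      HasFDerivAt (fun y => (Λ (f y)).comp a) L x ∧ ∀ v w, L v w = Λ (f' v) (a w) :=
  ⟨((ContinuousLinearMap.compL ℝ X F' ℝ).flip a ∘L Λ) ∘L f',
    HasFDerivAt.comp (g := ((ContinuousLinearMap.compL ℝ X F' ℝ).flip a ∘L Λ)) x
      (ContinuousLinearMap.hasFDerivAt _) h, fun _ _ => rfl⟩

/-- γ⁻¹dγ applied to a variation is the integral of its conjugate by Ad(u)⁻¹, so ⟨ξ, γ⁻¹dγ⟩ becomes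
∫⟨b, da⟩ with b the transport of ξ. -/
lemma pairing_comp_eq_form_comp (B : AdInvariantInner E G) {X : Type w} [NormedAddCommGroup X]
    [NormedSpace ℝ X] (a : X →L[ℝ] C(unitInterval, E)) (ξ : E) (y : X) :
    (B.pairing (transportPath G (a y) ξ)).comp a =
      (B.form ξ).comp (fderiv ℝ (fun y' => lc E ((hol G (a y))⁻¹ * hol G (a y'))) y) := by
  have h3 := HasFDerivAt.comp (g := fun c => lc E ((hol G (a y))⁻¹ * hol G c)) y
    (hasFDerivAt_lc_hol (a y)) a.hasFDerivAt
  have h4 := h3.fderiv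
  rw [Function.comp_def] at h4
  rw [h4]
  ext c
  exact (form_evalCLM_intOp B (a y) (a c) ξ).symm

lemma hasFDerivAt_comp_prod {X F F' F'' : Type*} [NormedAddCommGroup X] [NormedSpace ℝ X]
    [NormedAddCommGroup F] [NormedSpace ℝ F] [NormedAddCommGroup F'] [NormedSpace ℝ F']
    [NormedAddCommGroup F''] [NormedSpace ℝ F''] (a : X →L[ℝ] F) (e : X →L[ℝ] F')
    {f : F × F' → F''} {f' : F × F' →L[ℝ] F''} {x : X} (h : HasFDerivAt f f' (a x, e x)) :
    HasFDerivAt (fun y => f (a y, e y)) (f' ∘L a.prod e) x :=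
  HasFDerivAt.comp x h (a.prod e).hasFDerivAt

/-- The pull-back of the canonical symplectic form by `y ↦ (hol(a(y)), e(y))`, evaluated on
variations for which the transported path of `e(y)` is known. -/
theorem omegaCot_mfderiv_hol (B : AdInvariantInner E G) {X : Type w} [NormedAddCommGroup X]
    [NormedSpace ℝ X] (a : X →L[ℝ] C(unitInterval, E)) (e : X →L[ℝ] E) {x v w : X}
    {b bv bw : C(unitInterval, E)} (hb : HasDerivPath b (bilinOp (ad E G) (a x) b)) (h0 : b 0 = e x)
    (hv : HasDerivPath bv (bilinOp (ad E G) (a x) bv + bilinOp (ad E G) (a v) b)) (hv0 : bv 0 = e v)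
    (hw : HasDerivPath bw (bilinOp (ad E G) (a x) bw + bilinOp (ad E G) (a w) b))
    (hw0 : bw 0 = e w) :
    omegaCot E G (toCotangent B (hol G (a x)) (e x))
      (mfderiv 𝓘(ℝ, X) (cotangentModel E) (fun y => toCotangent B (hol G (a y)) (e y)) x v)
      (mfderiv 𝓘(ℝ, X) (cotangentModel E) (fun y => toCotangent B (hol G (a y)) (e y)) x w) =
    -(1 / 2) * (B.pairing bv (a w) - B.pairing bw (a v)) := by
  have hγ : ContMDiff 𝓘(ℝ, X) 𝓘(ℝ, E) ∞ (fun y => hol G (a y)) :=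
    (contMDiff_hol E G).comp a.contDiff.contMDiff
  have ht := eq_transportPath hb
  rw [h0] at ht
  rw [ht] at hv hw
  have h1 := hasFDerivAt_comp_prod a e
    ((contDiff_transportPath (E := E) (G := G)).differentiable (by simp) (a x, e x)).hasFDerivAt
  obtain ⟨L, hL, hLvw⟩ := exists_hasFDerivAt_comp_clm B.pairing a h1
  have h2 := omegaCot_mfderiv_toCotangent B hγ e.contDiff.contDiffAt
    (Eventually.of_forall fun y => pairing_comp_eq_form_comp B a (e y) y) hL v w
  beta_reduce at h2
  refine h2.trans ?_
  rw [hLvw, hLvw]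
  have e1 := fderiv_transportPath_eq (p := (a x, e x)) (v := (a v, e v)) hv hv0
  have e2 := fderiv_transportPath_eq (p := (a x, e x)) (v := (a w, e w)) hw hw0
  rw [ContinuousLinearMap.comp_apply, ContinuousLinearMap.comp_apply,
    ContinuousLinearMap.prod_apply, ContinuousLinearMap.prod_apply, e1, e2]

end HolonomyForm

/-! ## The two components of the map to `T*G × T*G` -/

section HalfMap

universe u v

variable (E : Type u) [NormedAddCommGroup E] [NormedSpace ℝ E]

/-- The path `-(T₀ + s T₂)`. -/
def connPath (s : ℝ) : Config E →L[ℝ] C(unitInterval, E) :=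
  -(C1Path.val E ∘L (ContinuousLinearMap.proj 0 + s • ContinuousLinearMap.proj 2))

/-- The path `T₁ + s T₃`. -/
def fieldPath (s : ℝ) : Config E →L[ℝ] C(unitInterval, E) :=
  C1Path.val E ∘L (ContinuousLinearMap.proj 1 + s • ContinuousLinearMap.proj 3)

/-- The initial value of `T₁ + s T₃`. -/
def fieldInit (s : ℝ) : Config E →L[ℝ] E :=
  ContinuousMap.evalCLM ℝ (0 : unitInterval) ∘L fieldPath E s

variable {E}

lemma connPath_apply (s : ℝ) (T : Config E) (t : unitInterval) :
    connPath E s T t = -(C1Path.val E (T 0) t + s • C1Path.val E (T 2) t) := by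
  change -(C1Path.val E (T 0 + s • T 2) t) = _
  rw [map_add, map_smul]
  rfl

lemma fieldPath_apply (s : ℝ) (T : Config E) (t : unitInterval) :
    fieldPath E s T t = C1Path.val E (T 1) t + s • C1Path.val E (T 3) t := by
  change C1Path.val E (T 1 + s • T 3) t = _
  rw [map_add, map_smul]
  rfl

lemma hasDerivPath_fieldPath (s : ℝ) (T : Config E) :
    HasDerivPath (fieldPath E s T) (C1Path.der E (T 1 + s • T 3)) :=
  (T 1 + s • T 3).hasDerivPath

lemma der_add_smul_apply (f g : C1Path E) (s : ℝ) (t : unitInterval) :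
    C1Path.der E (f + s • g) t = C1Path.der E f t + s • C1Path.der E g t := by
  rw [map_add, map_smul]
  rfl

lemma prodS_apply (X : Config E) :
    prodS X 0 = X 2 ∧ prodS X 1 = X 3 ∧ prodS X 2 = X 0 ∧ prodS X 3 = X 1 :=
  ⟨rfl, rfl, rfl, rfl⟩

lemma connPath_prodS {s : ℝ} (hs : s * s = 1) (X : Config E) :
    connPath E s (prodS X) = s • connPath E s X := by
  ext t
  rw [ContinuousMap.smul_apply, connPath_apply, connPath_apply, (prodS_apply X).1,
    (prodS_apply X).2.2.1, smul_neg, smul_add, smul_smul, hs, one_smul, add_comm]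

lemma fieldInit_prodS {s : ℝ} (hs : s * s = 1) (X : Config E) :
    fieldInit E s (prodS X) = s • fieldInit E s X := by
  change fieldPath E s (prodS X) 0 = s • fieldPath E s X 0
  rw [fieldPath_apply, fieldPath_apply, (prodS_apply X).2.1, (prodS_apply X).2.2.2, smul_add,
    smul_smul, hs, one_smul, add_comm]

variable {G : Type v} [TopologicalSpace G] [ChartedSpace E G] [Group G] [LieGroup 𝓘(ℝ, E) ∞ G]
  [FiniteDimensional ℝ E]

/-- Add `s` times the equation for T₃ to the equation for T₁. The relation s² = 1 makes the brackets
combine into one, and it treats both signs together. -/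
lemma hasDerivPath_fieldPath_of_mem_Sol {s : ℝ} (hs : s * s = 1) {T : Config E} (hT : T ∈ Sol E G) :
    HasDerivPath (fieldPath E s T) (bilinOp (ad E G) (connPath E s T) (fieldPath E s T)) := by
  have h : bilinOp (ad E G) (connPath E s T) (fieldPath E s T) = C1Path.der E (T 1 + s • T 3) := by
    ext t
    obtain ⟨h1, -, h3⟩ := hT t
    simp only [br_eq, ev_eq, dv_eq] at h1 h3
    rw [bilinOp_apply, connPath_apply, fieldPath_apply, der_add_smul_apply,
      eq_sub_of_add_eq h1, eq_sub_of_add_eq h3, ad_swap (C1Path.val E (T 1) t)]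
    simp only [map_neg, map_add, map_smul, neg_apply, add_apply, smul_apply]
    match_scalars <;> first | ring1 | linear_combination -hs
  rw [h]
  exact hasDerivPath_fieldPath s T

lemma hasDerivPath_fieldPath_of_mem_Horizontal {s : ℝ} (hs : s * s = 1) {T X : Config E}
    (hX : X ∈ Horizontal G T) : HasDerivPath (fieldPath E s X)
      (bilinOp (ad E G) (connPath E s T) (fieldPath E s X) +
        bilinOp (ad E G) (connPath E s X) (fieldPath E s T)) := by
  have h : bilinOp (ad E G) (connPath E s T) (fieldPath E s X) +
      bilinOp (ad E G) (connPath E s X) (fieldPath E s T) = C1Path.der E (X 1 + s • X 3) := by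
    ext t
    obtain ⟨h1, -, h3, -⟩ := hX t
    simp only [br_eq, ev_eq, dv_eq] at h1 h3
    rw [ad_swap (C1Path.val E (T 1) t), ad_swap (C1Path.val E (X 1) t)] at h3
    have h1' : C1Path.der E (X 1) t = -(ad E G (C1Path.val E (T 0) t) (C1Path.val E (X 1) t)
        + ad E G (C1Path.val E (X 0) t) (C1Path.val E (T 1) t)
        + ad E G (C1Path.val E (T 2) t) (C1Path.val E (X 3) t)
        + ad E G (C1Path.val E (X 2) t) (C1Path.val E (T 3) t)) := by
      rw [eq_neg_iff_add_eq_zero, ← h1]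
      abel
    have h3' : C1Path.der E (X 3) t = -(ad E G (C1Path.val E (T 0) t) (C1Path.val E (X 3) t)
        + ad E G (C1Path.val E (X 0) t) (C1Path.val E (T 3) t)
        + ad E G (C1Path.val E (X 2) t) (C1Path.val E (T 1) t)
        + ad E G (C1Path.val E (T 2) t) (C1Path.val E (X 1) t)) := by
      rw [eq_neg_iff_add_eq_zero, ← h3]
      abel
    rw [ContinuousMap.add_apply, bilinOp_apply, bilinOp_apply, connPath_apply, connPath_apply,
      fieldPath_apply, fieldPath_apply, der_add_smul_apply, h1', h3']
    simp only [map_neg, map_add, map_smul, neg_apply, add_apply, smul_apply]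
    match_scalars <;> first | ring1 | linear_combination -hs
  rw [h]
  exact hasDerivPath_fieldPath s X

/-- S exchanges the first equation with the third and the second with the fourth, by antisymmetry of
the bracket. -/
lemma prodS_mem_Horizontal {T X : Config E} (hX : X ∈ Horizontal G T) :
    prodS X ∈ Horizontal G T := by
  intro t
  obtain ⟨h1, h2, h3, h4⟩ := hX t
  simp only [br_eq, ev_eq, dv_eq] at h1 h2 h3 h4 ⊢
  obtain ⟨e0, e1, e2, e3⟩ := prodS_apply X
  rw [e0, e1, e2, e3]
  refine ⟨?_, ?_, ?_, ?_⟩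
  · rw [← h3, ad_swap (C1Path.val E (T 1) t), ad_swap (C1Path.val E (X 1) t)]
    abel
  · rw [← h4, ad_swap (C1Path.val E (T 1) t), ad_swap (C1Path.val E (T 2) t)]
    abel
  · rw [← h1, ad_swap (C1Path.val E (T 1) t), ad_swap (C1Path.val E (X 3) t)]
    abel
  · rw [← h2, ad_swap (C1Path.val E (T 1) t), ad_swap (C1Path.val E (T 2) t)]
    abel

variable [CompactSpace G]

/-- The point of `T*G` associated with `(T₀ + s T₂, T₁ + s T₃)`. -/
def halfMap (B : AdInvariantInner E G) (s : ℝ) (T : Config E) : Cotangent E G :=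
  toCotangent B (hol G (connPath E s T)) (fieldInit E s T)

lemma contMDiff_halfMap (B : AdInvariantInner E G) (s : ℝ) :
    ContMDiff 𝓘(ℝ, Config E) (cotangentModel E) ∞ (halfMap B s) := fun _ =>
  contMDiffAt_toCotangent B (((contMDiff_hol E G).comp (connPath E s).contDiff.contMDiff) _)
    (fieldInit E s).contDiff.contDiffAt.contMDiffAt

lemma omegaCot_mfderiv_halfMap (B : AdInvariantInner E G) {s : ℝ} (hs : s * s = 1) {T X Y : Config E}
    (hT : T ∈ Sol E G) (hX : X ∈ Horizontal G T) (hY : Y ∈ Horizontal G T) :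
    omegaCot E G (halfMap B s T)
      (mfderiv 𝓘(ℝ, Config E) (cotangentModel E) (halfMap B s) T X)
      (mfderiv 𝓘(ℝ, Config E) (cotangentModel E) (halfMap B s) T Y) =
    -(1 / 2) * (B.pairing (fieldPath E s X) (connPath E s Y) -
      B.pairing (fieldPath E s Y) (connPath E s X)) :=
  omegaCot_mfderiv_hol B (connPath E s) (fieldInit E s) (hasDerivPath_fieldPath_of_mem_Sol hs hT) rfl
    (hasDerivPath_fieldPath_of_mem_Horizontal hs hX) rfl
    (hasDerivPath_fieldPath_of_mem_Horizontal hs hY) rfl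

/-- The map factors through the linear map T ↦ (-(T₀ + sT₂), T₁(0) + sT₃(0)), on which S acts as
multiplication by `s`. -/
lemma mfderiv_halfMap_prodS (B : AdInvariantInner E G) {s : ℝ} (hs : s * s = 1) (T X : Config E) :
    (mfderiv 𝓘(ℝ, Config E) (cotangentModel E) (halfMap B s) T (prodS X) : E × (E →L[ℝ] ℝ)) =
      s • (mfderiv 𝓘(ℝ, Config E) (cotangentModel E) (halfMap B s) T X : E × (E →L[ℝ] ℝ)) := by
  set L : Config E →L[ℝ] C(unitInterval, E) × E := (connPath E s).prod (fieldInit E s) with hL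
  have h1 : ContMDiff 𝓘(ℝ, C(unitInterval, E) × E) (cotangentModel E) ∞
      (fun p : C(unitInterval, E) × E => toCotangent B (hol G p.1) p.2) := fun _ =>
    contMDiffAt_toCotangent B (((contMDiff_hol E G).comp contDiff_fst.contMDiff) _)
      contDiff_snd.contDiffAt.contMDiffAt
  have h2 := mfderiv_comp T (f := L) ((h1 (L T)).mdifferentiableAt (by simp))
    (L.contDiff.contMDiff.contMDiffAt (n := ∞) |>.mdifferentiableAt (by simp))
  have h3 : mfderiv 𝓘(ℝ, Config E) 𝓘(ℝ, C(unitInterval, E) × E) L T = L := by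
    rw [mfderiv_eq_fderiv, L.fderiv]
  have h4 : L (prodS X) = s • L X := Prod.ext (connPath_prodS hs X) (fieldInit_prodS hs X)
  let D : C(unitInterval, E) × E →L[ℝ] E × (E →L[ℝ] ℝ) :=
    mfderiv 𝓘(ℝ, C(unitInterval, E) × E) (cotangentModel E)
      (fun p : C(unitInterval, E) × E => toCotangent B (hol G p.1) p.2) (L T)
  have h5 : ∀ Y : Config E, (mfderiv 𝓘(ℝ, Config E) (cotangentModel E) (halfMap B s) T Y :
      E × (E →L[ℝ] ℝ)) = D (L Y) := fun Y => by
    refine (DFunLike.congr_fun h2 Y).trans ?_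
    rw [h3]
    rfl
  rw [h5, h5, h4]
  exact D.map_smul s (L X)

/-- The extension of `Φ` to all configurations. -/
def fullMap (B : AdInvariantInner E G) (T : Config E) : Cotangent E G × Cotangent E G :=
  (halfMap B 1 T, halfMap B (-1) T)

lemma contMDiff_fullMap (B : AdInvariantInner E G) :
    ContMDiff 𝓘(ℝ, Config E) (cotangentModel₂ E) ∞ (fullMap B) :=
  (contMDiff_halfMap B 1).prodMk (contMDiff_halfMap B (-1))

lemma mfderiv_fullMap_apply (B : AdInvariantInner E G) (T X : Config E) :
    mfderiv 𝓘(ℝ, Config E) (cotangentModel₂ E) (fullMap B) T X =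
      (mfderiv 𝓘(ℝ, Config E) (cotangentModel E) (halfMap B 1) T X,
        mfderiv 𝓘(ℝ, Config E) (cotangentModel E) (halfMap B (-1)) T X) :=
  DFunLike.congr_fun (mfderiv_prodMk ((contMDiff_halfMap B 1 T).mdifferentiableAt (by simp))
    ((contMDiff_halfMap B (-1) T).mdifferentiableAt (by simp))) X

/-- In the sum over s = ±1 the terms odd in `s` cancel and the even ones double, absorbing the
factor 1/2; what remains is ⟨X₁,Y₀⟩ - ⟨X₀,Y₁⟩ + ⟨X₃,Y₂⟩ - ⟨X₂,Y₃⟩ under the integral. -/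
lemma omegaCot₂_mfderiv_fullMap (B : AdInvariantInner E G) {T X Y : Config E}
    (hT : T ∈ Sol E G) (hX : X ∈ Horizontal G T) (hY : Y ∈ Horizontal G T) :
    omegaCot₂ E G (fullMap B T) (mfderiv 𝓘(ℝ, Config E) (cotangentModel₂ E) (fullMap B) T X)
      (mfderiv 𝓘(ℝ, Config E) (cotangentModel₂ E) (fullMap B) T Y) = omegaI B X Y := by
  have := FiniteDimensional.complete ℝ E
  rw [mfderiv_fullMap_apply, mfderiv_fullMap_apply]
  refine (congrArg₂ (· + ·) (omegaCot_mfderiv_halfMap B (one_mul 1) hT hX hY)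
    (omegaCot_mfderiv_halfMap B (by norm_num : (-1 : ℝ) * -1 = 1) hT hX hY)).trans ?_
  rw [omegaI, metric_eq]
  simp only [AdInvariantInner.pairing_apply]
  set p : ℝ → C(unitInterval, ℝ) := fun s => bilinOp B.form (fieldPath E s X) (connPath E s Y) with hp
  set q : ℝ → C(unitInterval, ℝ) := fun s => bilinOp B.form (fieldPath E s Y) (connPath E s X) with hq
  have hm : bilinOp B.form (C1Path.val E (cplxI X 0)) (C1Path.val E (Y 0)) +
      bilinOp B.form (C1Path.val E (cplxI X 1)) (C1Path.val E (Y 1)) -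
      bilinOp B.form (C1Path.val E (cplxI X 2)) (C1Path.val E (Y 2)) -
      bilinOp B.form (C1Path.val E (cplxI X 3)) (C1Path.val E (Y 3)) =
      (-(1 / 2) : ℝ) • (p 1 - q 1) + (-(1 / 2) : ℝ) • (p (-1) - q (-1)) := by
    ext t
    change B.form (C1Path.val E (X 1) t) (C1Path.val E (Y 0) t) +
      B.form (C1Path.val E (-X 0) t) (C1Path.val E (Y 1) t) -
      B.form (C1Path.val E (-X 3) t) (C1Path.val E (Y 2) t) -
      B.form (C1Path.val E (X 2) t) (C1Path.val E (Y 3) t) =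
      -(1 / 2) * (B.form (fieldPath E 1 X t) (connPath E 1 Y t) -
        B.form (fieldPath E 1 Y t) (connPath E 1 X t)) +
      -(1 / 2) * (B.form (fieldPath E (-1) X t) (connPath E (-1) Y t) -
        B.form (fieldPath E (-1) Y t) (connPath E (-1) X t))
    simp only [connPath_apply, fieldPath_apply, map_neg, map_add, map_smul, neg_apply, add_apply,
      smul_apply, ContinuousMap.neg_apply, smul_eq_mul]
    rw [B.symm (C1Path.val E (Y 1) t), B.symm (C1Path.val E (Y 1) t),
      B.symm (C1Path.val E (Y 3) t), B.symm (C1Path.val E (Y 3) t)]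
    ring
  rw [hm, map_add, map_smul, map_smul, map_sub, map_sub]
  rfl

lemma mfderiv_fullMap_prodS (B : AdInvariantInner E G) (T X : Config E) :
    mfderiv 𝓘(ℝ, Config E) (cotangentModel₂ E) (fullMap B) T (prodS X) =
      prodCot E G (fullMap B T) (mfderiv 𝓘(ℝ, Config E) (cotangentModel₂ E) (fullMap B) T X) := by
  rw [mfderiv_fullMap_apply, mfderiv_fullMap_apply, mfderiv_halfMap_prodS B (one_mul 1),
    mfderiv_halfMap_prodS B (by norm_num : (-1 : ℝ) * -1 = 1)]
  exact Prod.ext (one_smul ℝ _) (neg_one_smul ℝ _)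

end HalfMap

/-! ## The map `Φ` on the moduli space -/

section ModuliMap

universe u v

variable {E : Type u} [NormedAddCommGroup E] [NormedSpace ℝ E]
  {G : Type v} [TopologicalSpace G] [ChartedSpace E G] [Group G] [LieGroup 𝓘(ℝ, E) ∞ G]
  [FiniteDimensional ℝ E] [CompactSpace G]

lemma connPath_one (T : Config E) : connPath E 1 T = negA T := by
  ext t
  rw [connPath_apply, one_smul, negA, map_add]
  rfl

lemma connPath_neg_one (T : Config E) : connPath E (-1) T = -C1Path.val E (T 0 - T 2) := by
  ext t
  rw [connPath_apply, neg_one_smul, ← sub_eq_add_neg, map_sub]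
  rfl

lemma fieldInit_one (T : Config E) : fieldInit E 1 T = (relInit T).1 := by
  change fieldPath E 1 T 0 = C1Path.val E (T 1 + T 3) 0
  rw [fieldPath_apply, one_smul, map_add]
  rfl

lemma fieldInit_neg_one (T : Config E) : fieldInit E (-1) T = (relInit T).2.1 := by
  change fieldPath E (-1) T 0 = C1Path.val E (T 1 - T 3) 0
  rw [fieldPath_apply, neg_one_smul, ← sub_eq_add_neg, map_sub]
  rfl

lemma continuous_relInit : Continuous (relInit : Config E → E × E × E) := by
  have h : (relInit : Config E → E × E × E) = fun T => (fieldInit E 1 T, fieldInit E (-1) T,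
      (ContinuousMap.evalCLM ℝ (0 : unitInterval) ∘L C1Path.val E) ((2 : ℝ) • T 2)) := by
    funext T
    rw [fieldInit_one, fieldInit_neg_one]
    rfl
  rw [h]
  exact (fieldInit E 1).continuous.prodMk ((fieldInit E (-1)).continuous.prodMk
    ((ContinuousMap.evalCLM ℝ (0 : unitInterval) ∘L C1Path.val E).continuous.comp
      ((continuous_apply 2).const_smul (2 : ℝ))))

lemma fullMap_eq (B : AdInvariantInner E G) (T : Config E) : fullMap B T =
    (toCotangent B (hol G (negA T)) (relInit T).1,
      toCotangent B (hol G (-C1Path.val E (T 0 - T 2))) (relInit T).2.1) := by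
  rw [fullMap, halfMap, halfMap, connPath_one, connPath_neg_one, fieldInit_one, fieldInit_neg_one]

lemma isCotangentPoint_toCotangent (B : AdInvariantInner E G) (A F : C1Path E) :
    IsCotangentPoint B (A, F) (toCotangent B (hol G (-C1Path.val E A)) (ev F 0)) := by
  refine ⟨dev G (-C1Path.val E A), ⟨contMDiffOn_dev A.hasDerivPath.neg, dev_apply_zero _,
    fun t => ?_⟩, rfl⟩
  rw [((isDev_dev (G := G) (-C1Path.val E A)).vel t).logVel_eq t.2, ContinuousMap.neg_apply, neg_neg]
  rfl

/-- The map induced on the moduli space by `fullMap`. -/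
def moduliMap (B : AdInvariantInner E G) : Moduli E G → Cotangent E G × Cotangent E G :=
  Quot.lift (fun T => fullMap B T.1) fun T T' h => by
    have h1 : hol G (negA T.1) = hol G (negA T'.1) := h.hol_eq.1
    rw [fullMap_eq, fullMap_eq, h1, h.hol_eq.2, h.relInit_eq]

variable (E G) in
/-- The initial data of a solution, as a function on the moduli space. -/
def moduliInit : Moduli E G → E × E × E :=
  Quot.lift (fun T => relInit T.1) fun _ _ h => h.relInit_eq

lemma isOpen_preimage_moduliInit {W : Set (E × E × E)} (hW : IsOpen W) :
    IsOpen (moduliInit E G ⁻¹' W) :=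
  hW.preimage (continuous_quot_lift _ (continuous_relInit.comp continuous_subtype_val))

lemma hol_relPath_eq (T : Config E) : hol G (relPath G T).1 =
    (hol G (negA T))⁻¹ * hol G (-C1Path.val E (T 0 - T 2)) := by
  rw [hol_sub_eq, inv_mul_cancel_left]

lemma relEnd_relInit {T : Config E} (hT : T ∈ Sol E G) : relEnd E G (relInit T) =
    ((relInit T).1, (relInit T).2.1,
      lc E ((hol G (negA T))⁻¹ * hol G (-C1Path.val E (T 0 - T 2)))) := by
  have := FiniteDimensional.complete ℝ E
  rw [relEnd, (isRelSol_relPath hT).relSol_eq, hol_relPath_eq]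

/-- The two image points determine both holonomies, ξ and ξ', hence the value of `relEnd`. Its
injectivity recovers c₀, and equal data with equal holonomy are gauge equivalent. -/
lemma injOn_moduliMap (B : AdInvariantInner E G) {W : Set (E × E × E)}
    (hW : InjOn (relEnd E G) W) : InjOn (moduliMap B) (moduliInit E G ⁻¹' W) := by
  rintro ⟨T⟩ hT ⟨T'⟩ hT' h
  have h0 : fullMap B T.1 = fullMap B T'.1 := h
  rw [fullMap_eq, fullMap_eq] at h0
  obtain ⟨h1, h2⟩ := toCotangent_injective B (congrArg Prod.fst h0)
  obtain ⟨h3, h4⟩ := toCotangent_injective B (congrArg Prod.snd h0)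
  have h5 : relInit T.1 = relInit T'.1 := hW hT hT' (by
    change relEnd E G (relInit T.1) = relEnd E G (relInit T'.1)
    rw [relEnd_relInit T.2, relEnd_relInit T'.2, h1, h2, h3, h4])
  exact Quot.sound (gaugeRel_of_eq h1 h5)

lemma fullMap_ofRel [CompleteSpace E] (B : AdInvariantInner E G) (a : C1Path E) {r : E × E × E}
    (hr : r ∈ relSet E G) : fullMap B (ofRel G (a, r)) =
      (toCotangent B (hol G (C1Path.val E a)) r.1,
        toCotangent B (hol G (C1Path.val E a) * hol G (relSol G r).1) r.2.1) := by
  have h := isRelSol_relPath (ofRel_mem_Sol (G := G) (q := (a, r)) hr)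
  rw [relInit_ofRel] at h
  rw [fullMap_eq, hol_sub_eq, negA_ofRel, relInit_ofRel, ← h.relSol_eq]

/-- The point (γ, ξ) on the diagonal comes from a path with holonomy γ and the data (ξ, ξ, 0), for
which c = 0. -/
lemma diagonal_subset_image (B : AdInvariantInner E G) [ConnectedSpace G] {W : Set (E × E × E)}
    (hW : ∀ x : E, (x, x, (0 : E)) ∈ W) :
    diagonal (Cotangent E G) ⊆ moduliMap B '' (moduliInit E G ⁻¹' W) := by
  have := FiniteDimensional.complete ℝ E
  rintro ⟨p, p'⟩ (rfl : p = p')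
  obtain ⟨ξ, -, hξ⟩ := exists_toCotangent_eq B p
  obtain ⟨α, -, hα⟩ := exists_local_path E p.1
  have hr := diag_mem_relSet (G := G) (ξ p)
  refine ⟨proj E G ⟨_, ofRel_mem_Sol (q := (α p.1, (ξ p, ξ p, 0))) hr⟩, ?_, ?_⟩
  · change relInit (ofRel G (α p.1, (ξ p, ξ p, 0))) ∈ W
    rw [relInit_ofRel]
    exact hW _
  · change fullMap B (ofRel G (α p.1, (ξ p, ξ p, 0))) = (p, p)
    rw [fullMap_ofRel B _ hr, hα.self_of_nhds, relSol_diag, hol_zero, mul_one, hξ.self_of_nhds]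

/-- A local inverse is explicit: choose a path with holonomy γ smoothly, solve the boundary value
problem by the local inverse of `relEnd`, and reconstruct with `ofRel`. It gives both the openness
of the image and the smoothness of the inverse. -/
lemma exists_local_section (B : AdInvariantInner E G) [ConnectedSpace G] {W : Set (E × E × E)}
    (hWo : IsOpen W) {r : ℝ} (hW : W ⊆ relGood E G r) {p : Cotangent E G × Cotangent E G}
    (hp : p ∈ moduliMap B '' (moduliInit E G ⁻¹' W)) :
    ∃ σ : Cotangent E G × Cotangent E G → Config E,
      ContMDiffAt (cotangentModel₂ E) 𝓘(ℝ, Config E) ∞ σ p ∧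
      ∀ᶠ q in 𝓝 p, ∃ h : σ q ∈ Sol E G, proj E G ⟨σ q, h⟩ ∈ moduliInit E G ⁻¹' W ∧
        moduliMap B (proj E G ⟨σ q, h⟩) = q := by
  have := FiniteDimensional.complete ℝ E
  have hG := topologicalGroup_of_lieGroup 𝓘(ℝ, E) ∞ (G := G)
  obtain ⟨⟨T⟩, hT, hTp⟩ := hp
  replace hT : relInit T.1 ∈ W := hT
  replace hTp : fullMap B T.1 = p := hTp
  rw [fullMap_eq] at hTp
  obtain ⟨ξ, hξs, hξ⟩ := exists_toCotangent_eq B p.1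
  obtain ⟨η, hηs, hη⟩ := exists_toCotangent_eq B p.2
  obtain ⟨α, hαs, hα⟩ := exists_local_path E p.1.1
  obtain ⟨g, hgs, hg0, hg⟩ := exists_localInverse_relEnd (hW hT)
  obtain ⟨e1, e2⟩ := toCotangent_injective B (hξ.self_of_nhds.trans (congrArg Prod.fst hTp).symm)
  obtain ⟨e3, e4⟩ := toCotangent_injective B (hη.self_of_nhds.trans (congrArg Prod.snd hTp).symm)
  -- The boundary data of a pair of covectors: both fibre components and the relative holonomy γ⁻¹γ'
  -- in the chart at `1`.
  set R : Cotangent E G × Cotangent E G → E × E × E :=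
    fun q => (ξ q.1, η q.2, lc E ((q.1.1)⁻¹ * q.2.1)) with hR
  have hRp : R p = relEnd E G (relInit T.1) := by
    rw [relEnd_relInit T.2, hR]
    simp only
    rw [e2, e4, e1, e3]
  have p1 : ContMDiffAt (cotangentModel₂ E) 𝓘(ℝ, E) ∞
      (fun q : Cotangent E G × Cotangent E G => q.1.1) p :=
    ContMDiffAt.comp (g := fun c : Cotangent E G => c.1) p (contMDiff_proj _ p.1) contMDiffAt_fst
  have p2 : ContMDiffAt (cotangentModel₂ E) 𝓘(ℝ, E) ∞
      (fun q : Cotangent E G × Cotangent E G => q.2.1) p :=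
    ContMDiffAt.comp (g := fun c : Cotangent E G => c.1) p (contMDiff_proj _ p.2) contMDiffAt_snd
  have p3 : ContMDiffAt (cotangentModel₂ E) 𝓘(ℝ, E) ∞
      (fun q : Cotangent E G × Cotangent E G => (q.1.1)⁻¹ * q.2.1) p := p1.inv.mul p2
  have hl : (p.1.1)⁻¹ * p.2.1 ∈ lsrc E G := by
    obtain ⟨-, h, -⟩ := hW hT
    rwa [(isRelSol_relPath T.2).relSol_eq, hol_relPath_eq, ← e1, ← e3] at h
  have hRs : ContMDiffAt (cotangentModel₂ E) 𝓘(ℝ, E × E × E) ∞ R p :=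
    ContMDiffAt.prodMk_space (ContMDiffAt.comp (g := ξ) p hξs contMDiffAt_fst)
      (ContMDiffAt.prodMk_space (ContMDiffAt.comp (g := η) p hηs contMDiffAt_snd)
        (ContMDiffAt.comp (g := lc E) p (contMDiffAt_lc hl) p3))
  have hgR : ContMDiffAt (cotangentModel₂ E) 𝓘(ℝ, E × E × E) ∞ (fun q => g (R q)) p :=
    ContMDiffAt.comp (g := g) p (hRp ▸ hgs.contMDiffAt) hRs
  have hgp : g (R p) = relInit T.1 := by rw [hRp, hg0]
  have hαp : ContMDiffAt (cotangentModel₂ E) 𝓘(ℝ, C1Path E) ∞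
      (fun q : Cotangent E G × Cotangent E G => α q.1.1) p := ContMDiffAt.comp (g := α) p hαs p1
  refine ⟨fun q => ofRel G (α q.1.1, g (R q)), ?_, ?_⟩
  · exact ContMDiffAt.comp (g := ofRel G) p (contDiffAt_ofRel (by
      change g (R p) ∈ _
      rw [hgp]
      exact (hW hT).1)).contMDiffAt (hαp.prodMk_space hgR)
  · have E1 : ∀ᶠ q in 𝓝 p, toCotangent B q.1.1 (ξ q.1) = q.1 :=
      continuousAt_fst.eventually (p := fun c => toCotangent B c.1 (ξ c) = c) hξ
    have E2 : ∀ᶠ q in 𝓝 p, toCotangent B q.2.1 (η q.2) = q.2 :=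
      continuousAt_snd.eventually (p := fun c => toCotangent B c.1 (η c) = c) hη
    have E3 : ∀ᶠ q in 𝓝 p, hol G (C1Path.val E (α q.1.1)) = q.1.1 :=
      Tendsto.eventually (f := fun q : Cotangent E G × Cotangent E G => q.1.1) p1.continuousAt hα
    have E4 : ∀ᶠ q in 𝓝 p, relEnd E G (g (R q)) = R q :=
      Tendsto.eventually (f := R) hRs.continuousAt (hRp ▸ hg)
    have E5 : ∀ᶠ q in 𝓝 p, g (R q) ∈ W :=
      hgR.continuousAt.eventually (hWo.mem_nhds (by simpa only [hgp] using hT))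
    have E6 : ∀ᶠ q in 𝓝 p, (q.1.1)⁻¹ * q.2.1 ∈ lsrc E G :=
      Tendsto.eventually (f := fun q : Cotangent E G × Cotangent E G => (q.1.1)⁻¹ * q.2.1)
        p3.continuousAt (isOpen_lsrc.mem_nhds hl)
    filter_upwards [E1, E2, E3, E4, E5, E6] with q h1 h2 h3 h4 h5 h6
    have hr := (hW h5).1
    refine ⟨ofRel_mem_Sol hr, ?_, ?_⟩
    · change relInit (ofRel G (α q.1.1, g (R q))) ∈ W
      rwa [relInit_ofRel]
    · change fullMap B (ofRel G (α q.1.1, g (R q))) = q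
      have f1 : (g (R q)).1 = ξ q.1 := congrArg Prod.fst h4
      have f2 : (g (R q)).2.1 = η q.2 := congrArg (fun r => r.2.1) h4
      have f3 : lc E (hol G (relSol G (g (R q))).1) = lc E ((q.1.1)⁻¹ * q.2.1) :=
        congrArg (fun r => r.2.2) h4
      have f4 : hol G (relSol G (g (R q))).1 = (q.1.1)⁻¹ * q.2.1 := by
        rw [← li_lc (hW h5).2.1, f3, li_lc h6]
      rw [fullMap_ofRel B _ hr, h3, f1, f2, f4, mul_inv_cancel_left, h1, h2]

lemma isSmoothExtensionAt_fullMap (B : AdInvariantInner E G) (T : Sol E G) :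
    IsSmoothExtensionAt (cotangentModel₂ E) (moduliMap B) T (fullMap B) :=
  ⟨contMDiff_fullMap B _, Eventually.of_forall fun _ _ => rfl⟩

lemma isDiffeoOn_moduliMap (B : AdInvariantInner E G) [ConnectedSpace G] {W : Set (E × E × E)}
    (hWo : IsOpen W) {r : ℝ} (hW : W ⊆ relGood E G r) (hinj : InjOn (relEnd E G) W) :
    IsDiffeoOn (cotangentModel₂ E) (moduliMap B) (moduliInit E G ⁻¹' W)
      (moduliMap B '' (moduliInit E G ⁻¹' W)) := by
  refine ⟨isOpen_preimage_moduliInit hWo, isOpen_iff_mem_nhds.2 fun p hp => ?_,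
    (injOn_moduliMap B hinj).bijOn_image, fun T _ => ⟨_, isSmoothExtensionAt_fullMap B T⟩,
    fun p hp => exists_local_section B hWo hW hp⟩
  obtain ⟨σ, -, hσ⟩ := exists_local_section B hWo hW hp
  filter_upwards [hσ] with q ⟨h, h1, h2⟩
  exact ⟨_, h1, h2⟩

/-- T₂ = T₃ = 0 forces equal initial values of T₁ ± T₃ and c₀ = 0, which is a diagonal datum. -/
lemma Z_subset {W : Set (E × E × E)} (hW : ∀ x : E, (x, x, (0 : E)) ∈ W) :
    Z E G ⊆ moduliInit E G ⁻¹' W := by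
  rintro _ ⟨T, ⟨h2, h3⟩, rfl⟩
  change relInit T.1 ∈ W
  have h : relInit T.1 = (ev (T.1 1) 0, ev (T.1 1) 0, 0) := by
    rw [relInit, h2, h3, add_zero, sub_zero, smul_zero]
    rfl
  rw [h]
  exact hW _

lemma preimage_moduliInit_subset_M0 (B : AdInvariantInner E G) {r : ℝ}
    (hr : ∀ y : E, ‖y‖ < r → IsSmall B y) {W : Set (E × E × E)} (hW : W ⊆ relGood E G r) :
    moduliInit E G ⁻¹' W ⊆ M0 B := by
  rintro ⟨T⟩ hT
  exact ⟨T, not_mem_degeneracyLocus_of_relGood B hr T.2 (hW hT), rfl⟩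

end ModuliMap

end

end NahmSchmid

theorem mainTheorem4 {E : Type*} [NormedAddCommGroup E] [NormedSpace ℝ E] [FiniteDimensional ℝ E]
    {G : Type*} [TopologicalSpace G] [ChartedSpace E G] [Group G] [LieGroup 𝓘(ℝ, E) ∞ G]
    [CompactSpace G] [ConnectedSpace G] (B : NahmSchmid.AdInvariantInner E G) :
    ∃ Φ : NahmSchmid.Moduli E G → NahmSchmid.Cotangent E G × NahmSchmid.Cotangent E G,
      -- `Φ` is the map induced by `P`
      (∀ T : NahmSchmid.Sol E G,
        NahmSchmid.IsCotangentPoint B (NahmSchmid.mapP T.1).1 (Φ (NahmSchmid.proj E G T)).1 ∧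
        NahmSchmid.IsCotangentPoint B (NahmSchmid.mapP T.1).2 (Φ (NahmSchmid.proj E G T)).2) ∧
      ∃ (U : Set (NahmSchmid.Moduli E G))
        (V : Set (NahmSchmid.Cotangent E G × NahmSchmid.Cotangent E G)),
        NahmSchmid.Z E G ⊆ U ∧ U ⊆ NahmSchmid.M0 B ∧ Set.diagonal _ ⊆ V ∧
        NahmSchmid.IsDiffeoOn (NahmSchmid.cotangentModel₂ E) Φ U V ∧
        -- the differential of `Φ` at `[T]` (that of a smooth extension `F` of `Φ` near `T`) is
        -- symplectic and intertwines the product structures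
        ∀ T : NahmSchmid.Sol E G, NahmSchmid.proj E G T ∈ U →
          ∃ F, NahmSchmid.IsSmoothExtensionAt (NahmSchmid.cotangentModel₂ E) Φ T F ∧
            (∀ X ∈ NahmSchmid.Horizontal G T.1, ∀ Y ∈ NahmSchmid.Horizontal G T.1,
              NahmSchmid.omegaCot₂ E G (F T.1)
                (mfderiv 𝓘(ℝ, NahmSchmid.Config E) (NahmSchmid.cotangentModel₂ E) F T.1 X)
                (mfderiv 𝓘(ℝ, NahmSchmid.Config E) (NahmSchmid.cotangentModel₂ E) F T.1 Y)
              = NahmSchmid.omegaI B X Y) ∧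
            (∀ X ∈ NahmSchmid.Horizontal G T.1,
              NahmSchmid.prodS X ∈ NahmSchmid.Horizontal G T.1 ∧
              mfderiv 𝓘(ℝ, NahmSchmid.Config E) (NahmSchmid.cotangentModel₂ E) F T.1
                (NahmSchmid.prodS X)
              = NahmSchmid.prodCot E G (F T.1)
                (mfderiv 𝓘(ℝ, NahmSchmid.Config E) (NahmSchmid.cotangentModel₂ E) F T.1 X)) := by
  obtain ⟨r, hr, hsmall⟩ := NahmSchmid.exists_isSmall B
  obtain ⟨W, hWo, hdiag, hW, hinj⟩ := NahmSchmid.exists_relDom B hr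
  refine ⟨NahmSchmid.moduliMap B, fun T => ?_, NahmSchmid.moduliInit E G ⁻¹' W,
    NahmSchmid.moduliMap B '' (NahmSchmid.moduliInit E G ⁻¹' W), NahmSchmid.Z_subset hdiag,
    NahmSchmid.preimage_moduliInit_subset_M0 B hsmall hW, NahmSchmid.diagonal_subset_image B hdiag,
    NahmSchmid.isDiffeoOn_moduliMap B hWo hW hinj, fun T _ =>
    ⟨NahmSchmid.fullMap B, NahmSchmid.isSmoothExtensionAt_fullMap B T,
      fun X hX Y hY => NahmSchmid.omegaCot₂_mfderiv_fullMap B T.2 hX hY,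
      fun X hX => ⟨NahmSchmid.prodS_mem_Horizontal hX, NahmSchmid.mfderiv_fullMap_prodS B T.1 X⟩⟩⟩
  change NahmSchmid.IsCotangentPoint B _ (NahmSchmid.fullMap B T.1).1 ∧
    NahmSchmid.IsCotangentPoint B _ (NahmSchmid.fullMap B T.1).2
  rw [NahmSchmid.fullMap_eq]
  exact ⟨NahmSchmid.isCotangentPoint_toCotangent B _ _,
    NahmSchmid.isCotangentPoint_toCotangent B _ _⟩
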